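/- Let $T>0$ and let $H\in C^2([0,T]\times T^*\mathbb R^d)$, $(t,x,p)\mapsto H(t,x,p)$, be strictly convex in $p$ and equal to $|p|^2$ off a compact subset of $[0,T]\times T^*\mathbb R^d$. Let $\varphi_s^t=(X_s^t,Y_s^t)$ be the Hamiltonian flow of $\dot x=\partial_pH$, $\dot p=-\partial_xH$ from time $s$ to time $t$, let $c_H=\sup_{t,x,p}|D^2H_t(x,p)|$ (supremum over $[0,T]\times T^*\mathbb R^d$), and let $C^{\rm Lip}(\mathbb R^d)$ be the set of globally Lipschitz functions $\mathbb R^d\to\mathbb R$. *The minmax operators.* For $0\le s\le t\le T$ with $c_H(t-s)<\ln 2$ put $$\phi_s^t(X,y)=\int_s^t\big((Y^\tau-y)\cdot\dot X^\tau-H(\tau,X^\tau,Y^\tau)\big)\,d\tau,$$ where $(X^\tau,Y^\tau)=\varphi_s^\tau(x,y)$ and $x$ is the unique point with $X_s^t(x,y)=X$. For $0\le s\le t\le T$, a subdivision $s=t_0<\dots<t_N=t$ with $c_H(t_{i+1}-t_i)<\ln 2$ for all $i$, and $v\in C^{\rm Lip}(\mathbb R^d)$, let $$S(x;\eta)=v(x_0)+\sum_{0\le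 i<N}\phi_{t_i}^{t_{i+1}}(x_{i+1},y_i)+\sum_{0\le i<N}(x_{i+1}-x_i)\cdot y_i,\qquad x_N:=x,\quad \eta=(x_i,y_i)_{0\le i<N}.$$ A function $f$ on $\mathbb R^k$ is quadratic at infinity if $f-Q$ is globally Lipschitz for some nondegenerate quadratic form $Q$; if $k_\infty$ is the Morse index of $Q$, its minmax is $\inf_\sigma\max_{|\sigma|}f$, where $\sigma$ runs over the relative singular cycles with coefficients in $\mathbb Z/2$ that represent the generator of $H_{k_\infty}(\{f\le a\},\{f\le -a\};\mathbb Z/2)\simeq\mathbb Z/2$, $a$ large, and $|\sigma|$ is the image of $\sigma$. Let $R_s^tv(x)$ be the minmax of $S(x;\cdot)$; the function $(t,x)\mapsto R_0^tv(x)$ is the minmax solution of $\partial_tu+H(t,x,\partial_xu)=0$, $u(0,\cdot)=v$. Then: 1. The minmax $R_s^tv(x)$ exists, does not depend on the subdivision, and $R_s^tv\in C^{\rm Lip}(\mathbb R^d)$ for all $0\le s\le t\le T$ and $v\in C^{\rm Lip}(\mathbb R^d)$. 2. The minmax is reduced to a min: there is $\varepsilon>0$, depending only on $H$ and $T$, with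 the following properties. If $0\le s<t\le T$ and $t-s<\varepsilon$, then for all $x,X\in\mathbb R^d$ there is a unique solution $(X^\tau,Y^\tau)_{s\le\tau\le t}$ of Hamilton's equations with $X^s=x$, $X^t=X$; its action $$\psi_s^t(X,x)=\int_s^t\big(Y^\tau\cdot\dot X^\tau-H(\tau,X^\tau,Y^\tau)\big)\,d\tau$$ is a $C^1$ function of $(X,x)$, and $\varphi_s^t(x,y)=(X,Y)$ if and only if $Y=\partial_X\psi_s^t(X,x)$ and $y=-\partial_x\psi_s^t(X,x)$. For all $0\le s<t\le T$, all $v\in C^{\rm Lip}(\mathbb R^d)$ and every subdivision $s=\tau_0<\dots<\tau_N=t$ with steps smaller than $\varepsilon$, the function $$F(x;(x_i)_{0\le i<N})=v(x_0)+\sum_{0\le i<N}\psi_{\tau_i}^{\tau_{i+1}}(x_{i+1},x_i),\qquad x_N:=x,$$ is locally Lipschitz and is a generating family of $\varphi_s^t(\partial v)$, where $\partial v=\{(x,p):p\in\partial v(x)\}$; that is, $\varphi_s^t(\partial v)=\{(x,y):\exists\,\eta,\ (y,0)\in\partial F(x;\eta)\}$, with $\partial$ the Clarke generalized derivative. Moreover,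 for every $x\in\mathbb R^d$, the minimum is attained and $$R_s^tv(x)=\min_{(x_i)_{0\le i<N}}F(x;(x_i)).$$ 3. Semigroup property: for all $v\in C^{\rm Lip}(\mathbb R^d)$ and $0\le s\le t\le T$, $$R_0^tv=R_s^t\circ R_0^sv.$$ -/

import Mathlib

open Set Filter Topology
open scoped NNReal

noncomputable section

namespace HJ

/-! ### Singular chains with coefficients in `ℤ/2` and the minmax of a function -/

section Minmax

variable {V : Type*} [NormedAddCommGroup V] [NormedSpace ℝ V]

/-- A singular `n`-simplex of `V`: a continuous map from the standard `n`-simplex to `V`. -/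
abbrev SingularSimplex (V : Type*) [TopologicalSpace V] (n : ℕ) : Type _ :=
  C(stdSimplex ℝ (Fin (n + 1)), V)

/-- Singular `n`-chains of `V` with coefficients in `ℤ/2`. -/
abbrev Chain (V : Type*) [TopologicalSpace V] (n : ℕ) : Type _ :=
  SingularSimplex V n →₀ ZMod 2

/-- The `i`-th face of a singular simplex. -/
def face {n : ℕ} (i : Fin (n + 2)) (σ : SingularSimplex V (n + 1)) : SingularSimplex V n :=
  σ.comp ⟨stdSimplex.map (Fin.succAbove i), stdSimplex.continuous_map _⟩

/-- The singular boundary operator modulo 2, from `(n+1)`-chains to `n`-chains. -/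
def boundary {n : ℕ} (c : Chain V (n + 1)) : Chain V n :=
  c.sum fun σ r => ∑ i, Finsupp.single (face i σ) r

/-- The image `|c|` of a singular chain: the union of the images of its simplices. -/
def chainImage {n : ℕ} (c : Chain V n) : Set V :=
  ⋃ σ ∈ c.support, range σ

/-- The sublevel set `{f ≤ a}`. -/
def sublevel (f : V → ℝ) (a : ℝ) : Set V := {η | f η ≤ a}

/-- The boundary of the chain `σ` is contained in `A` (this is automatic in degree `0`, as there are
no chains of degree `-1`). -/
def BoundaryIn (A : Set V) : {k : ℕ} → Chain V k → Prop
  | 0, _ => True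
  | _ + 1, σ => chainImage (boundary σ) ⊆ A

/-- `σ` is a relative `k`-cycle of the pair `(f^a, f^{-a})` whose class in
`H_k(f^a, f^{-a}; ℤ/2)` is not zero. For `f` quadratic at infinity of index `k` and `a` large, that
group is isomorphic to `ℤ/2`, and so this says that the class of `σ` is its generator. -/
def IsDescendingCycle (f : V → ℝ) (k : ℕ) (a : ℝ) (σ : Chain V k) : Prop :=
  chainImage σ ⊆ sublevel f a ∧
  BoundaryIn (sublevel f (-a)) σ ∧
  ¬ ∃ τ : Chain V (k + 1), chainImage τ ⊆ sublevel f a ∧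
      chainImage (σ + boundary τ) ⊆ sublevel f (-a)

/-- The function `f` is quadratic at infinity, with quadratic part `Q`: the quadratic form `Q` is
nondegenerate and `f - Q` is globally Lipschitz. -/
def IsQuadraticAtInfinity (f : V → ℝ) (Q : QuadraticForm ℝ V) : Prop :=
  (QuadraticMap.associated (R := ℝ) Q).SeparatingLeft ∧
  ∃ C : ℝ≥0, LipschitzWith C fun η => f η - Q η

/-- `c` is the minmax of `f`: the function `f` is quadratic at infinity and `c` is the infimum,
over the descending cycles `σ` of `(f^∞, f^{-∞})` (that is, of `(f^a, f^{-a})` for `a` large)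
of dimension the Morse index of the quadratic part, of the maximum of `f` on `|σ|`. -/
def IsMinmax (f : V → ℝ) (c : ℝ) : Prop :=
  ∃ Q : QuadraticForm ℝ V, IsQuadraticAtInfinity f Q ∧
    ∀ᶠ a : ℝ in atTop,
      IsGLB {m : ℝ | ∃ σ : Chain V (sigNeg Q),
        IsDescendingCycle f (sigNeg Q) a σ ∧
        IsGreatest (f '' chainImage σ) m} c

/-- The Clarke generalized derivative of `f` at `a`: the convex hull of the set of limits of
sequences `df(u_n)` with `u_n → a`, where `f` is differentiable at every `u_n`. -/
def clarke (f : V → ℝ) (a : V) : Set (V →L[ℝ] ℝ) :=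
  convexHull ℝ {l | ∃ u : ℕ → V, (∀ n, DifferentiableAt ℝ f (u n)) ∧
    Tendsto u atTop (𝓝 a) ∧ Tendsto (fun n => fderiv ℝ f (u n)) atTop (𝓝 l)}

end Minmax

/-- The Euclidean space `ℝ^d`. -/
abbrev E (d : ℕ) : Type := EuclideanSpace ℝ (Fin d)

variable {d : ℕ}

/-- `v` belongs to `C^Lip(ℝ^d)`: it is globally Lipschitz. -/
def IsLip (v : E d → ℝ) : Prop := ∃ C : ℝ≥0, LipschitzWith C v

/-! ### The Hamiltonian flow

A Hamiltonian is `H : ℝ → E d → E d → ℝ`, `(t, x, p) ↦ H t x p`; only its values for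
`t ∈ [0, T]` are used. -/

/-- The constant `c_H`: the supremum of `|D²H_t(x,p)|` over `t ∈ [0,T]` and `(x,p) ∈ T*ℝ^d`, where
`ℝ^d × ℝ^d` carries the Euclidean norm and `|·|` is the operator norm. -/
def cH (H : ℝ → E d → E d → ℝ) (T : ℝ) : ℝ :=
  sSup {r | ∃ t ∈ Icc 0 T, ∃ z : WithLp 2 (E d × E d),
    r = ‖fderiv ℝ (fderiv ℝ fun w : WithLp 2 (E d × E d) => H t w.fst w.snd) z‖}

/-- The Hamiltonian vector field `X_{H_t} = (∂_p H, -∂_x H)`. -/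
def hamField (H : ℝ → E d → E d → ℝ) (t : ℝ) (z : E d × E d) : E d × E d :=
  (gradient (fun p => H t z.1 p) z.2, -gradient (fun x => H t x z.2) z.1)

/-- `γ` is a solution on `[0,T]` of Hamilton's equations. -/
def IsCharacteristic (H : ℝ → E d → E d → ℝ) (T : ℝ) (γ : ℝ → E d × E d) : Prop :=
  ∀ τ ∈ Icc 0 T, HasDerivWithinAt γ (hamField H τ (γ τ)) (Icc 0 T) τ

/-- `flow H T s t = φ_H^{s,t}`: its value at `z` is the value at time `t` of the solution on `[0,T]`
of Hamilton's equations that equals `z` at time `s`. -/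
def flow (H : ℝ → E d → E d → ℝ) (T s t : ℝ) (z : E d × E d) : E d × E d :=
  Classical.epsilon (fun γ : ℝ → E d × E d => IsCharacteristic H T γ ∧ γ s = z) t

/-- The map `α_s^t : (x, y) ↦ (X_s^t(x, y), y)`, where `(X_s^t, Y_s^t) = φ_H^{s,t}`. -/
def alpha (H : ℝ → E d → E d → ℝ) (T s t : ℝ) (z : E d × E d) : E d × E d :=
  ((flow H T s t z).1, z.2)

/-- The generating function of `φ_H^{s,t}`,
`φ_s^t(X, y) = ∫_s^t ((Y^τ - y)·Ẋ^τ - H(τ, X^τ, Y^τ)) dτ`,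
where `(X^τ, Y^τ) = φ_H^{s,τ} ((α_s^t)⁻¹ (X, y))`; along this curve `Ẋ^τ = ∂_p H(τ, X^τ, Y^τ)`. -/
def genFun (H : ℝ → E d → E d → ℝ) (T s t : ℝ) (X y : E d) : ℝ :=
  let z₀ := Function.invFun (alpha H T s t) (X, y)
  ∫ τ in s..t, (inner ℝ ((flow H T s τ z₀).2 - y) (hamField H τ (flow H T s τ z₀)).1
    - H τ (flow H T s τ z₀).1 (flow H T s τ z₀).2)

/-! ### The generating family and the minmax solution -/

/-- `τ 0 < ⋯ < τ N` is a subdivision of `[s,t]`. The only subdivision of `[s,s]` has `N = 0`. -/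
def IsSubdivision (s t : ℝ) {N : ℕ} (τ : Fin (N + 1) → ℝ) : Prop :=
  StrictMono τ ∧ τ 0 = s ∧ τ (Fin.last N) = t

/-- The points `x_0, …, x_{N-1}, x_N` with `x_N := x`. -/
def nodes {N : ℕ} (x : E d) (q : Fin N → E d) : Fin (N + 1) → E d :=
  Fin.snoc (α := fun _ => E d) q x

/-- The generating family
`S(x; η) = v(x_0) + ∑_{i<N} φ_H^{τ_i,τ_{i+1}}(x_{i+1}, y_i) + ∑_{i<N} (x_{i+1} - x_i)·y_i`, with
`x_N := x` and `η = ((x_i, y_i))_{i<N}`. (For `N = 0` this is `S(x) = v(x)`.) -/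
def genFamily (H : ℝ → E d → E d → ℝ) (T : ℝ) {N : ℕ} (τ : Fin (N + 1) → ℝ) (v : E d → ℝ)
    (x : E d) (η : Fin N → E d × E d) : ℝ :=
  let X := nodes x fun i => (η i).1
  v (X 0) + ∑ i : Fin N, genFun H T (τ i.castSucc) (τ i.succ) (X i.succ) (η i).2
    + ∑ i : Fin N, inner ℝ (X i.succ - X i.castSucc) (η i).2

/-- A subdivision of `[s,t]` with steps `< δ_H = c_H⁻¹ ln 2`. -/
def IsAdmissible (H : ℝ → E d → E d → ℝ) (T s t : ℝ) {N : ℕ} (τ : Fin (N + 1) → ℝ) : Prop :=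
  IsSubdivision s t τ ∧ ∀ i : Fin N, cH H T * (τ i.succ - τ i.castSucc) < Real.log 2

/-- `c` is the minmax of `S(x; ·)` for each admissible subdivision of `[s,t]`. -/
def IsMinmaxValue (H : ℝ → E d → E d → ℝ) (T s t : ℝ) (v : E d → ℝ) (x : E d) (c : ℝ) : Prop :=
  ∀ (N : ℕ) (τ : Fin (N + 1) → ℝ), IsAdmissible H T s t τ → IsMinmax (genFamily H T τ v x) c

/-- The minmax operator `R_s^t`: the value `R_s^t v(x)` is the minmax of `S(x; ·)`, the same for
every admissible subdivision of `[s,t]`. -/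
def minmaxOp (H : ℝ → E d → E d → ℝ) (T s t : ℝ) (v : E d → ℝ) (x : E d) : ℝ :=
  Classical.epsilon fun c => IsMinmaxValue H T s t v x c

/-! ### Classical generating functions and the min family -/

/-- `ψ(X, x)` is a classical generating function of `φ : T*ℝ^d → T*ℝ^d`: it is `C¹`, and
`φ(x, y) = (X, Y)` if and only if `Y = ∂_X ψ(X, x)` and `y = -∂_x ψ(X, x)`. -/
def IsClassicalGenFun (φ : E d × E d → E d × E d) (ψ : E d → E d → ℝ) : Prop :=
  ContDiff ℝ 1 (fun w : E d × E d => ψ w.1 w.2) ∧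
  ∀ x y X Y : E d, φ (x, y) = (X, Y) ↔
    Y = gradient (fun X' => ψ X' x) X ∧ y = -gradient (fun x' => ψ X x') x

/-- The classical generating function of `φ_H^{s,t}` for small `t - s`: the value `ψ_s^t(X, x)` is
the action `∫_s^t (Y^τ·Ẋ^τ - H(τ, X^τ, Y^τ)) dτ` of the solution `(X^τ, Y^τ)` of Hamilton's
equations with `X^s = x` and `X^t = X`. -/
def classicalGenFun (H : ℝ → E d → E d → ℝ) (T s t : ℝ) (X x : E d) : ℝ :=
  let z₀ := (x, Function.invFun (fun y => (flow H T s t (x, y)).1) X)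
  ∫ τ in s..t, (inner ℝ (flow H T s τ z₀).2 (hamField H τ (flow H T s τ z₀)).1
    - H τ (flow H T s τ z₀).1 (flow H T s τ z₀).2)

/-- The family `F(x; (x_i)_{i<N}) = v(x_0) + ∑_{i<N} ψ_{τ_i}^{τ_{i+1}}(x_{i+1}, x_i)`, with
`x_N := x`. -/
def minFamily (H : ℝ → E d → E d → ℝ) (T : ℝ) {N : ℕ} (τ : Fin (N + 1) → ℝ) (v : E d → ℝ)
    (x : E d) (q : Fin N → E d) : ℝ :=
  v (nodes x q 0) + ∑ i : Fin N,
    classicalGenFun H T (τ i.castSucc) (τ i.succ) (nodes x q i.succ) (nodes x q i.castSucc)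

/-- The generalized graph `∂v = {(x, p) : p ∈ ∂v(x)} ⊆ T*ℝ^d`, a vector `p` standing for the linear
form `⟨p, ·⟩`. -/
def clarkeGraph (v : E d → ℝ) : Set (E d × E d) :=
  {z | innerSL ℝ z.2 ∈ clarke v z.1}

/-- The (locally) Lipschitz family `S : ℝ^d × W → ℝ` is a generating family for `L ⊆ T*ℝ^d`:
`L = {(x, y) : ∃ η, (y, 0) ∈ ∂S(x, η)}`. -/
def IsGeneratingFamily {W : Type*} [NormedAddCommGroup W] [NormedSpace ℝ W]
    (S : E d → W → ℝ) (L : Set (E d × E d)) : Prop :=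
  LocallyLipschitz (fun w : E d × W => S w.1 w.2) ∧
  L = {z | ∃ η : W, (innerSL ℝ z.2).comp (ContinuousLinearMap.fst ℝ (E d) W) ∈
    clarke (fun w : E d × W => S w.1 w.2) (z.1, η)}

end HJ

end

/-! Write h = t - s. When c_H h < ln 2, two orbits separate by at most e^{c_H h} - 1 < 1 times their
initial distance, so the flow (x, y) ↦ (X, Y) admits (X, y) as coordinates, and its generating
function satisfies dφ = (Y - y)·dX + (x - X)·dy. Convexity of H in p gives ⟨y' - y, x' - x⟩ ≤ 0 for
two orbits with the same endpoint X (`inner_nonpos_of_fst_eq`). Hence, for fixed X and x, the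
function y ↦ φ(X, y) + (X - x)·y, whose gradient is x(X, y) - x, is concave; at infinity it behaves
like -h|y|². It has a maximum, and strict convexity makes the maximiser unique (`snd_eq_of_fst_eq`):
it is the initial momentum of the orbit from x to X, and the maximal value is the action ψ(X, x).

So, with the x_i fixed, S(x; ·) decreases to -∞ along every ray from a point m of the space of the
y_i, where m depends continuously on the x_i and S takes there the value F(x; (x_i)). The minmax of
such a function in the dimension of the fibre is the minimum of F (`isGLB_descendingCycles`). A
large simplex in the fibre over a minimum point of F, centred at m, is a descending cycle whose
maximum is min F. Conversely a cycle strictly below min F misses the graph of m, and sliding it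
outwards along the rays brings it into {f ≤ -a}, so its class is zero. That the simplex itself is
not trivial is Sperner's lemma, in the form of a functional on mod 2 chains that kills boundaries
and chains off the graph of m but takes the value 1 on the simplex
(`not_chainImage_subset_of_labels`).

What remains concerns minima. The minimum of F is an iteration of one-step minima v ↦ min_x (v(x) +
ψ(·, x)). At a minimising intermediate point the first order condition matches the momenta of two
orbit pieces, so ψ over a short interval is the minimum of the sum of its values over two halves
(`isLeast_actionGenFun_comp`). Independence of the subdivision (`iterMin_eq`) and the semigroup
property follow, and the Lipschitz property comes from translating both ends of an orbit. A function
determines its quadratic part, so its minmax is unique (`isMinmax_unique`), which identifies the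
operator with the iterated minimum.

Finally F is v(x_0) plus a function of class C¹, so its Clarke derivative is known exactly
(`clarke_comp_add`). Its vanishing in the variables x_i says that the pieces join into one orbit
issued from ∂v. -/

noncomputable section

namespace HJ

/-! ### Chains of tuples modulo 2 -/

section TupleChains

variable {L L' L'' : Type*}

/-- Chains modulo 2 on the `(n+1)`-tuples of elements of `L`. -/
abbrev TupleChain (L : Type*) (n : ℕ) : Type _ := (Fin (n + 1) → L) →₀ ZMod 2

/-- The boundary of a chain of tuples. -/
def tupleBoundary {n : ℕ} : TupleChain L (n + 1) →ₗ[ZMod 2] TupleChain L n :=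
  Finsupp.linearCombination (ZMod 2) fun v => ∑ i : Fin (n + 2), Finsupp.single (v ∘ i.succAbove) 1

/-- The chain map induced by a map of vertices. -/
def tupleMap (f : L → L') {n : ℕ} : TupleChain L n →ₗ[ZMod 2] TupleChain L' n :=
  Finsupp.lmapDomain _ _ (f ∘ ·)

/-- The cone with vertex `b`. -/
def tupleCone (b : L) {n : ℕ} : TupleChain L n →ₗ[ZMod 2] TupleChain L (n + 1) :=
  Finsupp.lmapDomain _ _ fun v => (Fin.cons b v : Fin (n + 2) → L)

/-- The number modulo 2 of the tuples of a chain. -/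
def tupleAug {n : ℕ} : TupleChain L n →ₗ[ZMod 2] ZMod 2 :=
  Finsupp.linearCombination (ZMod 2) fun _ => 1

@[simp] lemma tupleBoundary_single {n : ℕ} (v : Fin (n + 2) → L) :
    tupleBoundary (Finsupp.single v 1) =
      ∑ i : Fin (n + 2), Finsupp.single (v ∘ i.succAbove) (1 : ZMod 2) := by
  simp [tupleBoundary]

@[simp] lemma tupleMap_single (f : L → L') {n : ℕ} (v : Fin (n + 1) → L) (r : ZMod 2) :
    tupleMap f (Finsupp.single v r) = Finsupp.single (f ∘ v) r := by
  simp [tupleMap]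

@[simp] lemma tupleCone_single (b : L) {n : ℕ} (v : Fin (n + 1) → L) (r : ZMod 2) :
    tupleCone b (Finsupp.single v r) = Finsupp.single (Fin.cons b v : Fin (n + 2) → L) r := by
  simp [tupleCone]

@[simp] lemma tupleAug_single {n : ℕ} (v : Fin (n + 1) → L) :
    tupleAug (Finsupp.single v 1) = 1 := by
  simp [tupleAug]

lemma tupleChain_add_self {n : ℕ} (x : TupleChain L n) : x + x = 0 := by
  ext v; simpa using CharTwo.add_self_eq_zero (x v)

/-- Linear maps on chains of tuples agree when they agree on tuples. -/
lemma tuple_hom_ext {M : Type*} [AddCommMonoid M] [Module (ZMod 2) M] {n : ℕ}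
    {f g : TupleChain L n →ₗ[ZMod 2] M}
    (h : ∀ v, f (Finsupp.single v 1) = g (Finsupp.single v 1)) : f = g := by
  ext v; simpa using h v

lemma cons_comp_succAbove_succ {n : ℕ} (b : L) (v : Fin (n + 2) → L) (i : Fin (n + 2)) :
    (Fin.cons b v : Fin (n + 3) → L) ∘ i.succ.succAbove =
      (Fin.cons b (v ∘ i.succAbove) : Fin (n + 2) → L) := by
  ext j
  refine Fin.cases ?_ (fun j => ?_) j
  · simp
  · simp

/-- The face opposite `b` is the base and the other faces are cones over faces of the base; no signs
occur modulo 2. -/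
lemma tupleBoundary_cone {n : ℕ} (b : L) (x : TupleChain L (n + 1)) :
    tupleBoundary (tupleCone b x) = x + tupleCone b (tupleBoundary x) := by
  have : tupleBoundary.comp (tupleCone b) = LinearMap.id +
      (tupleCone b).comp (tupleBoundary (L := L) (n := n)) := by
    refine tuple_hom_ext fun v => ?_
    simp only [LinearMap.comp_apply, tupleCone_single, tupleBoundary_single, LinearMap.add_apply,
      LinearMap.id_apply, map_sum]
    rw [Fin.sum_univ_succ]
    congr 1
    exact Finset.sum_congr rfl fun i _ => by rw [cons_comp_succAbove_succ]
  exact LinearMap.congr_fun this x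

/-- Deleting the only vertex of a point leaves `b`, so the degree 0 cone formula carries an
augmentation term. -/
lemma tupleBoundary_cone_zero (b : L) (x : TupleChain L 0) :
    tupleBoundary (tupleCone b x) = x + tupleAug x • Finsupp.single (fun _ => b) 1 := by
  have : tupleBoundary.comp (tupleCone b) = LinearMap.id +
      (tupleAug (L := L) (n := 0)).smulRight (Finsupp.single (fun _ => b) 1) := by
    refine tuple_hom_ext fun v => ?_
    simp only [LinearMap.comp_apply, tupleCone_single, tupleBoundary_single, LinearMap.add_apply,
      LinearMap.id_apply, LinearMap.smulRight_apply, tupleAug_single, one_smul]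
    rw [Fin.sum_univ_succ, Fin.sum_univ_one]
    congr 2
    ext j
    fin_cases j
    rfl
  exact LinearMap.congr_fun this x

lemma tupleAug_boundary (x : TupleChain L 1) : tupleAug (tupleBoundary x) = 0 := by
  have : tupleAug.comp tupleBoundary = (0 : TupleChain L 1 →ₗ[ZMod 2] ZMod 2) := by
    refine tuple_hom_ext fun v => ?_
    simp [Fin.sum_univ_two]
    decide
  exact LinearMap.congr_fun this x

/-- Every tuple is the cone over its tail with vertex its head, so the cone formula gives ∂∂(b·x) =
∂x + ∂x + b·∂∂x and reduces the degree. -/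
lemma tupleBoundary_boundary {n : ℕ} (x : TupleChain L (n + 2)) :
    tupleBoundary (tupleBoundary x) = 0 := by
  have : tupleBoundary.comp tupleBoundary = (0 : TupleChain L (n + 2) →ₗ[ZMod 2] _) := by
    clear x
    induction n with
    | zero =>
      refine tuple_hom_ext fun v => ?_
      rw [LinearMap.comp_apply, ← Fin.cons_self_tail v, ← tupleCone_single, tupleBoundary_cone,
        map_add, tupleBoundary_cone_zero, tupleAug_boundary, zero_smul, add_zero,
        tupleChain_add_self, LinearMap.zero_apply]
    | succ n ih =>
      refine tuple_hom_ext fun v => ?_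
      rw [LinearMap.comp_apply, ← Fin.cons_self_tail v, ← tupleCone_single, tupleBoundary_cone,
        map_add, tupleBoundary_cone, ← LinearMap.comp_apply tupleBoundary tupleBoundary, ih,
        LinearMap.zero_apply, map_zero, add_zero, tupleChain_add_self, LinearMap.zero_apply]
  exact LinearMap.congr_fun this x

lemma tupleMap_boundary (f : L → L') {n : ℕ} (x : TupleChain L (n + 1)) :
    tupleMap f (tupleBoundary x) = tupleBoundary (tupleMap f x) := by
  have : (tupleMap f).comp tupleBoundary =
      tupleBoundary.comp (tupleMap f (n := n + 1)) := by
    refine tuple_hom_ext fun v => ?_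
    simp [Function.comp_assoc]
  exact LinearMap.congr_fun this x

lemma tupleMap_cone (f : L → L') {n : ℕ} (b : L) (x : TupleChain L n) :
    tupleMap f (tupleCone b x) = tupleCone (f b) (tupleMap f x) := by
  have : (tupleMap f).comp (tupleCone b) =
      (tupleCone (f b)).comp (tupleMap f (n := n)) := by
    refine tuple_hom_ext fun v => ?_
    simp only [LinearMap.comp_apply, tupleCone_single, tupleMap_single]
    congr 1
    ext j
    refine Fin.cases ?_ (fun j => ?_) j <;> simp
  exact LinearMap.congr_fun this x

lemma tupleMap_map (f : L → L') (g : L' → L'') {n : ℕ} (x : TupleChain L n) :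
    tupleMap g (tupleMap f x) = tupleMap (g ∘ f) x := by
  have : (tupleMap g).comp (tupleMap f) = tupleMap (g ∘ f) (n := n) := by
    refine tuple_hom_ext fun v => ?_
    simp [Function.comp_assoc]
  exact LinearMap.congr_fun this x

lemma tupleAug_map (f : L → L') {n : ℕ} (x : TupleChain L n) :
    tupleAug (tupleMap f x) = tupleAug x := by
  have : tupleAug.comp (tupleMap f) = tupleAug (L := L) (n := n) := by
    refine tuple_hom_ext fun v => ?_
    simp
  exact LinearMap.congr_fun this x

/-! #### Homotopies by coning -/

/-- A family of linear maps between chains of tuples is a chain map preserving the augmentation. -/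
structure IsTupleChainMap (F : ∀ n, TupleChain L n →ₗ[ZMod 2] TupleChain L' n) : Prop where
  boundary : ∀ n x, tupleBoundary (F (n + 1) x) = F n (tupleBoundary x)
  aug : ∀ x, tupleAug (F 0 x) = tupleAug x

lemma isTupleChainMap_map (f : L → L') : IsTupleChainMap fun n => tupleMap f (n := n) :=
  ⟨fun _ x => (tupleMap_boundary f x).symm, fun x => tupleAug_map f x⟩

/-- The homotopy between two chain maps obtained by coning. -/
def coneHomotopy (F G : ∀ n, TupleChain L n →ₗ[ZMod 2] TupleChain L' n)
    (b : ∀ n, (Fin (n + 1) → L) → L') : ∀ n, TupleChain L n →ₗ[ZMod 2] TupleChain L' (n + 1)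
  | 0 => Finsupp.linearCombination (ZMod 2) fun v =>
      tupleCone (b 0 v) (F 0 (Finsupp.single v 1) + G 0 (Finsupp.single v 1))
  | n + 1 => Finsupp.linearCombination (ZMod 2) fun v =>
      tupleCone (b (n + 1) v) (F (n + 1) (Finsupp.single v 1) + G (n + 1) (Finsupp.single v 1) +
        coneHomotopy F G b n (tupleBoundary (Finsupp.single v 1)))

variable {F G : ∀ n, TupleChain L n →ₗ[ZMod 2] TupleChain L' n}

lemma coneHomotopy_zero_single (b : ∀ n, (Fin (n + 1) → L) → L') (v : Fin 1 → L) :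
    coneHomotopy F G b 0 (Finsupp.single v 1) =
      tupleCone (b 0 v) (F 0 (Finsupp.single v 1) + G 0 (Finsupp.single v 1)) := by
  simp [coneHomotopy]

lemma coneHomotopy_succ_single (b : ∀ n, (Fin (n + 1) → L) → L') {n : ℕ} (v : Fin (n + 2) → L) :
    coneHomotopy F G b (n + 1) (Finsupp.single v 1) =
      tupleCone (b (n + 1) v) (F (n + 1) (Finsupp.single v 1) + G (n + 1) (Finsupp.single v 1) +
        coneHomotopy F G b n (tupleBoundary (Finsupp.single v 1))) := by
  rw [coneHomotopy, Finsupp.linearCombination_single, one_smul]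

lemma boundary_coneHomotopy_zero (hF : IsTupleChainMap F) (hG : IsTupleChainMap G)
    (b : ∀ n, (Fin (n + 1) → L) → L') (x : TupleChain L 0) :
    tupleBoundary (coneHomotopy F G b 0 x) = F 0 x + G 0 x := by
  have : tupleBoundary.comp (coneHomotopy F G b 0) = F 0 + G 0 := by
    refine tuple_hom_ext fun v => ?_
    rw [LinearMap.comp_apply, coneHomotopy_zero_single, tupleBoundary_cone_zero, map_add, hF.aug,
      hG.aug, CharTwo.add_self_eq_zero, zero_smul, add_zero, LinearMap.add_apply]
  exact LinearMap.congr_fun this x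

/-- By the formula one degree below, the chain Fv + Gv + K∂v that gets coned is a cycle, and a cone
over a cycle z has boundary z. This serves both for the prism and for the comparison of subdivision
with the identity. -/
lemma boundary_coneHomotopy_succ (hF : IsTupleChainMap F) (hG : IsTupleChainMap G)
    (b : ∀ n, (Fin (n + 1) → L) → L') {n : ℕ} (x : TupleChain L (n + 1)) :
    tupleBoundary (coneHomotopy F G b (n + 1) x) =
      F (n + 1) x + G (n + 1) x + coneHomotopy F G b n (tupleBoundary x) := by
  have : tupleBoundary.comp (coneHomotopy F G b (n + 1)) =
      F (n + 1) + G (n + 1) + (coneHomotopy F G b n).comp tupleBoundary := by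
    clear x
    induction n with
    | zero =>
      refine tuple_hom_ext fun v => ?_
      simp only [LinearMap.comp_apply, LinearMap.add_apply]
      rw [coneHomotopy_succ_single, tupleBoundary_cone]
      simp only [map_add tupleBoundary, boundary_coneHomotopy_zero hF hG, hF.boundary, hG.boundary]
      rw [tupleChain_add_self, map_zero, add_zero]
    | succ n ih =>
      refine tuple_hom_ext fun v => ?_
      simp only [LinearMap.comp_apply, LinearMap.add_apply]
      have h := LinearMap.congr_fun ih (tupleBoundary (Finsupp.single v 1))
      simp only [LinearMap.comp_apply, LinearMap.add_apply, tupleBoundary_boundary, map_zero,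
        add_zero] at h
      rw [coneHomotopy_succ_single, tupleBoundary_cone]
      simp only [map_add tupleBoundary, h, hF.boundary, hG.boundary]
      rw [tupleChain_add_self, map_zero, add_zero]
  exact LinearMap.congr_fun this x

/-- Naturality of the homotopy by coning. -/
lemma tupleMap_coneHomotopy {M M' : Type*} {F' G' : ∀ n, TupleChain M n →ₗ[ZMod 2] TupleChain M' n}
    {b : ∀ n, (Fin (n + 1) → L) → L'} {b' : ∀ n, (Fin (n + 1) → M) → M'} {f : L → M} {g : L' → M'}
    (hF : ∀ n x, tupleMap g (F n x) = F' n (tupleMap f x))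
    (hG : ∀ n x, tupleMap g (G n x) = G' n (tupleMap f x))
    (hb : ∀ n v, g (b n v) = b' n (f ∘ v)) (n : ℕ) (x : TupleChain L n) :
    tupleMap g (coneHomotopy F G b n x) = coneHomotopy F' G' b' n (tupleMap f x) := by
  have : (tupleMap g).comp (coneHomotopy F G b n) =
      (coneHomotopy F' G' b' n).comp (tupleMap f) := by
    clear x
    induction n with
    | zero =>
      refine tuple_hom_ext fun v => ?_
      simp only [LinearMap.comp_apply]
      rw [tupleMap_single, coneHomotopy_zero_single, coneHomotopy_zero_single, tupleMap_cone,
        map_add, hF, hG, tupleMap_single, hb]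
    | succ n ih =>
      refine tuple_hom_ext fun v => ?_
      have h := LinearMap.congr_fun ih
        (tupleBoundary (Finsupp.single v 1))
      simp only [LinearMap.comp_apply] at h ⊢
      rw [tupleMap_single, coneHomotopy_succ_single, coneHomotopy_succ_single, tupleMap_cone]
      simp only [map_add (tupleMap g), h, hF, hG, tupleMap_boundary, tupleMap_single, hb]
  exact LinearMap.congr_fun this x

/-- The chains whose tuples lie in a set. -/
abbrev tupleSupported {n : ℕ} (A : Set (Fin (n + 1) → L)) : Submodule (ZMod 2) (TupleChain L n) :=
  Finsupp.supported (ZMod 2) (ZMod 2) A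

/-- The chains whose vertices lie in a set. -/
abbrev vertexSupported (C : Set L) (n : ℕ) : Submodule (ZMod 2) (TupleChain L n) :=
  tupleSupported {v | ∀ j, v j ∈ C}

lemma tupleSupported_induction {n : ℕ} {A : Set (Fin (n + 1) → L)} {M : Type*} [AddCommMonoid M]
    [Module (ZMod 2) M] (f : TupleChain L n →ₗ[ZMod 2] M) (B : Submodule (ZMod 2) M)
    (h : ∀ v ∈ A, f (Finsupp.single v 1) ∈ B) {x : TupleChain L n} (hx : x ∈ tupleSupported A) :
    f x ∈ B := by
  rw [tupleSupported, Finsupp.supported_eq_span_single] at hx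
  have : Submodule.span (ZMod 2) ((fun i => Finsupp.single i (1 : ZMod 2)) '' A) ≤ B.comap f := by
    rw [Submodule.span_le]
    rintro _ ⟨v, hv, rfl⟩
    exact h v hv
  exact this hx

lemma single_mem_tupleSupported {n : ℕ} {A : Set (Fin (n + 1) → L)} {v : Fin (n + 1) → L}
    (hv : v ∈ A) : Finsupp.single v 1 ∈ tupleSupported A :=
  Finsupp.single_mem_supported _ _ hv

lemma tupleBoundary_mem {C : Set L} {n : ℕ} {x : TupleChain L (n + 1)}
    (hx : x ∈ vertexSupported C (n + 1)) : tupleBoundary x ∈ vertexSupported C n := by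
  refine tupleSupported_induction _ _ (fun v hv => ?_) hx
  rw [tupleBoundary_single]
  exact Submodule.sum_mem _ fun i _ => single_mem_tupleSupported fun j => hv _

lemma tupleCone_mem {C : Set L} {n : ℕ} {x : TupleChain L n} {b : L} (hb : b ∈ C)
    (hx : x ∈ vertexSupported C n) : tupleCone b x ∈ vertexSupported C (n + 1) := by
  refine tupleSupported_induction _ _ (fun v hv => ?_) hx
  rw [tupleCone_single]
  refine single_mem_tupleSupported fun j => ?_
  refine Fin.cases ?_ (fun j => ?_) j
  · simpa using hb
  · simpa using hv j

lemma tupleMap_mem {f : L → L'} {C : Set L} {C' : Set L'} (h : ∀ u ∈ C, f u ∈ C') {n : ℕ}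
    {x : TupleChain L n} (hx : x ∈ vertexSupported C n) :
    tupleMap f x ∈ vertexSupported C' n := by
  refine tupleSupported_induction _ _ (fun v hv => ?_) hx
  rw [tupleMap_single]
  exact single_mem_tupleSupported fun j => h _ (hv j)

lemma coneHomotopy_mem {C : Set L} {C' : Set L'} {b : ∀ n, (Fin (n + 1) → L) → L'}
    (hF : ∀ n, ∀ x ∈ vertexSupported C n, F n x ∈ vertexSupported C' n)
    (hG : ∀ n, ∀ x ∈ vertexSupported C n, G n x ∈ vertexSupported C' n)
    (hb : ∀ n v, (∀ j, v j ∈ C) → b n v ∈ C') (n : ℕ) {x : TupleChain L n}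
    (hx : x ∈ vertexSupported C n) : coneHomotopy F G b n x ∈ vertexSupported C' (n + 1) := by
  induction n with
  | zero =>
    refine tupleSupported_induction _ _ (fun v hv => ?_) hx
    have hs := single_mem_tupleSupported hv
    rw [coneHomotopy_zero_single]
    exact tupleCone_mem (hb _ _ hv) (Submodule.add_mem _ (hF _ _ hs) (hG _ _ hs))
  | succ n ih =>
    refine tupleSupported_induction _ _ (fun v hv => ?_) hx
    have hs := single_mem_tupleSupported hv
    rw [coneHomotopy_succ_single]
    exact tupleCone_mem (hb _ _ hv) (Submodule.add_mem _
      (Submodule.add_mem _ (hF _ _ hs) (hG _ _ hs)) (ih (tupleBoundary_mem hs)))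

/-! #### Subdivision -/

/-- The subdivision of chains of tuples with centres given by `β`. -/
def subdiv (β : ∀ n, (Fin (n + 1) → L) → L) : ∀ n, TupleChain L n →ₗ[ZMod 2] TupleChain L n
  | 0 => LinearMap.id
  | n + 1 => Finsupp.linearCombination (ZMod 2) fun v =>
      tupleCone (β (n + 1) v) (subdiv β n (tupleBoundary (Finsupp.single v 1)))

variable {β : ∀ n, (Fin (n + 1) → L) → L}

lemma subdiv_succ_single {n : ℕ} (v : Fin (n + 2) → L) :
    subdiv β (n + 1) (Finsupp.single v 1) =
      tupleCone (β (n + 1) v) (subdiv β n (tupleBoundary (Finsupp.single v 1))) := by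
  rw [subdiv, Finsupp.linearCombination_single, one_smul]

lemma isTupleChainMap_subdiv : IsTupleChainMap (subdiv β) := by
  refine ⟨fun n x => ?_, fun x => rfl⟩
  have : tupleBoundary.comp (subdiv β (n + 1)) = (subdiv β n).comp tupleBoundary := by
    clear x
    induction n with
    | zero =>
      refine tuple_hom_ext fun v => ?_
      rw [LinearMap.comp_apply, subdiv_succ_single, tupleBoundary_cone_zero]
      simp only [subdiv, LinearMap.id_apply, tupleAug_boundary, zero_smul, add_zero,
        LinearMap.comp_apply]
    | succ n ih =>
      refine tuple_hom_ext fun v => ?_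
      rw [LinearMap.comp_apply, subdiv_succ_single, tupleBoundary_cone,
        ← LinearMap.comp_apply tupleBoundary (subdiv β (n + 1)),
        ih]
      simp only [LinearMap.comp_apply, tupleBoundary_boundary, map_zero, add_zero]
  exact LinearMap.congr_fun this x

lemma tupleMap_subdiv {β' : ∀ n, (Fin (n + 1) → L') → L'} {f : L → L'}
    (hf : ∀ n v, f (β n v) = β' n (f ∘ v)) (n : ℕ) (x : TupleChain L n) :
    tupleMap f (subdiv β n x) = subdiv β' n (tupleMap f x) := by
  have : (tupleMap f).comp (subdiv β n) = (subdiv β' n).comp (tupleMap f) := by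
    clear x
    induction n with
    | zero => rfl
    | succ n ih =>
      refine tuple_hom_ext fun v => ?_
      have h := LinearMap.congr_fun ih
        (tupleBoundary (Finsupp.single v 1))
      simp only [LinearMap.comp_apply] at h ⊢
      rw [tupleMap_single, subdiv_succ_single, subdiv_succ_single, tupleMap_cone, h,
        tupleMap_boundary, tupleMap_single, hf]
  exact LinearMap.congr_fun this x

lemma subdiv_mem {C : Set L} (hC : ∀ n v, (∀ j, v j ∈ C) → β n v ∈ C) (n : ℕ) {x : TupleChain L n}
    (hx : x ∈ vertexSupported C n) : subdiv β n x ∈ vertexSupported C n := by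
  induction n with
  | zero => exact hx
  | succ n ih =>
    refine tupleSupported_induction _ _ (fun v hv => ?_) hx
    rw [subdiv_succ_single]
    exact tupleCone_mem (hC _ _ hv) (ih (tupleBoundary_mem (single_mem_tupleSupported hv)))

/-- The iterated subdivision. -/
def subdivIter (β : ∀ n, (Fin (n + 1) → L) → L) (m : ℕ) (n : ℕ) :
    TupleChain L n →ₗ[ZMod 2] TupleChain L n := (subdiv β n) ^ m

lemma subdivIter_succ (m n : ℕ) (x : TupleChain L n) :
    subdivIter β (m + 1) n x = subdiv β n (subdivIter β m n x) := by
  rw [subdivIter, pow_succ']; rfl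

lemma isTupleChainMap_subdivIter (m : ℕ) : IsTupleChainMap (subdivIter β m) := by
  induction m with
  | zero => exact ⟨fun _ _ => rfl, fun _ => rfl⟩
  | succ m ih =>
    refine ⟨fun n x => ?_, fun x => ?_⟩
    · rw [subdivIter_succ, isTupleChainMap_subdiv.boundary, ih.boundary, subdivIter_succ]
    · rw [subdivIter_succ, isTupleChainMap_subdiv.aug, ih.aug]

lemma tupleMap_subdivIter {β' : ∀ n, (Fin (n + 1) → L') → L'} {f : L → L'}
    (hf : ∀ n v, f (β n v) = β' n (f ∘ v)) (m n : ℕ) (x : TupleChain L n) :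
    tupleMap f (subdivIter β m n x) = subdivIter β' m n (tupleMap f x) := by
  induction m with
  | zero => rfl
  | succ m ih => rw [subdivIter_succ, tupleMap_subdiv hf, ih, subdivIter_succ]

lemma subdivIter_mem {C : Set L} (hC : ∀ n v, (∀ j, v j ∈ C) → β n v ∈ C) (m n : ℕ)
    {x : TupleChain L n} (hx : x ∈ vertexSupported C n) :
    subdivIter β m n x ∈ vertexSupported C n := by
  induction m with
  | zero => exact hx
  | succ m ih => rw [subdivIter_succ]; exact subdiv_mem hC n ih

/-! #### Counting the tuples with all labels -/

open Classical in
/-- The number modulo 2 of the tuples that carry each label exactly once. -/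
def fullCount (k : ℕ) : TupleChain (Fin (k + 1)) k →ₗ[ZMod 2] ZMod 2 :=
  Finsupp.linearCombination (ZMod 2) fun v => if Function.Surjective v then 1 else 0

lemma fullCount_single_of_not_surjective {k : ℕ} {v : Fin (k + 1) → Fin (k + 1)}
    (hv : ¬ Function.Surjective v) : fullCount k (Finsupp.single v 1) = 0 := by
  simp [fullCount, hv]

lemma fullCount_single_of_surjective {k : ℕ} {v : Fin (k + 1) → Fin (k + 1)}
    (hv : Function.Surjective v) : fullCount k (Finsupp.single v 1) = 1 := by
  simp [fullCount, hv]

/-- Deleting one of two places with equal labels loses no label. If both stay, the k + 1 remaining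
places carry a repeated label and cannot exhaust the k + 1 labels. -/
lemma surjective_comp_succAbove_iff {k : ℕ} {v : Fin (k + 2) → Fin (k + 1)} {i j : Fin (k + 2)}
    (hij : i ≠ j) (hvij : v i = v j) (hv : Function.Surjective v) (l : Fin (k + 2)) :
    Function.Surjective (v ∘ l.succAbove) ↔ l = i ∨ l = j := by
  constructor
  · intro h
    by_contra! hl
    obtain ⟨a, ha⟩ := Fin.exists_succAbove_eq hl.1.symm
    obtain ⟨b, hb⟩ := Fin.exists_succAbove_eq hl.2.symm
    have hinj := Finite.injective_iff_surjective.2 h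
    have : a = b := hinj (by simp [ha, hb, hvij])
    exact hij (by rw [← ha, ← hb, this])
  · intro h c
    obtain ⟨a, ha⟩ := hv c
    have : ∃ a', a' ≠ l ∧ v a' = c := by
      by_cases hal : a = l
      · rcases h with rfl | rfl
        · exact ⟨j, hij.symm, by rw [← hvij, ← hal, ha]⟩
        · exact ⟨i, hij, by rw [hvij, ← hal, ha]⟩
      · exact ⟨a, hal, ha⟩
    obtain ⟨a', ha', hc⟩ := this
    obtain ⟨b, hb⟩ := Fin.exists_succAbove_eq ha'
    exact ⟨b, by simp [hb, hc]⟩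

/-- Sperner's count: the number of completely labelled tuples in a boundary is even. -/
lemma fullCount_boundary {k : ℕ} (x : TupleChain (Fin (k + 1)) (k + 1)) :
    fullCount k (tupleBoundary x) = 0 := by
  classical
  have : (fullCount k).comp tupleBoundary =
      (0 : TupleChain (Fin (k + 1)) (k + 1) →ₗ[ZMod 2] ZMod 2) := by
    refine tuple_hom_ext fun v => ?_
    rw [LinearMap.comp_apply, tupleBoundary_single, map_sum, LinearMap.zero_apply]
    -- If all labels occur on the k + 2 places, one pair of places shares a label and exactly the
    -- two faces opposite to this pair are complete, and 1 + 1 = 0. Otherwise no face is complete.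
    by_cases hv : Function.Surjective v
    · obtain ⟨i, j, hvij, hij⟩ : ∃ i j, v i = v j ∧ i ≠ j := by
        by_contra! h
        have := Fintype.card_le_of_injective v fun a b hab => h a b hab
        simp at this
      have hs : ∀ l, fullCount k (Finsupp.single (v ∘ l.succAbove) 1) =
          if l ∈ ({i, j} : Finset (Fin (k + 2))) then 1 else 0 := by
        intro l
        split_ifs with h
        · exact fullCount_single_of_surjective
            ((surjective_comp_succAbove_iff hij hvij hv l).2 (by simpa using h))
        · exact fullCount_single_of_not_surjective
            fun hl => h (by simpa using (surjective_comp_succAbove_iff hij hvij hv l).1 hl)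
      rw [Finset.sum_congr rfl fun l _ => hs l, Finset.sum_ite_mem, Finset.univ_inter,
        Finset.sum_const, Finset.card_pair hij]
      decide
    · exact Finset.sum_eq_zero fun l _ => fullCount_single_of_not_surjective
        fun hl => hv (Function.Surjective.of_comp hl)
  exact LinearMap.congr_fun this x

end TupleChains

end HJ
end

noncomputable section

namespace HJ

section Sperner

/-! ### Barycentric subdivision of the standard simplex -/

/-- The standard `n`-simplex. -/
abbrev Simplex (n : ℕ) : Type := stdSimplex ℝ (Fin (n + 1))

/-- The convex combination of the points `v i` with weights `s i`. -/
def simplexComb {m n : ℕ} (s : Simplex n) (v : Fin (n + 1) → Simplex m) : Simplex m :=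
  ⟨∑ i, s.1 i • (v i).1,
    (convex_stdSimplex ℝ _).sum_mem (fun i _ => s.2.1 i) s.2.2 fun i _ => (v i).2⟩

lemma simplexComb_coe {m n : ℕ} (s : Simplex n) (v : Fin (n + 1) → Simplex m) :
    (simplexComb s v).1 = ∑ i, s.1 i • (v i).1 := rfl

/-- The vertices of the standard simplex. -/
def simplexVertices (n : ℕ) : Fin (n + 1) → Simplex n := fun i => stdSimplex.vertex i

lemma simplexComb_vertices {n : ℕ} (s : Simplex n) : simplexComb s (simplexVertices n) = s := by
  apply Subtype.ext
  rw [simplexComb_coe]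
  ext j
  simp [simplexVertices, Finset.sum_apply, Pi.single_apply]

lemma simplexMap_coe {m n : ℕ} (f : Fin (m + 1) → Fin (n + 1)) (s : Simplex m) :
    (stdSimplex.map f s).1 = FunOnFinite.linearMap ℝ ℝ f s.1 := rfl

lemma simplexMap_comb {m n p : ℕ} (f : Fin (m + 1) → Fin (p + 1)) (s : Simplex n)
    (v : Fin (n + 1) → Simplex m) :
    stdSimplex.map f (simplexComb s v) = simplexComb s (stdSimplex.map f ∘ v) := by
  apply Subtype.ext
  rw [simplexMap_coe, simplexComb_coe, simplexComb_coe, map_sum]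
  refine Finset.sum_congr rfl fun i _ => ?_
  rw [map_smul, Function.comp_apply, simplexMap_coe]

lemma simplexMap_vertices {m n : ℕ} (f : Fin (m + 1) → Fin (n + 1)) :
    stdSimplex.map f ∘ simplexVertices m = simplexVertices n ∘ f := by
  ext1 i
  exact stdSimplex.map_vertex f i

/-- The barycenter of a tuple of points of a simplex. -/
def tupleBary (m : ℕ) (n : ℕ) (v : Fin (n + 1) → Simplex m) : Simplex m :=
  simplexComb stdSimplex.barycenter v

lemma tupleBary_coe {m n : ℕ} (v : Fin (n + 1) → Simplex m) :
    (tupleBary m n v).1 = ∑ i, ((n : ℝ) + 1)⁻¹ • (v i).1 := by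
  simp [tupleBary, simplexComb_coe, stdSimplex.barycenter_apply]

lemma simplexMap_tupleBary {m p : ℕ} (f : Fin (m + 1) → Fin (p + 1)) (n : ℕ)
    (v : Fin (n + 1) → Simplex m) :
    stdSimplex.map f (tupleBary m n v) = tupleBary p n (stdSimplex.map f ∘ v) :=
  simplexMap_comb f _ v

/-- In the mean of the differences `v i - v j` the term `i = j` vanishes, so only n of the n + 1
weights contribute. -/
lemma dist_tupleBary_le {m n : ℕ} (v : Fin (n + 1) → Simplex m) {δ : ℝ}
    (hv : ∀ i j, dist (v i) (v j) ≤ δ) (j : Fin (n + 1)) :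
    dist (tupleBary m n v) (v j) ≤ n / (n + 1) * δ := by
  have hn : ((n : ℝ) + 1) ≠ 0 := by positivity
  rw [Subtype.dist_eq, dist_eq_norm, tupleBary_coe]
  have h1 : ∑ i, ((n : ℝ) + 1)⁻¹ • (v i).1 - (v j).1 =
      ∑ i ∈ Finset.univ.erase j, ((n : ℝ) + 1)⁻¹ • ((v i).1 - (v j).1) := by
    rw [Finset.sum_erase _ (by simp)]
    simp only [smul_sub, Finset.sum_sub_distrib, Finset.sum_const, Finset.card_univ,
      Fintype.card_fin]
    congr 1
    rw [← Nat.cast_smul_eq_nsmul ℝ, smul_smul]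
    push_cast
    rw [mul_inv_cancel₀ hn, one_smul]
  rw [h1]
  refine (norm_sum_le _ _).trans ?_
  have h2 : ∀ i ∈ Finset.univ.erase j, ‖((n : ℝ) + 1)⁻¹ • ((v i).1 - (v j).1)‖ ≤
      ((n : ℝ) + 1)⁻¹ * δ := by
    intro i _
    rw [norm_smul, Real.norm_of_nonneg (by positivity), ← dist_eq_norm, ← Subtype.dist_eq]
    gcongr
    exact hv i j
  refine (Finset.sum_le_card_nsmul _ _ _ h2).trans (le_of_eq ?_)
  rw [Finset.card_erase_of_mem (Finset.mem_univ _), Finset.card_univ, Fintype.card_fin]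
  simp
  ring

lemma tupleBary_mem_of_dist_le {m n : ℕ} (v : Fin (n + 1) → Simplex m) (a : Simplex m) {δ : ℝ}
    (hv : ∀ j, dist a (v j) ≤ δ) : dist a (tupleBary m n v) ≤ δ := by
  have h : (tupleBary m n v).1 ∈ Metric.closedBall a.1 δ := by
    rw [tupleBary, simplexComb_coe]
    refine (convex_closedBall _ _).sum_mem (fun i _ => Subtype.property stdSimplex.barycenter |>.1 i)
      (Subtype.property stdSimplex.barycenter).2 fun i _ => ?_
    rw [Metric.mem_closedBall, dist_comm]
    exact hv i
  rw [Metric.mem_closedBall, dist_comm] at h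
  exact h

lemma tupleBary_apply_eq_zero {m n : ℕ} (v : Fin (n + 1) → Simplex m) (i : Fin (m + 1))
    (hv : ∀ j, (v j).1 i = 0) : (tupleBary m n v).1 i = 0 := by
  simp [tupleBary_coe, Finset.sum_apply, hv]

/-- The tuples of diameter at most `δ`. -/
def smallTuples (m n : ℕ) (δ : ℝ) : Set (Fin (n + 1) → Simplex m) :=
  {u | ∀ i j, dist (u i) (u j) ≤ δ}

/-- A simplex of the subdivision is a cone from the barycentre over a simplex of the subdivided
boundary. The latter is small by induction, and its vertices stay in a ball about the barycentre,
since balls are stable under taking barycentres. The factor is that of the top dimension k, to be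
the same in all lower degrees. -/
lemma subdiv_mem_smallTuples {m k : ℕ} {n : ℕ} (hn : n ≤ k) {δ : ℝ}
    {x : TupleChain (Simplex m) n} (hx : x ∈ tupleSupported (smallTuples m n δ)) :
    subdiv (tupleBary m) n x ∈ tupleSupported (smallTuples m n (k / (k + 1) * δ)) := by
  induction n with
  | zero =>
    refine tupleSupported_induction _ _ (fun v hv => ?_) hx
    refine single_mem_tupleSupported fun i j => ?_
    have h0 : 0 ≤ δ := dist_nonneg.trans (hv 0 0)
    rw [show i = j from Subsingleton.elim (α := Fin 1) i j, dist_self]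
    positivity
  | succ n ih =>
    refine tupleSupported_induction _ _ (fun v hv => ?_) hx
    have h0 : 0 ≤ δ := dist_nonneg.trans (hv 0 0)
    set b := tupleBary m (n + 1) v with hb
    set C : Set (Simplex m) := {w | dist b w ≤ k / (k + 1) * δ} with hC
    have hvC : ∀ j, v j ∈ C := by
      intro j
      refine (dist_tupleBary_le v hv j).trans ?_
      gcongr ?_ * _
      rw [div_le_div_iff₀ (by positivity) (by positivity)]
      have : ((n + 1 : ℕ) : ℝ) ≤ k := by exact_mod_cast hn
      nlinarith
    have h1 : subdiv (tupleBary m) n (tupleBoundary (Finsupp.single v 1)) ∈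
        tupleSupported (smallTuples m n (k / (k + 1) * δ)) := by
      refine ih (by omega) ?_
      rw [tupleBoundary_single]
      exact Submodule.sum_mem _ fun i _ => single_mem_tupleSupported fun a c => hv _ _
    have h2 : subdiv (tupleBary m) n (tupleBoundary (Finsupp.single v 1)) ∈
        vertexSupported C n :=
      subdiv_mem (fun n v h => tupleBary_mem_of_dist_le v b h) n
        (tupleBoundary_mem (single_mem_tupleSupported hvC))
    have h3 : subdiv (tupleBary m) n (tupleBoundary (Finsupp.single v 1)) ∈
        tupleSupported (smallTuples m n (k / (k + 1) * δ) ∩ {v | ∀ j, v j ∈ C}) :=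
      fun u hu => ⟨h1 hu, h2 hu⟩
    rw [subdiv_succ_single]
    refine tupleSupported_induction _ _ (fun u hu => ?_) h3
    rw [tupleCone_single]
    refine single_mem_tupleSupported fun i j => ?_
    refine Fin.cases ?_ (fun i => ?_) i <;> refine Fin.cases ?_ (fun j => ?_) j
    · simp only [Fin.cons_zero, dist_self]; positivity
    · simpa using show dist b (u j) ≤ _ from hu.2 j
    · rw [dist_comm]; simpa using show dist b (u i) ≤ _ from hu.2 i
    · simpa using hu.1 i j

lemma subdivIter_vertices_mem (k m : ℕ) :
    subdivIter (tupleBary k) m k (Finsupp.single (simplexVertices k) 1) ∈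
      tupleSupported (smallTuples k k ((k / (k + 1) : ℝ) ^ m)) := by
  induction m with
  | zero =>
    refine single_mem_tupleSupported fun i j => ?_
    rw [pow_zero, Subtype.dist_eq]
    refine (dist_pi_le_iff zero_le_one).2 fun a => ?_
    have h := fun i : Fin (k + 1) => mem_Icc_of_mem_stdSimplex (simplexVertices k i).2 a
    have := Real.dist_le_of_mem_Icc (h i) (h j)
    simpa using this
  | succ m ih =>
    rw [subdivIter_succ, pow_succ']
    exact subdiv_mem_smallTuples le_rfl ih

/-! ### Sperner's lemma for singular chains -/

variable {V : Type*} [NormedAddCommGroup V]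

/-- The singular boundary operator as a linear map. -/
def boundaryHom {n : ℕ} : Chain V (n + 1) →ₗ[ZMod 2] Chain V n :=
  Finsupp.linearCombination (ZMod 2) fun σ => ∑ i, Finsupp.single (face i σ) 1

lemma boundary_eq {n : ℕ} (c : Chain V (n + 1)) : boundary c = boundaryHom c := by
  rw [boundary, boundaryHom, Finsupp.linearCombination_apply]
  refine Finsupp.sum_congr fun σ _ => ?_
  rw [Finset.smul_sum]
  simp

/-- The number modulo 2 of the completely labelled simplices of the `m`-th subdivision. -/
def labelCount {k : ℕ} (l : V → Fin (k + 1)) (m : ℕ) : Chain V k →ₗ[ZMod 2] ZMod 2 :=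
  Finsupp.linearCombination (ZMod 2) fun σ : SingularSimplex V k => fullCount k
    (tupleMap (l ∘ σ) (subdivIter (tupleBary k) m k (Finsupp.single (simplexVertices k) 1)))

/-- Subdivision is natural under face inclusions. The counts on the faces of τ therefore add up to
the count on the boundary of one subdivided (k+1)-simplex, which is even by `fullCount_boundary`. -/
lemma labelCount_boundary {k : ℕ} (l : V → Fin (k + 1)) (m : ℕ) (τ : Chain V (k + 1)) :
    labelCount l m (boundary τ) = 0 := by
  rw [boundary_eq]
  have : (labelCount l m).comp boundaryHom = (0 : Chain V (k + 1) →ₗ[ZMod 2] ZMod 2) := by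
    ext σ
    simp only [LinearMap.comp_apply, Finsupp.lsingle_apply, LinearMap.zero_apply, boundaryHom,
      Finsupp.linearCombination_single, one_smul, map_sum, labelCount]
    have h : ∀ i : Fin (k + 2), tupleMap (l ∘ face i σ)
        (subdivIter (tupleBary k) m k (Finsupp.single (simplexVertices k) 1)) =
        tupleMap (l ∘ σ) (subdivIter (tupleBary (k + 1)) m k
          (Finsupp.single (simplexVertices (k + 1) ∘ i.succAbove) 1)) := by
      intro i
      rw [← simplexMap_vertices, ← tupleMap_single,
        ← tupleMap_subdivIter (simplexMap_tupleBary i.succAbove), tupleMap_map]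
      rfl
    simp only [h]
    rw [← map_sum, ← map_sum, ← map_sum, ← tupleBoundary_single,
      ← (isTupleChainMap_subdivIter m).boundary, tupleMap_boundary, fullCount_boundary]
  exact LinearMap.congr_fun this τ

lemma fullCount_eq_zero_of_missing {k : ℕ} {L : Type*} {l : L → Fin (k + 1)} {C : Set L}
    {i : Fin (k + 1)} (hl : ∀ s ∈ C, l s ≠ i) {x : TupleChain L k}
    (hx : x ∈ vertexSupported C k) : fullCount k (tupleMap l x) = 0 := by
  have := tupleSupported_induction ((fullCount k).comp (tupleMap l)) ⊥ (fun v hv => ?_) hx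
  · simpa using this
  · simp only [LinearMap.comp_apply, tupleMap_single, Submodule.mem_bot]
    refine fullCount_single_of_not_surjective fun h => ?_
    obtain ⟨j, hj⟩ := h i
    exact hl _ (hv j) hj

/-- Sperner's lemma. Subdivision is homotopic to the identity through K, so the subdivided simplex
differs from the simplex by ∂Kι + K∂ι. The first term has even count, and the second stays in the
faces, each of which misses a label; the count is that of the unsubdivided simplex, namely 1. -/
lemma labelCount_of_faces {k : ℕ} {l : V → Fin (k + 1)} {σ : SingularSimplex V k}
    (hv : ∀ i, l (σ (stdSimplex.vertex i)) = i)
    (hf : ∀ (i : Fin (k + 1)) (s : Simplex k), s.1 i = 0 → l (σ s) ≠ i) (m : ℕ) :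
    labelCount l m (Finsupp.single σ 1) = 1 := by
  rw [labelCount, Finsupp.linearCombination_single, one_smul]
  set ι : TupleChain (Simplex k) k := Finsupp.single (simplexVertices k) 1 with hι
  have hS : IsTupleChainMap (subdivIter (tupleBary k) m) := isTupleChainMap_subdivIter m
  have hI : IsTupleChainMap (subdivIter (tupleBary k) 0) := isTupleChainMap_subdivIter 0
  have h1 : fullCount k (tupleMap (l ∘ σ) ι) = 1 := by
    rw [hι, tupleMap_single]
    exact fullCount_single_of_surjective fun i => ⟨i, hv i⟩
  suffices h : fullCount k (tupleMap (l ∘ σ) (subdivIter (tupleBary k) m k ι + ι)) = 0 by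
    rw [map_add, map_add, h1] at h
    exact CharTwo.add_eq_zero.1 h
  have h2 : ∀ n (x : TupleChain (Simplex k) n), subdivIter (tupleBary k) 0 n x = x :=
    fun _ _ => rfl
  set K := coneHomotopy (subdivIter (tupleBary k) m) (subdivIter (tupleBary k) 0) (tupleBary k)
  cases k with
  | zero =>
    have h3 := boundary_coneHomotopy_zero hS hI (tupleBary 0) ι
    rw [h2] at h3
    rw [← h3, tupleMap_boundary, fullCount_boundary]
  | succ k =>
    have h3 := boundary_coneHomotopy_succ hS hI (tupleBary (k + 1)) ι
    have h4 : subdivIter (tupleBary (k + 1)) m (k + 1) ι + ι =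
        tupleBoundary (K (k + 1) ι) + K k (tupleBoundary ι) := by
      refine (add_zero _).symm.trans ?_
      rw [h3, h2]
      exact ((add_assoc _ _ _).trans (congrArg _ (tupleChain_add_self _))).symm
    rw [h4, map_add, map_add, tupleMap_boundary, fullCount_boundary, zero_add, hι,
      tupleBoundary_single, map_sum, map_sum, map_sum]
    refine Finset.sum_eq_zero fun i _ => ?_
    refine fullCount_eq_zero_of_missing (C := {s : Simplex (k + 1) | s.1 i = 0}) (i := i)
      (fun s hs => hf i s hs) ?_
    -- A face is stable under barycentres, so neither the subdivision nor the homotopy leaves it.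
    have hC : ∀ n (v : Fin (n + 1) → Simplex (k + 1)), (∀ j, v j ∈ {s : Simplex (k + 1) | s.1 i = 0})
        → tupleBary (k + 1) n v ∈ {s : Simplex (k + 1) | s.1 i = 0} :=
      fun n v h => tupleBary_apply_eq_zero v i h
    refine coneHomotopy_mem (fun n x hx => subdivIter_mem hC m n hx)
      (fun n x hx => subdivIter_mem hC 0 n hx) hC k (single_mem_tupleSupported fun j => ?_)
    simp [simplexVertices]

/-- Once the pieces of the subdivision are smaller than a Lebesgue number of the cover, each of them
lies in a single `U i`, where the label `i` is absent. -/
lemma eventually_labelCount_eq_zero {k : ℕ} {l : V → Fin (k + 1)} {U : Fin (k + 1) → Set V}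
    (hU : ∀ i, IsOpen (U i)) (hl : ∀ i, ∀ v ∈ U i, l v ≠ i) {ρ : Chain V k}
    (hρ : chainImage ρ ⊆ ⋃ i, U i) : ∀ᶠ m in atTop, labelCount l m ρ = 0 := by
  have h1 : ∀ σ ∈ ρ.support, ∀ᶠ m in atTop, labelCount l m (Finsupp.single σ 1) = 0 := by
    intro σ hσ
    obtain ⟨δ, hδ, hball⟩ := lebesgue_number_lemma_of_metric (s := (univ : Set (Simplex k)))
      (c := fun i => σ ⁻¹' U i) isCompact_univ (fun i => (hU i).preimage σ.continuous) (by
        intro s _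
        have : σ s ∈ ⋃ i, U i := hρ (by
          simp only [chainImage, mem_iUnion]
          exact ⟨σ, hσ, mem_range_self s⟩)
        simpa using this)
    have hr : (k / (k + 1) : ℝ) < 1 := by
      rw [div_lt_one (by positivity)]; linarith
    have := tendsto_pow_atTop_nhds_zero_of_lt_one (by positivity) hr
    filter_upwards [this.eventually (gt_mem_nhds hδ)] with m hm
    rw [labelCount, Finsupp.linearCombination_single, one_smul]
    have := tupleSupported_induction ((fullCount k).comp (tupleMap (l ∘ σ))) ⊥ (fun v hv => ?_)
      (subdivIter_vertices_mem k m)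
    · simpa using this
    · simp only [LinearMap.comp_apply, tupleMap_single, Submodule.mem_bot]
      refine fullCount_single_of_not_surjective fun h => ?_
      obtain ⟨i, hi⟩ := hball (v 0) (mem_univ _)
      obtain ⟨j, hj⟩ := h i
      exact hl i _ (hi (Metric.mem_ball.2 ((hv j 0).trans_lt hm))) hj
  filter_upwards [(Filter.eventually_all_finset _).2 h1] with m hm
  rw [← Finsupp.sum_single ρ, Finsupp.sum, map_sum]
  refine Finset.sum_eq_zero fun σ hσ => ?_
  have : Finsupp.single σ (ρ σ) = ρ σ • Finsupp.single σ (1 : ZMod 2) := by simp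
  rw [this, map_smul, hm σ hσ, smul_zero]

/-- A labelled version of the nontriviality of the fundamental class of a simplex relative to its
boundary: the set where some label is locally missing contains no chain homologous to `σ`. -/
theorem not_chainImage_subset_of_labels {k : ℕ} {l : V → Fin (k + 1)} {U : Fin (k + 1) → Set V}
    (hU : ∀ i, IsOpen (U i)) (hl : ∀ i, ∀ v ∈ U i, l v ≠ i) {σ : SingularSimplex V k}
    (hv : ∀ i, l (σ (stdSimplex.vertex i)) = i)
    (hf : ∀ (i : Fin (k + 1)) (s : Simplex k), s.1 i = 0 → l (σ s) ≠ i) (τ : Chain V (k + 1)) :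
    ¬ chainImage (Finsupp.single σ 1 + boundary τ) ⊆ ⋃ i, U i := by
  intro h
  obtain ⟨m, hm⟩ := (eventually_labelCount_eq_zero hU hl h).exists
  rw [map_add, labelCount_of_faces hv hf, labelCount_boundary] at hm
  simp at hm

end Sperner

end HJ
end

noncomputable section

namespace HJ

section Prism

/-! ### Homotopy invariance of singular chains -/

variable {V : Type*} [NormedAddCommGroup V]

lemma sum_simplexMap_smul {m n : ℕ} {M : Type*} [AddCommGroup M] [Module ℝ M]
    (f : Fin (m + 1) → Fin (n + 1)) (s : Simplex m) (w : Fin (n + 1) → M) :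
    ∑ i, (stdSimplex.map f s).1 i • w i = ∑ j, s.1 j • w (f j) := by
  classical
  rw [simplexMap_coe]
  simp only [FunOnFinite.linearMap_apply_apply, Finset.sum_smul]
  rw [← Finset.sum_fiberwise Finset.univ f]
  refine Finset.sum_congr rfl fun i _ => Finset.sum_congr ?_ fun j hj => ?_
  · ext; simp
  · rw [(Finset.mem_filter.1 hj).2]

/-- The affine simplex in `Δⁿ × ℝ` with the given vertices. -/
def affineSimplex {m n : ℕ} (v : Fin (m + 1) → Simplex n × ℝ) : C(Simplex m, Simplex n × ℝ) where
  toFun s := (simplexComb s fun i => (v i).1, ∑ i, s.1 i • (v i).2)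
  continuous_toFun := by
    have h : ∀ i, Continuous fun s : Simplex m => s.1 i := fun i =>
      (continuous_apply i).comp continuous_subtype_val
    refine Continuous.prodMk (Continuous.subtype_mk ?_ _) ?_
    · exact continuous_finsetSum _ fun i _ => (h i).smul continuous_const
    · exact continuous_finsetSum _ fun i _ => (h i).smul continuous_const

lemma affineSimplex_apply {m n : ℕ} (v : Fin (m + 1) → Simplex n × ℝ) (s : Simplex m) :
    affineSimplex v s = (simplexComb s fun i => (v i).1, ∑ i, s.1 i • (v i).2) := rfl

lemma affineSimplex_map {m m' n : ℕ} (f : Fin (m + 1) → Fin (m' + 1))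
    (v : Fin (m' + 1) → Simplex n × ℝ) (s : Simplex m) :
    affineSimplex v (stdSimplex.map f s) = affineSimplex (v ∘ f) s := by
  rw [affineSimplex_apply, affineSimplex_apply, sum_simplexMap_smul f s]
  congr 1
  exact Subtype.ext (sum_simplexMap_smul f s fun i => (v i).1.1)

lemma affineSimplex_face {m n p : ℕ} (f : Fin (n + 1) → Fin (p + 1))
    (v : Fin (m + 1) → Simplex n × ℝ) (s : Simplex m) :
    affineSimplex (Prod.map (stdSimplex.map f) id ∘ v) s =
      Prod.map (stdSimplex.map f) id (affineSimplex v s) := by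
  simp only [affineSimplex_apply, Prod.map_apply, simplexMap_comb, Function.comp_def, Prod.map_fst,
    Prod.map_snd, id]

lemma affineSimplex_snd_mem {m n : ℕ} {v : Fin (m + 1) → Simplex n × ℝ}
    (hv : ∀ j, (v j).2 ∈ Icc (0 : ℝ) 1) (s : Simplex m) : (affineSimplex v s).2 ∈ Icc (0 : ℝ) 1 :=
  (convex_Icc 0 1).sum_mem (fun i _ => s.2.1 i) s.2.2 fun i _ => hv i

/-- The singular chain obtained from a chain of tuples of points of `Δⁿ × ℝ`. -/
def realize {n : ℕ} (g : C(Simplex n × ℝ, V)) {m : ℕ} :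
    TupleChain (Simplex n × ℝ) m →ₗ[ZMod 2] Chain V m :=
  Finsupp.lmapDomain _ _ fun v => g.comp (affineSimplex v)

lemma realize_single {n : ℕ} (g : C(Simplex n × ℝ, V)) {m : ℕ} (v : Fin (m + 1) → Simplex n × ℝ) :
    realize g (Finsupp.single v 1) = Finsupp.single (g.comp (affineSimplex v)) 1 := by
  simp [realize]

lemma boundaryHom_single {n : ℕ} (σ : SingularSimplex V (n + 1)) :
    boundaryHom (Finsupp.single σ 1) = ∑ i, Finsupp.single (face i σ) (1 : ZMod 2) := by
  simp [boundaryHom]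

/-- An affine simplex is determined by its vertices, so `realize` is a chain map. The combinatorial
identities on tuples then transfer to singular chains. -/
lemma boundaryHom_realize {n : ℕ} (g : C(Simplex n × ℝ, V)) {m : ℕ}
    (x : TupleChain (Simplex n × ℝ) (m + 1)) :
    boundaryHom (realize g x) = realize g (tupleBoundary x) := by
  have : boundaryHom.comp (realize g) = (realize g).comp (tupleBoundary (n := m)) := by
    refine tuple_hom_ext fun v => ?_
    simp only [LinearMap.comp_apply, realize_single, boundaryHom_single, tupleBoundary_single,
      map_sum]
    refine Finset.sum_congr rfl fun i _ => ?_
    congr 1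
    ext s
    exact congrArg g (affineSimplex_map i.succAbove v s)
  exact LinearMap.congr_fun this x

/-- The chains of simplices contained in a set. -/
abbrev chainsIn (A : Set V) (n : ℕ) : Submodule (ZMod 2) (Chain V n) :=
  Finsupp.supported (ZMod 2) (ZMod 2) {σ : SingularSimplex V n | range σ ⊆ A}

lemma mem_chainsIn {A : Set V} {n : ℕ} {c : Chain V n} : c ∈ chainsIn A n ↔ chainImage c ⊆ A := by
  rw [chainsIn, Finsupp.mem_supported, chainImage, iUnion₂_subset_iff]
  rfl

lemma chain_hom_ext {M : Type*} [AddCommMonoid M] [Module (ZMod 2) M] {n : ℕ}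
    {f g : Chain V n →ₗ[ZMod 2] M}
    (h : ∀ σ, f (Finsupp.single σ 1) = g (Finsupp.single σ 1)) : f = g := by
  ext v; simpa using h v

lemma chainsIn_induction {n : ℕ} {A : Set V} {M : Type*} [AddCommMonoid M]
    [Module (ZMod 2) M] (f : Chain V n →ₗ[ZMod 2] M) (B : Submodule (ZMod 2) M)
    (h : ∀ σ : SingularSimplex V n, range σ ⊆ A → f (Finsupp.single σ 1) ∈ B) {x : Chain V n}
    (hx : x ∈ chainsIn A n) : f x ∈ B := by
  rw [chainsIn, Finsupp.supported_eq_span_single] at hx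
  have : Submodule.span (ZMod 2) ((fun i => Finsupp.single i (1 : ZMod 2)) ''
      {σ : SingularSimplex V n | range σ ⊆ A}) ≤ B.comap f := by
    rw [Submodule.span_le]
    rintro _ ⟨v, hv, rfl⟩
    exact h v hv
  exact this hx

/-- The prism over the standard simplex. -/
def prismModel (m n : ℕ) : TupleChain (Simplex m) n →ₗ[ZMod 2] TupleChain (Simplex m × ℝ) (n + 1) :=
  coneHomotopy (fun _ => tupleMap fun s => (s, 0)) (fun _ => tupleMap fun s => (s, 1))
    (fun _ v => (v 0, 0)) n

/-- The prism operator of a homotopy. -/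
def prism (h : C(V × ℝ, V)) (n : ℕ) : Chain V n →ₗ[ZMod 2] Chain V (n + 1) :=
  Finsupp.linearCombination (ZMod 2) fun σ : SingularSimplex V n =>
    realize (h.comp (σ.prodMap (ContinuousMap.id ℝ)))
      (prismModel n n (Finsupp.single (simplexVertices n) 1))

lemma prism_single (h : C(V × ℝ, V)) {n : ℕ} (σ : SingularSimplex V n) :
    prism h n (Finsupp.single σ 1) = realize (h.comp (σ.prodMap (ContinuousMap.id ℝ)))
      (prismModel n n (Finsupp.single (simplexVertices n) 1)) := by
  rw [prism, Finsupp.linearCombination_single, one_smul]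

/-- The map of chains induced by the time `r` map of a homotopy. -/
def pushAt (h : C(V × ℝ, V)) (r : ℝ) (n : ℕ) : Chain V n →ₗ[ZMod 2] Chain V n :=
  Finsupp.lmapDomain _ _ fun σ : SingularSimplex V n =>
    h.comp ((ContinuousMap.id V).prodMk (ContinuousMap.const V r)) |>.comp σ

lemma pushAt_single (h : C(V × ℝ, V)) (r : ℝ) {n : ℕ} (σ : SingularSimplex V n) :
    pushAt h r n (Finsupp.single σ 1) = Finsupp.single
      ((h.comp ((ContinuousMap.id V).prodMk (ContinuousMap.const V r))).comp σ) 1 := by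
  simp [pushAt]

lemma realize_end (h : C(V × ℝ, V)) (r : ℝ) {n : ℕ} (σ : SingularSimplex V n) :
    realize (h.comp (σ.prodMap (ContinuousMap.id ℝ)))
      (tupleMap (fun s => (s, r)) (Finsupp.single (simplexVertices n) 1)) =
      pushAt h r n (Finsupp.single σ 1) := by
  rw [tupleMap_single, realize_single, pushAt_single]
  congr 1
  ext s
  have : affineSimplex ((fun s => (s, r)) ∘ simplexVertices n) s = (s, r) := by
    rw [affineSimplex_apply]
    refine Prod.ext (simplexComb_vertices s) ?_
    change ∑ i, s.1 i • r = r
    rw [← Finset.sum_smul, s.2.2, one_smul]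
  simp [this]

lemma boundaryHom_prism_zero (h : C(V × ℝ, V)) (c : Chain V 0) :
    boundaryHom (prism h 0 c) = pushAt h 0 0 c + pushAt h 1 0 c := by
  have : boundaryHom.comp (prism h 0) = pushAt h 0 0 + pushAt h 1 0 := by
    refine chain_hom_ext fun σ => ?_
    simp only [LinearMap.comp_apply, LinearMap.add_apply]
    rw [prism_single, boundaryHom_realize, prismModel, boundary_coneHomotopy_zero
      (isTupleChainMap_map _) (isTupleChainMap_map _), map_add, realize_end, realize_end]
  exact LinearMap.congr_fun this c

/-- This is the formula for the cone homotopy on the model simplex, realized by the homotopy. The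
lateral part becomes the prism over the boundary because the model prism is natural in the face
inclusions. -/
lemma boundaryHom_prism_succ (h : C(V × ℝ, V)) {n : ℕ} (c : Chain V (n + 1)) :
    boundaryHom (prism h (n + 1) c) =
      pushAt h 0 (n + 1) c + pushAt h 1 (n + 1) c + prism h n (boundaryHom c) := by
  have : boundaryHom.comp (prism h (n + 1)) =
      pushAt h 0 (n + 1) + pushAt h 1 (n + 1) + (prism h n).comp boundaryHom := by
    refine chain_hom_ext fun σ => ?_
    simp only [LinearMap.comp_apply, LinearMap.add_apply]
    rw [prism_single, boundaryHom_realize, prismModel, boundary_coneHomotopy_succ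
      (isTupleChainMap_map _) (isTupleChainMap_map _), map_add, map_add, realize_end, realize_end,
      boundaryHom_single, tupleBoundary_single, map_sum, map_sum, map_sum]
    congr 1
    refine Finset.sum_congr rfl fun i _ => ?_
    rw [prism_single, ← simplexMap_vertices, ← tupleMap_single, prismModel]
    rw [← tupleMap_coneHomotopy (f := stdSimplex.map i.succAbove)
      (g := Prod.map (stdSimplex.map i.succAbove) id)
      (F := fun _ => tupleMap fun s => (s, 0)) (G := fun _ => tupleMap fun s => (s, 1))
      (b := fun _ v => (v 0, 0))]
    · have key : ∀ (m : ℕ) (x : TupleChain (Simplex n × ℝ) m),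
          realize (h.comp (σ.prodMap (ContinuousMap.id ℝ)))
            (tupleMap (Prod.map (stdSimplex.map i.succAbove) id) x) =
          realize (h.comp ((face i σ).prodMap (ContinuousMap.id ℝ))) x := by
        intro m x
        have : (realize (h.comp (σ.prodMap (ContinuousMap.id ℝ)))).comp
            (tupleMap (Prod.map (stdSimplex.map i.succAbove) id) (n := m)) =
            realize (h.comp ((face i σ).prodMap (ContinuousMap.id ℝ))) := by
          refine tuple_hom_ext fun v => ?_
          rw [LinearMap.comp_apply, tupleMap_single, realize_single, realize_single]
          congr 1
          ext s
          simp only [ContinuousMap.comp_apply, affineSimplex_face]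
          rfl
        exact LinearMap.congr_fun this x
      exact key _ _
    · intro m x; rw [tupleMap_map, tupleMap_map]; rfl
    · intro m x; rw [tupleMap_map, tupleMap_map]; rfl
    · intro m v; rfl
  exact LinearMap.congr_fun this c

lemma prism_mem {h : C(V × ℝ, V)} {A B : Set V} (hAB : ∀ v ∈ A, ∀ r ∈ Icc (0 : ℝ) 1, h (v, r) ∈ B)
    {n : ℕ} {c : Chain V n} (hc : c ∈ chainsIn A n) : prism h n c ∈ chainsIn B (n + 1) := by
  refine chainsIn_induction _ _ (fun σ hσ => ?_) hc
  rw [prism_single]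
  have hx : prismModel n n (Finsupp.single (simplexVertices n) 1) ∈
      vertexSupported {w : Simplex n × ℝ | w.2 ∈ Icc (0 : ℝ) 1} (n + 1) := by
    refine coneHomotopy_mem (C := univ) (fun m x hx => tupleMap_mem ?_ hx)
      (fun m x hx => tupleMap_mem ?_ hx) ?_ n (single_mem_tupleSupported fun j => mem_univ _)
    · intro u _; simp
    · intro u _; simp
    · intro m v _; simp
  refine tupleSupported_induction _ _ (fun u hu => ?_) hx
  rw [realize_single]
  refine Finsupp.single_mem_supported _ _ ?_
  rintro _ ⟨s, rfl⟩
  exact hAB _ (hσ (mem_range_self _)) _ (affineSimplex_snd_mem hu s)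

lemma pushAt_mem {h : C(V × ℝ, V)} {r : ℝ} {A B : Set V} (hAB : ∀ v ∈ A, h (v, r) ∈ B)
    {n : ℕ} {c : Chain V n} (hc : c ∈ chainsIn A n) : pushAt h r n c ∈ chainsIn B n := by
  refine chainsIn_induction _ _ (fun σ hσ => ?_) hc
  rw [pushAt_single]
  refine Finsupp.single_mem_supported _ _ ?_
  rintro _ ⟨s, rfl⟩
  exact hAB _ (hσ (mem_range_self _))

lemma pushAt_eq_self {h : C(V × ℝ, V)} {r : ℝ} (hr : ∀ v, h (v, r) = v) {n : ℕ} (c : Chain V n) :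
    pushAt h r n c = c := by
  have : pushAt h r n = LinearMap.id := by
    refine chain_hom_ext fun σ => ?_
    rw [pushAt_single, LinearMap.id_apply]
    congr 1
    ext s
    exact hr _
  exact LinearMap.congr_fun this c

/-- A descending cycle cannot be pushed into `{f ≤ -a}` by a deformation along which `f`
decreases. -/
lemma IsDescendingCycle.not_deformable {f : V → ℝ} {k : ℕ} {a : ℝ} {σ : Chain V k}
    (hσ : IsDescendingCycle f k a σ) (h : C(V × ℝ, V)) (h0 : ∀ v, h (v, 0) = v)
    (hf : ∀ v, ∀ r ∈ Icc (0 : ℝ) 1, f (h (v, r)) ≤ f v) :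
    ¬ ∀ v ∈ chainImage σ, f (h (v, 1)) ≤ -a := by
  intro h1
  obtain ⟨hσa, hσb, hσn⟩ := hσ
  have hlow : ∀ c : ℝ, ∀ v ∈ sublevel f c, ∀ r ∈ Icc (0 : ℝ) 1, h (v, r) ∈ sublevel f c :=
    fun c v hv r hr => (hf v r hr).trans hv
  -- Modulo 2, σ plus the boundary of its prism is the pushed chain plus the prism over ∂σ. Both lie
  -- in {f ≤ -a}: the first by assumption, the second because f decreases along the deformation.
  refine hσn ⟨prism h k σ, mem_chainsIn.1 (prism_mem (hlow a) (mem_chainsIn.2 hσa)), ?_⟩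
  rw [boundary_eq, ← mem_chainsIn]
  have hp : pushAt h 1 k σ ∈ chainsIn (sublevel f (-a)) k :=
    pushAt_mem (A := chainImage σ) h1 (mem_chainsIn.2 Subset.rfl)
  have hss : σ + σ = 0 := by ext v; simpa using CharTwo.add_self_eq_zero (σ v)
  cases k with
  | zero =>
    rw [boundaryHom_prism_zero, pushAt_eq_self h0, ← add_assoc, hss, zero_add]
    exact hp
  | succ k =>
    rw [boundaryHom_prism_succ, pushAt_eq_self h0, ← add_assoc, ← add_assoc, hss, zero_add]
    refine Submodule.add_mem _ hp (prism_mem (hlow (-a)) (mem_chainsIn.2 ?_))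
    rw [← boundary_eq]
    exact hσb

end Prism

section AbstractMinmax

/-! ### Minmax of functions that decrease along the rays from a fibrewise maximum -/

lemma chainImage_single {V : Type*} [NormedAddCommGroup V] {n : ℕ} (σ : SingularSimplex V n) :
    chainImage (Finsupp.single σ (1 : ZMod 2)) = range σ := by
  rw [chainImage, Finsupp.support_single _ one_ne_zero]
  simp

lemma isCompact_chainImage {V : Type*} [NormedAddCommGroup V] {n : ℕ} (c : Chain V n) :
    IsCompact (chainImage c) :=
  c.support.isCompact_biUnion fun σ _ => isCompact_range σ.continuous

/-! ### Affine coordinates of a simplex centred at the origin of a fibre -/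

section Coordinates

variable {Y : Type*} [AddCommGroup Y] [Module ℝ Y] {k : ℕ} (b : Module.Basis (Fin k) ℝ Y)

/-- Linear forms with sum zero, the coordinates together with minus their sum. -/
def simplexForm (i : Fin (k + 1)) (y : Y) : ℝ :=
  Fin.lastCases (motive := fun _ => ℝ) (-∑ j, b.repr y j) (fun j => b.repr y j) i

lemma simplexForm_castSucc (j : Fin k) (y : Y) : simplexForm b j.castSucc y = b.repr y j := by
  simp [simplexForm]

lemma simplexForm_last (y : Y) : simplexForm b (Fin.last k) y = -∑ j, b.repr y j := by
  simp [simplexForm]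

lemma sum_simplexForm (y : Y) : ∑ i, simplexForm b i y = 0 := by
  rw [Fin.sum_univ_castSucc]
  simp [simplexForm_castSucc, simplexForm_last]

lemma simplexForm_smul (i : Fin (k + 1)) (r : ℝ) (y : Y) :
    simplexForm b i (r • y) = r * simplexForm b i y := by
  refine Fin.lastCases ?_ (fun j => ?_) i
  · simp [simplexForm_last, Finset.mul_sum]
  · simp [simplexForm_castSucc]

/-- The forms have sum zero and separate points, so the open half-spaces where one of them is
negative cover the complement of 0. They are the sets `U i` of the Sperner argument. -/
lemma exists_simplexForm_neg {y : Y} (hy : y ≠ 0) : ∃ i, simplexForm b i y < 0 := by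
  by_contra! h
  have h0 := (Finset.sum_eq_zero_iff_of_nonneg fun i _ => h i).1 (sum_simplexForm b y)
  refine hy (b.repr.injective ?_)
  ext j
  simpa [simplexForm_castSucc] using h0 j.castSucc (Finset.mem_univ _)

lemma exists_simplexForm_pos {y : Y} {i : Fin (k + 1)} (hi : simplexForm b i y < 0) :
    ∃ j, 0 < simplexForm b j y := by
  by_contra! h
  have h0 := (Finset.sum_eq_zero_iff_of_nonpos fun i _ => h i).1 (sum_simplexForm b y)
  exact hi.ne (h0 i (Finset.mem_univ _))

/-- The point with barycentric coordinates `s` in a simplex centred at `0`. -/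
def simplexPoint (s : Simplex k) : Y := ∑ j : Fin k, (s.1 j.castSucc - ((k : ℝ) + 1)⁻¹) • b j

lemma simplexForm_simplexPoint (s : Simplex k) (i : Fin (k + 1)) :
    simplexForm b i (simplexPoint b s) = s.1 i - ((k : ℝ) + 1)⁻¹ := by
  have h : ∀ j, b.repr (simplexPoint b s) j = s.1 j.castSucc - ((k : ℝ) + 1)⁻¹ := by
    intro j
    rw [simplexPoint, b.repr_sum_self]
  refine Fin.lastCases ?_ (fun j => ?_) i
  · rw [simplexForm_last]
    simp only [h, Finset.sum_sub_distrib]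
    have hs := s.2.2
    rw [Fin.sum_univ_castSucc] at hs
    have : (∑ j : Fin k, ((k : ℝ) + 1)⁻¹) = 1 - ((k : ℝ) + 1)⁻¹ := by
      simp; field_simp; ring
    rw [this]
    linarith
  · rw [simplexForm_castSucc, h]

end Coordinates

open Classical in
/-- A label of `y`: an index at which the linear forms are positive. -/
def simplexLabel {Y : Type*} [AddCommGroup Y] [Module ℝ Y] {k : ℕ} (b : Module.Basis (Fin k) ℝ Y)
    (y : Y) : Fin (k + 1) :=
  if h : ∃ i, 0 < simplexForm b i y then h.choose else 0

lemma simplexLabel_ne {Y : Type*} [AddCommGroup Y] [Module ℝ Y] {k : ℕ}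
    (b : Module.Basis (Fin k) ℝ Y) {y : Y} {i : Fin (k + 1)} (hi : simplexForm b i y < 0) :
    simplexLabel b y ≠ i := by
  have h := exists_simplexForm_pos b hi
  rw [simplexLabel, dif_pos h]
  intro he
  have := h.choose_spec
  rw [he] at this
  exact this.not_gt hi

variable {V P Y : Type*} [NormedAddCommGroup V] [NormedSpace ℝ V] [NormedAddCommGroup P]
  [NormedSpace ℝ P] [NormedAddCommGroup Y] [NormedSpace ℝ Y]

/-- The sets of points from which the dilation by n + 1 about `m` brings f below `a` are open, cover
`K`, and increase with n because f decreases along rays. By compactness one n suffices. -/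
lemma exists_uniform_ray {f : V → ℝ} (hf : Continuous f) (e : V ≃L[ℝ] P × Y) {m : P → Y}
    (hm : Continuous m)
    (hanti : ∀ p w, AntitoneOn (fun r : ℝ => f (e.symm (p, m p + r • w))) (Ici 0))
    (hbot : ∀ p w, w ≠ 0 → Tendsto (fun r : ℝ => f (e.symm (p, m p + r • w))) atTop atBot)
    {K : Set V} (hK : IsCompact K) (hKm : ∀ v ∈ K, (e v).2 ≠ m (e v).1) (a : ℝ) :
    ∃ R : ℝ, 0 < R ∧ ∀ v ∈ K, f (e.symm ((e v).1, m (e v).1 + R • ((e v).2 - m (e v).1))) ≤ a := by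
  set O : ℕ → Set V := fun n =>
    {v | f (e.symm ((e v).1, m (e v).1 + ((n : ℝ) + 1) • ((e v).2 - m (e v).1))) < a} with hO
  have hopen : ∀ n, IsOpen (O n) := by
    intro n
    refine isOpen_lt (hf.comp (e.symm.continuous.comp ?_)) continuous_const
    have h1 : Continuous fun v => (e v).1 := continuous_fst.comp e.continuous
    have h2 : Continuous fun v => (e v).2 := continuous_snd.comp e.continuous
    exact h1.prodMk ((hm.comp h1).add ((h2.sub (hm.comp h1)).const_smul _))
  have hmono : Monotone O := by
    intro n n' hn v hv
    refine lt_of_le_of_lt (hanti _ _ ?_ ?_ ?_) hv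
    · simp only [mem_Ici]; positivity
    · simp only [mem_Ici]; positivity
    · have : (n : ℝ) ≤ n' := by exact_mod_cast hn
      linarith
  have hcover : K ⊆ ⋃ n, O n := by
    intro v hv
    have h := hbot (e v).1 _ (sub_ne_zero.2 (hKm v hv))
    have h' := h.comp (tendsto_atTop_add_const_right atTop (1 : ℝ) tendsto_natCast_atTop_atTop)
    obtain ⟨n, hn⟩ := (h'.eventually (eventually_lt_atBot a)).exists
    exact mem_iUnion.2 ⟨n, hn⟩
  obtain ⟨n, hn⟩ := hK.elim_directed_cover O hopen hcover hmono.directed_le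
  exact ⟨n + 1, by positivity, fun v hv => (hn hv).le⟩

/-- A function that decreases to `-∞` along the rays issued from a continuous family of points
`m p` of the fibres `{p} × Y` has the minimum of `p ↦ f (p, m p)` as its minmax in dimension
`dim Y`. -/
theorem isGLB_descendingCycles [FiniteDimensional ℝ Y] {f : V → ℝ} (hf : Continuous f) (e : V ≃L[ℝ] P × Y) {m : P → Y}
    (hm : Continuous m)
    (hanti : ∀ p w, AntitoneOn (fun r : ℝ => f (e.symm (p, m p + r • w))) (Ici 0))
    (hbot : ∀ p w, w ≠ 0 → Tendsto (fun r : ℝ => f (e.symm (p, m p + r • w))) atTop atBot)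
    {p₀ : P} (hp₀ : ∀ p, f (e.symm (p₀, m p₀)) ≤ f (e.symm (p, m p))) {k : ℕ}
    (hk : Module.finrank ℝ Y = k) :
    ∀ᶠ a in atTop, IsGLB {M : ℝ | ∃ σ : Chain V k, IsDescendingCycle f k a σ ∧
      IsGreatest (f '' chainImage σ) M} (f (e.symm (p₀, m p₀))) := by
  set c := f (e.symm (p₀, m p₀)) with hc
  filter_upwards [eventually_gt_atTop c, eventually_gt_atTop (-c)] with a ha ha'
  have hne : ∀ v, f v < c → (e v).2 ≠ m (e v).1 := by
    intro v hv h
    have h1 := hp₀ (e v).1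
    rw [← h, Prod.mk.eta, e.symm_apply_apply] at h1
    exact (hc ▸ h1).not_gt hv
  -- The infimum is attained, by one simplex in the fibre over `p₀` centred at `m p₀`.
  refine IsLeast.isGLB ⟨?_, ?_⟩
  · let b : Module.Basis (Fin k) ℝ Y := Module.finBasisOfFinrankEq ℝ Y hk
    have hform : ∀ i, Continuous (simplexForm b i) := by
      intro i
      have h : ∀ j, Continuous fun y => b.repr y j := fun j =>
        (LinearMap.continuous_of_finiteDimensional (b.coord j))
      refine Fin.lastCases ?_ (fun j => ?_) i
      · simp only [funext fun y => simplexForm_last b y]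
        exact (continuous_finsetSum _ fun j _ => h j).neg
      · simpa only [funext fun y => simplexForm_castSucc b j y] using h j
    have hpt : Continuous (simplexPoint b) := continuous_finsetSum _ fun j _ =>
      (((continuous_apply _).comp continuous_subtype_val).sub continuous_const).smul
        continuous_const
    have hpt0 : ∀ s : Simplex k, ∀ i, s.1 i = 0 → simplexForm b i (simplexPoint b s) < 0 := by
      intro s i hi
      rw [simplexForm_simplexPoint, hi, zero_sub, neg_lt_zero]
      positivity
    have form_zero : ∀ i, simplexForm b i 0 = 0 := by
      intro i; simpa using simplexForm_smul b i 0 0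
    -- The boundary of the simplex is compact and avoids the centre, so a large enough dilation
    -- takes it into {f ≤ -a}.
    obtain ⟨R, hR, hRa⟩ : ∃ R : ℝ, 0 < R ∧ ∀ (s : Simplex k) (i), s.1 i = 0 →
        f (e.symm (p₀, m p₀ + R • simplexPoint b s)) ≤ -a := by
      have hcl : IsClosed {s : Simplex k | ∃ i, s.1 i = 0} := by
        simp only [ofPred_exists]
        exact isClosed_iUnion_of_finite fun i => isClosed_eq
          ((continuous_apply _).comp continuous_subtype_val) continuous_const
      have hg : Continuous fun s : Simplex k => e.symm (p₀, m p₀ + simplexPoint b s) :=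
        e.symm.continuous.comp (continuous_const.prodMk (continuous_const.add hpt))
      obtain ⟨R, hR, h⟩ := exists_uniform_ray hf e hm hanti hbot (hcl.isCompact.image hg) (by
        rintro _ ⟨s, ⟨i, hi⟩, rfl⟩ h
        simp only [e.apply_symm_apply, add_eq_left] at h
        have := hpt0 s i hi
        rw [h, form_zero] at this
        exact this.false) (-a)
      refine ⟨R, hR, fun s i hi => ?_⟩
      simpa using h _ ⟨s, ⟨i, hi⟩, rfl⟩
    let σ : SingularSimplex V k := ⟨fun s => e.symm (p₀, m p₀ + R • simplexPoint b s),
      e.symm.continuous.comp (continuous_const.prodMk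
        (continuous_const.add (hpt.const_smul R)))⟩
    have hσ : ∀ s, σ s = e.symm (p₀, m p₀ + R • simplexPoint b s) := fun _ => rfl
    have hle : ∀ s, f (σ s) ≤ c := by
      intro s
      have := hanti p₀ (simplexPoint b s) (mem_Ici.2 le_rfl) (mem_Ici.2 hR.le) hR.le
      simpa [hσ, hc] using this
    refine ⟨Finsupp.single σ 1, ⟨?_, ?_, ?_⟩, ?_, ?_⟩
    · rw [chainImage_single]
      rintro _ ⟨s, rfl⟩
      exact (hle s).trans ha.le
    · cases k with
      | zero => trivial
      | succ k =>
        change chainImage (boundary _) ⊆ _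
        rw [boundary_eq, boundaryHom_single, ← mem_chainsIn]
        refine Submodule.sum_mem _ fun i _ => Finsupp.single_mem_supported _ _ ?_
        rintro _ ⟨s, rfl⟩
        refine hRa _ i ?_
        have h0 := sum_simplexMap_smul i.succAbove s (fun j => if j = i then (1 : ℝ) else 0)
        simpa [Fin.succAbove_ne] using h0
    -- Since -a < c, a point of {f ≤ -a} is off the graph of `m`, so some form is negative there.
    -- Labelling each point off the graph by a form that is positive excludes every such chain from
    -- the class of σ.
    · rintro ⟨τ, -, hτ⟩
      have hy : ∀ v : V, Continuous fun v => (e v).2 - m (e v).1 := fun _ =>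
        (continuous_snd.comp e.continuous).sub (hm.comp (continuous_fst.comp e.continuous))
      refine not_chainImage_subset_of_labels
        (l := fun v => simplexLabel b ((e v).2 - m (e v).1))
        (U := fun i => {v | simplexForm b i ((e v).2 - m (e v).1) < 0})
        (fun i => isOpen_lt ((hform i).comp (hy 0)) continuous_const)
        (fun i v hv => simplexLabel_ne b hv) (σ := σ) ?_ ?_ τ ?_
      · intro i
        simp only [hσ, e.apply_symm_apply, add_sub_cancel_left]
        by_contra hne
        have hpos : ∃ j, 0 < simplexForm b j (R • simplexPoint b (stdSimplex.vertex i)) := by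
          have : simplexForm b (simplexLabel b (R • simplexPoint b (stdSimplex.vertex i)))
              (R • simplexPoint b (stdSimplex.vertex i)) < 0 := by
            rw [simplexForm_smul, simplexForm_simplexPoint]
            refine mul_neg_of_pos_of_neg hR ?_
            change (Pi.single i 1 : Fin (k + 1) → ℝ) _ - _ < 0
            rw [Pi.single_eq_of_ne hne, zero_sub, neg_lt_zero]
            positivity
          exact exists_simplexForm_pos b this
        have hspec := hpos.choose_spec
        have hl : simplexLabel b (R • simplexPoint b (stdSimplex.vertex i)) = hpos.choose := by
          rw [simplexLabel, dif_pos hpos]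
        rw [← hl, simplexForm_smul, simplexForm_simplexPoint] at hspec
        have h2 := (mul_pos_iff_of_pos_left hR).1 hspec
        change 0 < (Pi.single i 1 : Fin (k + 1) → ℝ) _ - _ at h2
        rw [Pi.single_eq_of_ne hne, zero_sub, neg_pos] at h2
        have : 0 < ((k : ℝ) + 1)⁻¹ := by positivity
        linarith
      · intro i s hs
        simp only [hσ, e.apply_symm_apply, add_sub_cancel_left]
        refine simplexLabel_ne b ?_
        rw [simplexForm_smul]
        exact mul_neg_of_pos_of_neg hR (hpt0 s i hs)
      · intro v hv
        have hv' : f v < c := lt_of_le_of_lt (hτ hv) (by linarith)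
        obtain ⟨i, hi⟩ := exists_simplexForm_neg b (sub_ne_zero.2 (hne v hv'))
        exact mem_iUnion.2 ⟨i, hi⟩
    · rw [chainImage_single]
      refine ⟨σ stdSimplex.barycenter, mem_range_self _, ?_⟩
      have : simplexPoint b (stdSimplex.barycenter : Simplex k) = 0 := by
        refine Finset.sum_eq_zero fun j _ => ?_
        rw [stdSimplex.barycenter_apply]
        simp
      rw [hσ, this, smul_zero, add_zero]
    · rw [chainImage_single]
      rintro _ ⟨_, ⟨s, rfl⟩, rfl⟩
      exact hle s
  -- A chain on which f < c avoids the graph of `m`. Dilating from the graph by 1 + rR, for r from 0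
  -- to 1, lowers f and carries the chain into {f ≤ -a}, against the nontriviality of its class.
  · rintro M ⟨σ, hσ, hM⟩
    by_contra! hlt
    have hlt' : ∀ v ∈ chainImage σ, f v < c := fun v hv =>
      lt_of_le_of_lt (hM.2 ⟨v, hv, rfl⟩) hlt
    obtain ⟨R, hR, h⟩ := exists_uniform_ray hf e hm hanti hbot (isCompact_chainImage σ)
      (fun v hv => hne v (hlt' v hv)) (-a)
    have h1 : Continuous fun v => (e v).1 := continuous_fst.comp e.continuous
    have h2 : Continuous fun v => (e v).2 := continuous_snd.comp e.continuous
    let H : C(V × ℝ, V) := ⟨fun q => e.symm ((e q.1).1, m (e q.1).1 +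
      (1 + q.2 * R) • ((e q.1).2 - m (e q.1).1)), by
        refine e.symm.continuous.comp ((h1.comp continuous_fst).prodMk
          ((hm.comp (h1.comp continuous_fst)).add (Continuous.smul ?_ ?_)))
        · exact continuous_const.add (continuous_snd.mul continuous_const)
        · exact (h2.comp continuous_fst).sub (hm.comp (h1.comp continuous_fst))⟩
    have hH : ∀ v r, H (v, r) = e.symm ((e v).1, m (e v).1 +
      (1 + r * R) • ((e v).2 - m (e v).1)) := fun _ _ => rfl
    have h0 : ∀ v, H (v, 0) = v := by
      intro v; rw [hH]; simp
    refine hσ.not_deformable H h0 (fun v r hr => ?_) fun v hv => ?_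
    · conv_rhs => rw [← h0 v]
      rw [hH, hH]
      refine hanti _ _ ?_ ?_ ?_
      · simp
      · have := mul_nonneg hr.1 hR.le; simp only [mem_Ici]; linarith
      · have := mul_nonneg hr.1 hR.le; linarith
    · refine le_trans ?_ (h v hv)
      rw [hH]
      refine hanti _ _ hR.le ?_ ?_
      · simp only [mem_Ici]; linarith
      · linarith

end AbstractMinmax

end HJ
end

noncomputable section

namespace HJ

section Regularity

/-! ### Estimates on the Hamiltonian -/

variable {d : ℕ}

/-- The Euclidean phase space. -/
abbrev Phase (d : ℕ) : Type := WithLp 2 (E d × E d)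

/-- The hypotheses on the Hamiltonian. -/
structure IsAdmissibleHamiltonian (T : ℝ) (H : ℝ → E d → E d → ℝ) : Prop where
  pos : 0 < T
  contDiffOn : ContDiffOn ℝ 2 (fun z : ℝ × E d × E d => H z.1 z.2.1 z.2.2) (Icc 0 T ×ˢ univ)
  strictConvexOn : ∀ t ∈ Icc 0 T, ∀ x, StrictConvexOn ℝ univ (H t x)
  eq_sq : ∃ K : Set (ℝ × E d × E d), IsCompact K ∧
      ∀ t ∈ Icc 0 T, ∀ x p, (t, x, p) ∉ K → H t x p = ‖p‖ ^ 2

/-- The Hamiltonian at time `t` as a function on the Euclidean phase space. -/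
def phaseFun (H : ℝ → E d → E d → ℝ) (t : ℝ) (w : Phase d) : ℝ := H t w.fst w.snd

section Slices

variable {F G : Type*} [NormedAddCommGroup F] [NormedSpace ℝ F] [NormedAddCommGroup G]
  [NormedSpace ℝ G]

/-- Regularity in time is one-sided at 0 and T, but the slice at fixed time is differentiable on the
whole space, with the space part of the derivative within the strip. -/
lemma fderiv_slice {T : ℝ} {f : ℝ × F → G} {n : WithTop ℕ∞} (hn : n ≠ 0)
    (hf : ContDiffOn ℝ n f (Icc 0 T ×ˢ univ)) {t : ℝ} (ht : t ∈ Icc 0 T) (w : F) :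
    HasFDerivAt (fun w => f (t, w))
      ((fderivWithin ℝ f (Icc 0 T ×ˢ univ) (t, w)).comp (ContinuousLinearMap.inr ℝ ℝ F)) w := by
  have h1 : HasFDerivWithinAt f (fderivWithin ℝ f (Icc 0 T ×ˢ univ) (t, w)) (Icc 0 T ×ˢ univ)
      (t, w) := ((hf.differentiableOn hn) (t, w) ⟨ht, mem_univ _⟩).hasFDerivWithinAt
  have h2 : HasFDerivAt (fun w : F => (t, w)) (ContinuousLinearMap.inr ℝ ℝ F) w :=
    hasFDerivAt_prodMk_right t w
  rw [← hasFDerivWithinAt_univ] at h2 ⊢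
  exact HasFDerivWithinAt.comp w h1 h2 fun w _ => ⟨ht, mem_univ _⟩

lemma contDiffOn_fderiv_slice {T : ℝ} (hT : 0 < T) {f : ℝ × F → G} {m n : WithTop ℕ∞}
    (hmn : m + 1 ≤ n) (hf : ContDiffOn ℝ n f (Icc 0 T ×ˢ univ)) :
    ContDiffOn ℝ m (fun q : ℝ × F => fderiv ℝ (fun w => f (q.1, w)) q.2) (Icc 0 T ×ˢ univ) := by
  have hn : n ≠ 0 := by
    rintro rfl
    exact absurd (le_trans (le_add_left le_rfl) hmn) (by simp)
  have hu : UniqueDiffOn ℝ (Icc 0 T ×ˢ (univ : Set F)) :=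
    (uniqueDiffOn_Icc hT).prod uniqueDiffOn_univ
  have h1 : ContDiffOn ℝ m (fun q => (fderivWithin ℝ f (Icc 0 T ×ˢ univ) q).comp
      (ContinuousLinearMap.inr ℝ ℝ F)) (Icc 0 T ×ˢ univ) :=
    (hf.fderivWithin hu hmn).clm_comp contDiffOn_const
  exact h1.congr fun q hq => (fderiv_slice hn hf hq.1 q.2).fderiv

end Slices

lemma exists_bound_of_eq_zero_off {F G : Type*} [NormedAddCommGroup F] [NormedAddCommGroup G]
    {T : ℝ} {f : ℝ × F → G} (hf : ContinuousOn f (Icc 0 T ×ˢ univ)) {K : Set (ℝ × F)}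
    (hK : IsCompact K) (h0 : ∀ q ∈ Icc 0 T ×ˢ (univ : Set F), q ∉ K → f q = 0) :
    ∃ C, 0 ≤ C ∧ ∀ t ∈ Icc 0 T, ∀ w, ‖f (t, w)‖ ≤ C := by
  obtain ⟨C, hC⟩ := (hK.inter_right (isClosed_Icc.prod isClosed_univ)).exists_bound_of_continuousOn
    (hf.mono inter_subset_right)
  refine ⟨max C 0, le_max_right _ _, fun t ht w => ?_⟩
  by_cases h : (t, w) ∈ K
  · exact (hC _ ⟨h, ht, mem_univ _⟩).trans (le_max_left _ _)
  · rw [h0 _ ⟨ht, mem_univ _⟩ h, norm_zero]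
    exact le_max_right _ _

/-! ### Second order bounds and convexity -/

section SecondOrder

variable {F : Type*} [NormedAddCommGroup F] [NormedSpace ℝ F]

lemma exists_hasFDerivAt_norm_sq {G : Type*} [NormedAddCommGroup G] [InnerProductSpace ℝ G]
    (π : F →L[ℝ] G) : ∃ L : F →L[ℝ] (F →L[ℝ] ℝ), (∀ w v, L w v = 2 * inner ℝ (π w) (π v)) ∧
      ∀ w, HasFDerivAt (fun w => ‖π w‖ ^ 2) (L w) w := by
  let A : (G →L[ℝ] ℝ) →L[ℝ] (F →L[ℝ] ℝ) := (ContinuousLinearMap.compL ℝ F G ℝ).flip π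
  let J : G →L[ℝ] (G →L[ℝ] ℝ) := innerSL ℝ
  refine ⟨(2 : ℝ) • A.comp (J.comp π), fun w v => by simp [A, J]; rfl, fun w => ?_⟩
  have h := (π.hasFDerivAt (x := w)).norm_sq
  convert h using 1
  ext v
  simp [A, J]
  rfl

/-- The second derivative minus the constant second derivative `L` of the model `q` is continuous on
the strip and vanishes off a compact set. -/
lemma exists_bound_fderiv_fderiv_of_eventuallyEq {T : ℝ} (hT : 0 < T) {f : ℝ → F → ℝ}
    (hf : ContDiffOn ℝ 2 (fun q : ℝ × F => f q.1 q.2) (Icc 0 T ×ˢ univ)) {q : F → ℝ}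
    {L : F →L[ℝ] (F →L[ℝ] ℝ)} (hq : ∀ w, HasFDerivAt q (L w) w) {K : Set (ℝ × F)}
    (hK : IsCompact K) (hKf : ∀ t ∈ Icc 0 T, ∀ w, (t, w) ∉ K → f t =ᶠ[𝓝 w] q) :
    ∃ C, ∀ t ∈ Icc 0 T, ∀ w, ‖fderiv ℝ (fderiv ℝ (f t)) w‖ ≤ C := by
  have hD : ContDiffOn ℝ 1 (fun q : ℝ × F => fderiv ℝ (f q.1) q.2) (Icc 0 T ×ˢ univ) :=
    contDiffOn_fderiv_slice hT (by norm_num) hf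
  have hD2 : ContinuousOn (fun q : ℝ × F => fderiv ℝ (fderiv ℝ (f q.1)) q.2)
      (Icc 0 T ×ˢ univ) :=
    (contDiffOn_fderiv_slice (m := 0) hT (by norm_num) hD).continuousOn
  have hsq : fderiv ℝ q = L := funext fun w => (hq w).fderiv
  obtain ⟨C, -, hC⟩ := exists_bound_of_eq_zero_off (T := T)
    (f := fun q : ℝ × F => fderiv ℝ (fderiv ℝ (f q.1)) q.2 - L)
    (hD2.sub continuousOn_const) hK (fun r hr hrK => by
      have h := ((hKf r.1 hr.1 r.2 hrK).fderiv (𝕜 := ℝ)).fderiv_eq (𝕜 := ℝ)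
      rw [h, hsq, L.fderiv, sub_self])
  refine ⟨C + ‖L‖, fun t ht w => ?_⟩
  have := norm_add_le (fderiv ℝ (fderiv ℝ (f t)) w - L) L
  rw [sub_add_cancel] at this
  linarith [hC t ht w]

lemma exists_bound_fderiv_sub_of_eventuallyEq {T : ℝ} (hT : 0 < T) {f : ℝ → F → ℝ}
    (hf : ContDiffOn ℝ 2 (fun q : ℝ × F => f q.1 q.2) (Icc 0 T ×ˢ univ)) {q : F → ℝ}
    {L : F →L[ℝ] (F →L[ℝ] ℝ)} (hq : ∀ w, HasFDerivAt q (L w) w) {K : Set (ℝ × F)}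
    (hK : IsCompact K) (hKf : ∀ t ∈ Icc 0 T, ∀ w, (t, w) ∉ K → f t =ᶠ[𝓝 w] q) :
    ∃ C, 0 ≤ C ∧ ∀ t ∈ Icc 0 T, ∀ w, |f t w - q w| ≤ C ∧ ‖fderiv ℝ (f t) w - L w‖ ≤ C := by
  have hD : ContDiffOn ℝ 1 (fun q : ℝ × F => fderiv ℝ (f q.1) q.2) (Icc 0 T ×ˢ univ) :=
    contDiffOn_fderiv_slice hT (by norm_num) hf
  have hqc : Continuous q := continuous_iff_continuousAt.2 fun w => (hq w).continuousAt
  obtain ⟨C, hC0, hC⟩ := exists_bound_of_eq_zero_off (T := T)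
    (f := fun r : ℝ × F => f r.1 r.2 - q r.2)
    (hf.continuousOn.sub (hqc.comp continuous_snd).continuousOn) hK (fun r hr hrK => by
      rw [(hKf r.1 hr.1 r.2 hrK).eq_of_nhds, sub_self])
  obtain ⟨C', hC0', hC'⟩ := exists_bound_of_eq_zero_off (T := T)
    (f := fun r : ℝ × F => fderiv ℝ (f r.1) r.2 - L r.2)
    (hD.continuousOn.sub (L.continuous.comp continuous_snd).continuousOn) hK (fun r hr hrK => by
      rw [(hKf r.1 hr.1 r.2 hrK).fderiv_eq, (hq _).fderiv, sub_self])
  exact ⟨max C C', hC0.trans (le_max_left _ _), fun t ht w =>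
    ⟨(hC t ht w).trans (le_max_left _ _), (hC' t ht w).trans (le_max_right _ _)⟩⟩

lemma ContDiff.differentiable_fderiv_of_two {g : F → ℝ} (hg : ContDiff ℝ 2 g) :
    Differentiable ℝ (fderiv ℝ g) :=
  (hg.fderiv_right (m := 1) (by norm_num)).differentiable (by norm_num)

lemma norm_fderiv_sub_le_of_bound {g : F → ℝ} (hg : ContDiff ℝ 2 g) {c : ℝ}
    (hc : ∀ w, ‖fderiv ℝ (fderiv ℝ g) w‖ ≤ c) (w w' : F) :
    ‖fderiv ℝ g w' - fderiv ℝ g w‖ ≤ c * ‖w' - w‖ :=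
  convex_univ.norm_image_sub_le_of_norm_fderiv_le
    (fun x _ => ContDiff.differentiable_fderiv_of_two hg x) (fun x _ => hc x) (mem_univ _)
    (mem_univ _)

lemma taylor_le_of_bound {g : F → ℝ} (hg : ContDiff ℝ 2 g) {c : ℝ}
    (hc : ∀ w, ‖fderiv ℝ (fderiv ℝ g) w‖ ≤ c) (w w' : F) :
    |g w' - g w - fderiv ℝ g w (w' - w)| ≤ c * ‖w' - w‖ ^ 2 := by
  have hd : Differentiable ℝ g := hg.differentiable (by norm_num)
  have hc0 : 0 ≤ c := (norm_nonneg (fderiv ℝ (fderiv ℝ g) 0)).trans (hc 0)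
  have h := (convex_segment (𝕜 := ℝ) w w').norm_image_sub_le_of_norm_hasFDerivWithin_le'
    (f := g) (f' := fderiv ℝ g) (φ := fderiv ℝ g w) (C := c * ‖w' - w‖)
    (fun x _ => (hd x).hasFDerivAt.hasFDerivWithinAt) (fun x hx => by
      refine (norm_fderiv_sub_le_of_bound hg hc w x).trans ?_
      gcongr
      exact norm_sub_le_of_mem_segment hx) (left_mem_segment ℝ w w') (right_mem_segment ℝ w w')
  rw [Real.norm_eq_abs] at h
  rw [pow_two, ← mul_assoc]
  exact h

lemma fderiv_fderiv_nonneg_of_convexOn {g : F → ℝ} (hg : ContDiff ℝ 2 g) {w v : F}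
    (hv : ConvexOn ℝ univ fun r : ℝ => g (w + r • v)) : 0 ≤ fderiv ℝ (fderiv ℝ g) w v v := by
  have hd : Differentiable ℝ g := hg.differentiable (by norm_num)
  have hline : ∀ r : ℝ, HasDerivAt (fun r : ℝ => w + r • v) v r := fun r => by
    simpa using ((hasDerivAt_id r).smul_const v).const_add w
  have h1 : ∀ r : ℝ, HasDerivAt (fun r : ℝ => g (w + r • v)) (fderiv ℝ g (w + r • v) v) r :=
    fun r => (hd _).hasFDerivAt.comp_hasDerivAt r (hline r)
  have h2 : HasDerivAt (fun r : ℝ => fderiv ℝ g (w + r • v) v)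
      (fderiv ℝ (fderiv ℝ g) w v v) 0 := by
    have h3 := (ContDiff.differentiable_fderiv_of_two hg (w + (0 : ℝ) • v)).hasFDerivAt.comp_hasDerivAt
      (0 : ℝ) (hline 0)
    have h4 := h3.clm_apply (hasDerivAt_const (0 : ℝ) v)
    simpa using h4
  have hmono : Monotone fun r : ℝ => fderiv ℝ g (w + r • v) v := by
    have h5 := hv.monotoneOn_deriv (fun r _ => (h1 r).differentiableAt)
    intro a b hab
    simpa only [(h1 _).deriv] using h5 (mem_univ a) (mem_univ b) hab
  rw [← h2.deriv]
  exact hmono.deriv_nonneg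

/-- The twisted monotonicity of the differential of a function that is convex in some directions. -/
lemma neg_le_fderiv_sub_of_bound {g : F → ℝ} (hg : ContDiff ℝ 2 g) {c : ℝ}
    (hc : ∀ w, ‖fderiv ℝ (fderiv ℝ g) w‖ ≤ c) {ξ η ζ : F} {k : ℝ} (hk : 0 ≤ k)
    (hconv : ∀ w, 0 ≤ fderiv ℝ (fderiv ℝ g) w (η + k • ζ) (η + k • ζ)) (hζ : ‖ζ‖ = ‖ξ‖) (w : F) :
    -(c * (1 + k) ^ 2 * ‖ξ‖ ^ 2) ≤
      (fderiv ℝ g (w + (ξ + η)) - fderiv ℝ g w) (η - ξ + (2 * k) • ζ) := by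
  set Δ := ξ + η
  set v := η - ξ + (2 * k) • ζ
  have hline : ∀ r : ℝ, HasDerivAt (fun r : ℝ => w + r • Δ) Δ r := fun r => by
    simpa using ((hasDerivAt_id r).smul_const Δ).const_add w
  have h2 : ∀ r : ℝ, HasDerivAt (fun r : ℝ => fderiv ℝ g (w + r • Δ) v)
      (fderiv ℝ (fderiv ℝ g) (w + r • Δ) Δ v) r := by
    intro r
    have h3 := (ContDiff.differentiable_fderiv_of_two hg (w + r • Δ)).hasFDerivAt.comp_hasDerivAt
      r (hline r)
    have h4 := h3.clm_apply (hasDerivAt_const r v)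
    simpa using h4
  have hsymm : ∀ w a b, fderiv ℝ (fderiv ℝ g) w a b = fderiv ℝ (fderiv ℝ g) w b a := by
    intro w a b
    exact (hg.contDiffAt (x := w)).isSymmSndFDerivAt (by simp) a b
  have hquad : ∀ w a b, |fderiv ℝ (fderiv ℝ g) w a b| ≤ c * ‖a‖ * ‖b‖ := by
    intro w a b
    refine ((fderiv ℝ (fderiv ℝ g) w).le_opNorm₂ a b).trans ?_
    gcongr
    exact hc w
  have hlow : ∀ r : ℝ, -(c * (1 + k) ^ 2 * ‖ξ‖ ^ 2) ≤
      fderiv ℝ (fderiv ℝ g) (w + r • Δ) Δ v := by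
    intro r
    set B := fderiv ℝ (fderiv ℝ g) (w + r • Δ) with hB
    -- Completing the square in the convex directions. The square is nonnegative, and the three
    -- other terms, where ‖ζ‖ = ‖ξ‖, cost at most c(k² + 1 + 2k)‖ξ‖² = c(1 + k)²‖ξ‖².
    have e1 : B Δ v = B (η + k • ζ) (η + k • ζ) - k ^ 2 * B ζ ζ - B ξ ξ + 2 * k * B ξ ζ := by
      simp only [Δ, v, map_add, map_sub, map_smul, add_apply,
        smul_apply, smul_eq_mul]
      rw [hsymm _ η ξ, hsymm _ ζ η]
      ring
    have q1 := (abs_le.1 (hquad (w + r • Δ) ζ ζ)).2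
    have q2 := (abs_le.1 (hquad (w + r • Δ) ξ ξ)).2
    have q3 := (abs_le.1 (hquad (w + r • Δ) ξ ζ)).1
    rw [← hB] at q1 q2 q3
    rw [hζ] at q1 q3
    rw [e1]
    have q1' := mul_le_mul_of_nonneg_left q1 (sq_nonneg k)
    have q3' := mul_le_mul_of_nonneg_left q3 (by positivity : 0 ≤ 2 * k)
    have := hconv (w + r • Δ)
    nlinarith
  have hmvt := (convex_Icc (0 : ℝ) 1).mul_sub_le_image_sub_of_le_deriv
    (f := fun r : ℝ => fderiv ℝ g (w + r • Δ) v) (C := -(c * (1 + k) ^ 2 * ‖ξ‖ ^ 2))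
    (fun r _ => (h2 r).continuousAt.continuousWithinAt)
    (fun r _ => (h2 r).differentiableAt.differentiableWithinAt)
    (fun r _ => by rw [(h2 r).deriv]; exact hlow r) 0 (by simp) 1 (by simp) zero_le_one
  simpa using hmvt

end SecondOrder

namespace IsAdmissibleHamiltonian

variable {T : ℝ} {H : ℝ → E d → E d → ℝ}

lemma contDiffOn_phase (hH : IsAdmissibleHamiltonian T H) :
    ContDiffOn ℝ 2 (fun q : ℝ × Phase d => phaseFun H q.1 q.2) (Icc 0 T ×ˢ univ) := by
  have h : ContDiff ℝ 2 fun q : ℝ × Phase d => (q.1, q.2.fst, q.2.snd) :=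
    contDiff_fst.prodMk (((WithLp.fstL 2 ℝ (E d) (E d)).contDiff.comp contDiff_snd).prodMk
      ((WithLp.sndL 2 ℝ (E d) (E d)).contDiff.comp contDiff_snd))
  exact hH.contDiffOn.comp h.contDiffOn fun q hq => ⟨hq.1, mem_univ _⟩

lemma contDiff_phaseFun (hH : IsAdmissibleHamiltonian T H) {t : ℝ} (ht : t ∈ Icc 0 T) :
    ContDiff ℝ 2 (phaseFun H t) := by
  have h : ContDiff ℝ 2 fun w : Phase d => (t, w) := contDiff_const.prodMk contDiff_id
  exact hH.contDiffOn_phase.comp_contDiff h fun w => ⟨ht, mem_univ _⟩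

lemma exists_compact_eventuallyEq (hH : IsAdmissibleHamiltonian T H) :
    ∃ K : Set (ℝ × Phase d), IsCompact K ∧ ∀ t ∈ Icc 0 T, ∀ w, (t, w) ∉ K →
      phaseFun H t =ᶠ[𝓝 w] fun w => ‖w.snd‖ ^ 2 := by
  obtain ⟨K, hK, hKH⟩ := hH.eq_sq
  have hcont : Continuous fun q : ℝ × E d × E d => (q.1, (WithLp.toLp 2 q.2 : Phase d)) :=
    continuous_fst.prodMk ((WithLp.prod_continuous_toLp 2 (E d) (E d)).comp continuous_snd)
  refine ⟨_, hK.image hcont, fun t ht w hw => ?_⟩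
  have hcl := (hK.image hcont).isClosed
  have : ∀ᶠ w' in 𝓝 w, (t, w') ∉ (fun q : ℝ × E d × E d =>
      (q.1, (WithLp.toLp 2 q.2 : Phase d))) '' K :=
    (Continuous.prodMk_right t).continuousAt.eventually (hcl.isOpen_compl.mem_nhds hw)
  filter_upwards [this] with w' hw'
  exact hKH t ht _ _ fun h => hw' ⟨_, h, rfl⟩

/-- The real supremum defining `cH` dominates its set only because the set is bounded above; this is
where equality with |p|² off a compact set is used. -/
lemma norm_fderiv_fderiv_le (hH : IsAdmissibleHamiltonian T H) {t : ℝ} (ht : t ∈ Icc 0 T)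
    (w : Phase d) : ‖fderiv ℝ (fderiv ℝ (phaseFun H t)) w‖ ≤ cH H T := by
  obtain ⟨K, hK, hKH⟩ := hH.exists_compact_eventuallyEq
  obtain ⟨L, -, hL⟩ := exists_hasFDerivAt_norm_sq (WithLp.sndL 2 ℝ (E d) (E d))
  obtain ⟨C, hC⟩ := exists_bound_fderiv_fderiv_of_eventuallyEq hH.pos hH.contDiffOn_phase hL hK hKH
  refine le_csSup ⟨C, ?_⟩ ⟨t, ht, w, rfl⟩
  rintro _ ⟨t, ht, w, rfl⟩
  exact hC t ht w

lemma cH_nonneg (_ : IsAdmissibleHamiltonian T H) : 0 ≤ cH H T := by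
  refine Real.sSup_nonneg ?_
  rintro _ ⟨t, ht, w, rfl⟩
  positivity

lemma differentiable_phaseFun (hH : IsAdmissibleHamiltonian T H) {t : ℝ} (ht : t ∈ Icc 0 T) :
    Differentiable ℝ (phaseFun H t) :=
  (hH.contDiff_phaseFun ht).differentiable (by norm_num)

/-- Hamilton's vector field and the differential of the Hamiltonian. -/
lemma fderiv_phaseFun_apply (hH : IsAdmissibleHamiltonian T H) {t : ℝ} (ht : t ∈ Icc 0 T)
    (z : E d × E d) (v : Phase d) :
    fderiv ℝ (phaseFun H t) (WithLp.toLp 2 z) v =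
      inner ℝ (hamField H t z).1 v.snd - inner ℝ (hamField H t z).2 v.fst := by
  have hd := (hH.differentiable_phaseFun ht (WithLp.toLp 2 z)).hasFDerivAt
  set D := fderiv ℝ (phaseFun H t) (WithLp.toLp 2 z) with hD
  let e := (WithLp.prodContinuousLinearEquiv 2 ℝ (E d) (E d)).symm
  have h1 : HasFDerivAt (fun p => H t z.1 p)
      ((D.comp (e : E d × E d →L[ℝ] Phase d)).comp (ContinuousLinearMap.inr ℝ (E d) (E d))) z.2 := by
    have h2 : HasFDerivAt (fun p : E d => e (z.1, p))
        ((e : E d × E d →L[ℝ] Phase d).comp (ContinuousLinearMap.inr ℝ (E d) (E d))) z.2 :=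
      (e : E d × E d →L[ℝ] Phase d).hasFDerivAt.comp z.2 (hasFDerivAt_prodMk_right z.1 z.2)
    exact HasFDerivAt.comp (g := phaseFun H t) z.2 hd h2
  have h3 : HasFDerivAt (fun x => H t x z.2)
      ((D.comp (e : E d × E d →L[ℝ] Phase d)).comp (ContinuousLinearMap.inl ℝ (E d) (E d))) z.1 := by
    have h2 : HasFDerivAt (fun x : E d => e (x, z.2))
        ((e : E d × E d →L[ℝ] Phase d).comp (ContinuousLinearMap.inl ℝ (E d) (E d))) z.1 :=
      (e : E d × E d →L[ℝ] Phase d).hasFDerivAt.comp z.1 (hasFDerivAt_prodMk_left z.1 z.2)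
    exact HasFDerivAt.comp (g := phaseFun H t) z.1 hd h2
  rw [hamField, inner_neg_left, sub_neg_eq_add, inner_gradient_left, inner_gradient_left, h1.fderiv,
    h3.fderiv]
  simp only [ContinuousLinearMap.comp_apply, ← map_add]
  congr 1
  rw [ContinuousLinearMap.inr_apply, ContinuousLinearMap.inl_apply, Prod.mk_add_mk, zero_add,
    add_zero]
  rfl

end IsAdmissibleHamiltonian

end Regularity

end HJ
end

/-! ### Derivation of the analytic estimates from the hypotheses on the Hamiltonian -/

noncomputable section

namespace HJ

section Estimates

variable {d : ℕ}

/-- The Euclidean norm on the phase space. -/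
def phaseNorm (z : E d × E d) : ℝ := ‖(WithLp.toLp 2 z : Phase d)‖

lemma phaseNorm_sq (z : E d × E d) : phaseNorm z ^ 2 = ‖z.1‖ ^ 2 + ‖z.2‖ ^ 2 :=
  WithLp.prod_norm_sq_eq_of_L2 _

lemma phaseNorm_nonneg (z : E d × E d) : 0 ≤ phaseNorm z := norm_nonneg _

lemma norm_fst_le_phaseNorm (z : E d × E d) : ‖z.1‖ ≤ phaseNorm z :=
  abs_le_of_sq_le_sq' (by rw [phaseNorm_sq]; nlinarith [sq_nonneg ‖z.2‖]) (phaseNorm_nonneg z) |>.2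

lemma norm_snd_le_phaseNorm (z : E d × E d) : ‖z.2‖ ≤ phaseNorm z :=
  abs_le_of_sq_le_sq' (by rw [phaseNorm_sq]; nlinarith [sq_nonneg ‖z.1‖]) (phaseNorm_nonneg z) |>.2

lemma norm_le_phaseNorm (z : E d × E d) : ‖z‖ ≤ phaseNorm z :=
  max_le (norm_fst_le_phaseNorm z) (norm_snd_le_phaseNorm z)

lemma phaseNorm_le_add (z : E d × E d) : phaseNorm z ≤ ‖z.1‖ + ‖z.2‖ :=
  abs_le_of_sq_le_sq' (by
    rw [phaseNorm_sq]
    nlinarith [mul_nonneg (norm_nonneg z.1) (norm_nonneg z.2)]) (by positivity) |>.2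

/-- The estimates on a Hamiltonian on `[0,T]` used in the sequel: the constant `c` bounds the
second derivative and `B` bounds the difference with `|p|²` in the `C¹` norm. -/
structure HamiltonianEstimates (T c B : ℝ) (H : ℝ → E d → E d → ℝ) : Prop where
  pos : 0 < T
  c_nonneg : 0 ≤ c
  B_nonneg : 0 ≤ B
  continuousOn : ContinuousOn (fun q : ℝ × E d × E d => H q.1 q.2.1 q.2.2) (Icc 0 T ×ˢ univ)
  continuousOn_hamField : ContinuousOn (fun q : ℝ × E d × E d => hamField H q.1 q.2)
    (Icc 0 T ×ˢ univ)
  lipschitz : ∀ t ∈ Icc 0 T, ∀ z z',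
    phaseNorm (hamField H t z' - hamField H t z) ≤ c * phaseNorm (z' - z)
  taylor : ∀ t ∈ Icc 0 T, ∀ z z' : E d × E d,
    |H t z'.1 z'.2 - H t z.1 z.2 -
      (inner ℝ (hamField H t z).1 (z'.2 - z.2) - inner ℝ (hamField H t z).2 (z'.1 - z.1))| ≤
      c * phaseNorm (z' - z) ^ 2
  twist : ∀ t ∈ Icc 0 T, ∀ z z' : E d × E d, ∀ k : ℝ, 0 ≤ k →
    -(c * (1 + k) ^ 2 * ‖z'.1 - z.1‖ ^ 2) ≤
      inner ℝ ((hamField H t z').1 - (hamField H t z).1) (z'.2 - z.2 + (2 * k) • (z'.1 - z.1)) +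
        inner ℝ ((hamField H t z').2 - (hamField H t z).2) (z'.1 - z.1)
  injective : ∀ t ∈ Icc 0 T, ∀ x p p' : E d,
    (hamField H t (x, p)).1 = (hamField H t (x, p')).1 → p = p'
  bound : ∀ t ∈ Icc 0 T, ∀ z : E d × E d, |H t z.1 z.2 - ‖z.2‖ ^ 2| ≤ B
  bound_fst : ∀ t ∈ Icc 0 T, ∀ z : E d × E d, ‖(hamField H t z).1 - (2 : ℝ) • z.2‖ ≤ B
  bound_snd : ∀ t ∈ Icc 0 T, ∀ z : E d × E d, ‖(hamField H t z).2‖ ≤ B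

namespace IsAdmissibleHamiltonian

variable {T : ℝ} {H : ℝ → E d → E d → ℝ}

lemma phaseNorm_hamField_sub_le (hH : IsAdmissibleHamiltonian T H) {t : ℝ} (ht : t ∈ Icc 0 T)
    (z z' : E d × E d) :
    phaseNorm (hamField H t z' - hamField H t z) ≤ cH H T * phaseNorm (z' - z) := by
  have h := norm_fderiv_sub_le_of_bound (hH.contDiff_phaseFun ht) (hH.norm_fderiv_fderiv_le ht)
    (WithLp.toLp 2 z) (WithLp.toLp 2 z')
  set Δ := hamField H t z' - hamField H t z with hΔ
  -- The test vector is Δ rotated by the symplectic structure, so that the difference of the two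
  -- differentials evaluates to |Δ|².
  have hv := ContinuousLinearMap.le_of_opNorm_le _ h (WithLp.toLp 2 (-Δ.2, Δ.1))
  rw [sub_apply, hH.fderiv_phaseFun_apply ht, hH.fderiv_phaseFun_apply ht,
    Real.norm_eq_abs] at hv
  have e1 : ‖(WithLp.toLp 2 (-Δ.2, Δ.1) : Phase d)‖ = phaseNorm Δ := by
    refine (sq_eq_sq₀ (norm_nonneg _) (phaseNorm_nonneg _)).1 ?_
    rw [phaseNorm_sq, WithLp.prod_norm_sq_eq_of_L2]
    simp [add_comm]
  have e2 : inner ℝ (hamField H t z').1 Δ.1 - inner ℝ (hamField H t z').2 (-Δ.2) -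
      (inner ℝ (hamField H t z).1 Δ.1 - inner ℝ (hamField H t z).2 (-Δ.2)) = phaseNorm Δ ^ 2 := by
    rw [phaseNorm_sq, ← real_inner_self_eq_norm_sq, ← real_inner_self_eq_norm_sq]
    simp only [hΔ, Prod.fst_sub, Prod.snd_sub, inner_sub_left, inner_neg_right, inner_sub_right]
    ring
  have e3 := le_abs_self (inner ℝ (hamField H t z').1 Δ.1 - inner ℝ (hamField H t z').2 (-Δ.2) -
      (inner ℝ (hamField H t z).1 Δ.1 - inner ℝ (hamField H t z).2 (-Δ.2)))
  have e4 := e3.trans hv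
  rw [e2, e1] at e4
  have e5 : ‖(WithLp.toLp 2 z' : Phase d) - WithLp.toLp 2 z‖ = phaseNorm (z' - z) := rfl
  rw [e5] at e4
  by_contra! hlt
  have h0 : 0 < phaseNorm Δ := lt_of_le_of_lt (mul_nonneg hH.cH_nonneg (phaseNorm_nonneg _)) hlt
  nlinarith

lemma taylor (hH : IsAdmissibleHamiltonian T H) {t : ℝ} (ht : t ∈ Icc 0 T) (z z' : E d × E d) :
    |H t z'.1 z'.2 - H t z.1 z.2 -
      (inner ℝ (hamField H t z).1 (z'.2 - z.2) - inner ℝ (hamField H t z).2 (z'.1 - z.1))| ≤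
      cH H T * phaseNorm (z' - z) ^ 2 := by
  have h := taylor_le_of_bound (hH.contDiff_phaseFun ht) (hH.norm_fderiv_fderiv_le ht)
    (WithLp.toLp 2 z) (WithLp.toLp 2 z')
  rw [hH.fderiv_phaseFun_apply ht] at h
  exact h

/-- Apply `neg_le_fderiv_sub_of_bound` with ξ the position difference, η the momentum difference and
ζ the position difference placed in the momentum slot. Then η + kζ is vertical, and convexity in p
applies to it. -/
lemma twist (hH : IsAdmissibleHamiltonian T H) {t : ℝ} (ht : t ∈ Icc 0 T) (z z' : E d × E d)
    {k : ℝ} (hk : 0 ≤ k) :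
    -(cH H T * (1 + k) ^ 2 * ‖z'.1 - z.1‖ ^ 2) ≤
      inner ℝ ((hamField H t z').1 - (hamField H t z).1) (z'.2 - z.2 + (2 * k) • (z'.1 - z.1)) +
        inner ℝ ((hamField H t z').2 - (hamField H t z).2) (z'.1 - z.1) := by
  set x := z'.1 - z.1 with hx
  set p := z'.2 - z.2 with hp
  have hconv : ∀ w : Phase d, 0 ≤ fderiv ℝ (fderiv ℝ (phaseFun H t)) w
      (WithLp.toLp 2 (0, p) + k • WithLp.toLp 2 (0, x))
      (WithLp.toLp 2 (0, p) + k • WithLp.toLp 2 (0, x)) := by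
    intro w
    refine fderiv_fderiv_nonneg_of_convexOn (hH.contDiff_phaseFun ht) ?_
    have h1 := (hH.strictConvexOn t ht w.fst).convexOn.comp_affineMap
      (AffineMap.lineMap w.snd (w.snd + (p + k • x)))
    rw [preimage_univ] at h1
    have e : (fun r : ℝ => phaseFun H t
        (w + r • (WithLp.toLp 2 (0, p) + k • WithLp.toLp 2 (0, x)))) =
        H t w.fst ∘ AffineMap.lineMap w.snd (w.snd + (p + k • x)) := by
      ext r
      simp [phaseFun, AffineMap.lineMap_apply, add_comm]
    rw [e]
    exact h1
  have h := neg_le_fderiv_sub_of_bound (hH.contDiff_phaseFun ht) (hH.norm_fderiv_fderiv_le ht)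
    (ξ := WithLp.toLp 2 (x, 0)) (η := WithLp.toLp 2 (0, p)) (ζ := WithLp.toLp 2 (0, x)) hk hconv
    (by rw [WithLp.norm_toLp_fst, WithLp.norm_toLp_snd]) (WithLp.toLp 2 z)
  have e : (WithLp.toLp 2 z + (WithLp.toLp 2 (x, 0) + WithLp.toLp 2 (0, p)) : Phase d) =
      WithLp.toLp 2 z' := by
    rw [← WithLp.toLp_add, ← WithLp.toLp_add]
    congr 1
    ext1 <;> simp [hx, hp]
  rw [WithLp.norm_toLp_fst, e, sub_apply, hH.fderiv_phaseFun_apply ht,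
    hH.fderiv_phaseFun_apply ht] at h
  refine h.trans (le_of_eq ?_)
  simp [inner_sub_left]
  ring

/-- Strict convexity makes the derivative of H strictly increasing along the segment from p to p',
so equal velocities force p = p'. -/
lemma hamField_injective (hH : IsAdmissibleHamiltonian T H) {t : ℝ} (ht : t ∈ Icc 0 T)
    (x p p' : E d) (h : (hamField H t (x, p)).1 = (hamField H t (x, p')).1) : p = p' := by
  by_contra hne
  have hd : ∀ q, HasFDerivAt (H t x) (fderiv ℝ (H t x) q) q := by
    intro q
    have h1 : Differentiable ℝ (H t x) := by
      have h2 : Differentiable ℝ fun q : E d => (WithLp.toLp 2 (x, q) : Phase d) :=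
        ((WithLp.prodContinuousLinearEquiv 2 ℝ (E d) (E d)).symm.differentiable).comp
          ((differentiable_const x).prodMk differentiable_id)
      exact (hH.differentiable_phaseFun ht).comp h2
    exact (h1 q).hasFDerivAt
  have hline : ∀ r : ℝ, HasDerivAt (fun r : ℝ => H t x (p + r • (p' - p)))
      (inner ℝ (hamField H t (x, p + r • (p' - p))).1 (p' - p)) r := by
    intro r
    have h1 : HasDerivAt (fun r : ℝ => p + r • (p' - p)) (p' - p) r := by
      simpa using ((hasDerivAt_id r).smul_const (p' - p)).const_add p
    have h2 := (hd (p + r • (p' - p))).comp_hasDerivAt r h1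
    rwa [← inner_gradient_left] at h2
  have hsc : StrictConvexOn ℝ univ fun r : ℝ => H t x (p + r • (p' - p)) := by
    refine ⟨convex_univ, fun a _ b _ hab α β hα hβ hαβ => ?_⟩
    have hne' : p + a • (p' - p) ≠ p + b • (p' - p) := by
      intro he
      have := smul_left_injective ℝ (sub_ne_zero.2 (Ne.symm hne)) (add_left_cancel he)
      exact hab this
    have := (hH.strictConvexOn t ht x).2 (mem_univ _) (mem_univ _) hne' hα hβ hαβ
    have e : α • (p + a • (p' - p)) + β • (p + b • (p' - p)) =
        p + (α • a + β • b) • (p' - p) := by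
      have e1 : α • (p + a • (p' - p)) + β • (p + b • (p' - p)) =
          (α + β) • p + (α • a + β • b) • (p' - p) := by
        simp only [smul_eq_mul]
        module
      rw [e1, hαβ, one_smul]
    rwa [e] at this
  have h1 := hsc.strictMonoOn_deriv (fun r _ => (hline r).differentiableAt)
  have h2 := h1 (mem_univ (0 : ℝ)) (mem_univ (1 : ℝ)) one_pos
  rw [(hline 0).deriv, (hline 1).deriv] at h2
  simp only [zero_smul, add_zero, one_smul, add_sub_cancel, h] at h2
  exact h2.false

lemma continuousOn_hamField (hH : IsAdmissibleHamiltonian T H) :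
    ContinuousOn (fun q : ℝ × E d × E d => hamField H q.1 q.2) (Icc 0 T ×ˢ univ) := by
  have hD : ContinuousOn (fun q : ℝ × E d × E d =>
      fderiv ℝ (phaseFun H q.1) (WithLp.toLp 2 q.2)) (Icc 0 T ×ˢ univ) := by
    have h1 : ContDiffOn ℝ 1 (fun q : ℝ × Phase d => fderiv ℝ (phaseFun H q.1) q.2)
      (Icc 0 T ×ˢ univ) := contDiffOn_fderiv_slice hH.pos (by norm_num) hH.contDiffOn_phase
    have hcont : Continuous fun q : ℝ × E d × E d => (q.1, (WithLp.toLp 2 q.2 : Phase d)) :=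
      continuous_fst.prodMk ((WithLp.prod_continuous_toLp 2 (E d) (E d)).comp continuous_snd)
    exact h1.continuousOn.comp hcont.continuousOn fun q hq => ⟨hq.1, mem_univ _⟩
  let e : E d × E d →L[ℝ] Phase d := (WithLp.prodContinuousLinearEquiv 2 ℝ (E d) (E d)).symm
  have e1 : ∀ q ∈ Icc 0 T ×ˢ (univ : Set (E d × E d)), (hamField H q.1 q.2).1 =
      (InnerProductSpace.toDual ℝ (E d)).symm ((fderiv ℝ (phaseFun H q.1) (WithLp.toLp 2 q.2)).comp
        (e.comp (ContinuousLinearMap.inr ℝ (E d) (E d)))) := by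
    intro q hq
    refine ext_inner_right ℝ fun v => ?_
    rw [InnerProductSpace.toDual_symm_apply]
    change _ = fderiv ℝ (phaseFun H q.1) (WithLp.toLp 2 q.2) (WithLp.toLp 2 (0, v))
    rw [hH.fderiv_phaseFun_apply hq.1]
    simp
  have e2 : ∀ q ∈ Icc 0 T ×ˢ (univ : Set (E d × E d)), (hamField H q.1 q.2).2 =
      -(InnerProductSpace.toDual ℝ (E d)).symm ((fderiv ℝ (phaseFun H q.1) (WithLp.toLp 2 q.2)).comp
        (e.comp (ContinuousLinearMap.inl ℝ (E d) (E d)))) := by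
    intro q hq
    refine ext_inner_right ℝ fun v => ?_
    rw [inner_neg_left, InnerProductSpace.toDual_symm_apply]
    change _ = -(fderiv ℝ (phaseFun H q.1) (WithLp.toLp 2 q.2) (WithLp.toLp 2 (v, 0)))
    rw [hH.fderiv_phaseFun_apply hq.1]
    simp
  have c1 := ((InnerProductSpace.toDual ℝ (E d)).symm.continuous.comp_continuousOn
    (hD.clm_comp (continuousOn_const (c := e.comp (ContinuousLinearMap.inr ℝ (E d) (E d))))))
  have c2 := ((InnerProductSpace.toDual ℝ (E d)).symm.continuous.comp_continuousOn
    (hD.clm_comp (continuousOn_const (c := e.comp (ContinuousLinearMap.inl ℝ (E d) (E d)))))).neg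
  exact (c1.congr e1).prodMk (c2.congr e2)

/-- A Hamiltonian satisfies the estimates with the constant `c_H`. -/
theorem exists_estimates (hH : IsAdmissibleHamiltonian T H) :
    ∃ B, HamiltonianEstimates T (cH H T) B H := by
  obtain ⟨K, hK, hKH⟩ := hH.exists_compact_eventuallyEq
  obtain ⟨L, hLa, hL⟩ := exists_hasFDerivAt_norm_sq (WithLp.sndL 2 ℝ (E d) (E d))
  obtain ⟨C, hC0, hC⟩ :=
    exists_bound_fderiv_sub_of_eventuallyEq hH.pos hH.contDiffOn_phase hL hK hKH
  have key : ∀ u v : E d, inner ℝ u u ≤ C * ‖u‖ → ‖u‖ ≤ C := by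
    intro u _ h
    rw [real_inner_self_eq_norm_sq] at h
    by_contra! hlt
    nlinarith [lt_of_le_of_lt hC0 hlt]
  refine ⟨C, hH.pos, hH.cH_nonneg, hC0, hH.contDiffOn.continuousOn, hH.continuousOn_hamField,
    fun t ht => hH.phaseNorm_hamField_sub_le ht, fun t ht => hH.taylor ht,
    fun t ht z z' k hk => hH.twist ht z z' hk, fun t ht => hH.hamField_injective ht,
    fun t ht z => (hC t ht (WithLp.toLp 2 z)).1, fun t ht z => ?_, fun t ht z => ?_⟩
  · refine key _ 0 ?_
    have h := ContinuousLinearMap.le_of_opNorm_le _ (hC t ht (WithLp.toLp 2 z)).2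
      (WithLp.toLp 2 (0, (hamField H t z).1 - (2 : ℝ) • z.2))
    rw [sub_apply, hH.fderiv_phaseFun_apply ht, hLa, WithLp.norm_toLp_snd] at h
    refine (le_of_eq ?_).trans ((le_abs_self _).trans h)
    rw [inner_sub_left, inner_smul_left]
    simp
  · refine key _ 0 ?_
    have h := ContinuousLinearMap.le_of_opNorm_le _ (hC t ht (WithLp.toLp 2 z)).2
      (WithLp.toLp 2 (-(hamField H t z).2, 0))
    rw [sub_apply, hH.fderiv_phaseFun_apply ht, hLa, WithLp.norm_toLp_fst, norm_neg] at h
    refine (le_of_eq ?_).trans ((le_abs_self _).trans h)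
    simp

end IsAdmissibleHamiltonian

end Estimates

end HJ
end

noncomputable section

namespace HJ

section Flow

/-! ### The Hamiltonian flow -/

variable {d : ℕ} {T c B : ℝ} {H : ℝ → E d → E d → ℝ}

namespace HamiltonianEstimates

lemma norm_hamField_sub_le (hE : HamiltonianEstimates T c B H) {t : ℝ} (ht : t ∈ Icc 0 T)
    (z z' : E d × E d) : ‖hamField H t z' - hamField H t z‖ ≤ 2 * c * ‖z' - z‖ := by
  have h1 := (norm_le_phaseNorm _).trans (hE.lipschitz t ht z z')
  have h2 : phaseNorm (z' - z) ≤ 2 * ‖z' - z‖ := by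
    have := phaseNorm_le_add (z' - z)
    linarith [norm_fst_le (z' - z), norm_snd_le (z' - z)]
  have := mul_le_mul_of_nonneg_left h2 hE.c_nonneg
  linarith

/-- Hamilton's equations have global solutions. -/
theorem exists_isCharacteristic (hE : HamiltonianEstimates T c B H) {s : ℝ} (hs : s ∈ Icc 0 T)
    (z : E d × E d) : ∃ γ, IsCharacteristic H T γ ∧ γ s = z := by
  have hT := hE.pos
  have hc := hE.c_nonneg
  have hB := hE.B_nonneg
  -- The substitution by the flow of |p|² removes the linear growth of the field. The transformed
  -- field is bounded and Lipschitz, so a single application of Picard–Lindelöf covers [0,T].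
  let A : ℝ → E d × E d → E d × E d := fun τ w => (w.1 + (2 * τ) • w.2, w.2)
  have hA : ∀ τ ∈ Icc 0 T, ∀ w w', ‖A τ w' - A τ w‖ ≤ (1 + 2 * T) * ‖w' - w‖ := by
    intro τ hτ w w'
    have e : A τ w' - A τ w = ((w' - w).1 + (2 * τ) • (w' - w).2, (w' - w).2) := by
      ext1
      · simp only [A, Prod.fst_sub, Prod.snd_sub]; module
      · simp [A]
    have h1 := norm_fst_le (w' - w)
    have h2 := norm_snd_le (w' - w)
    have h3 : (2 * τ) * ‖(w' - w).2‖ ≤ 2 * T * ‖w' - w‖ := by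
      have := hτ.2
      have := hτ.1
      gcongr
    have h4 := norm_nonneg (w' - w)
    rw [e]
    refine max_le ?_ ?_
    · refine (norm_add_le _ _).trans ?_
      rw [norm_smul, Real.norm_of_nonneg (by have := hτ.1; positivity)]
      linarith
    · change ‖(w' - w).2‖ ≤ _
      nlinarith
  let f : ℝ → E d × E d → E d × E d := fun τ w =>
    ((hamField H τ (A τ w)).1 - (2 : ℝ) • w.2 - (2 * τ) • (hamField H τ (A τ w)).2,
      (hamField H τ (A τ w)).2)
  have hf1 : ∀ τ w, (f τ w).1 =
    (hamField H τ (A τ w)).1 - (2 : ℝ) • w.2 - (2 * τ) • (hamField H τ (A τ w)).2 := fun _ _ => rfl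
  have hf2 : ∀ τ w, (f τ w).2 = (hamField H τ (A τ w)).2 := fun _ _ => rfl
  have hfB : ∀ τ ∈ Icc 0 T, ∀ w, ‖f τ w‖ ≤ (1 + 2 * T) * B := by
    intro τ hτ w
    have h1 := hE.bound_fst τ hτ (A τ w)
    have h2 := hE.bound_snd τ hτ (A τ w)
    have h0 := hτ.1
    refine max_le ?_ ?_
    · rw [hf1]
      refine (norm_sub_le _ _).trans ?_
      rw [norm_smul, Real.norm_of_nonneg (by positivity)]
      have h3 : (2 * τ) * ‖(hamField H τ (A τ w)).2‖ ≤ 2 * T * B := by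
        have := hτ.2
        gcongr
      have h4 : ‖(hamField H τ (A τ w)).1 - (2 : ℝ) • w.2‖ ≤ B := h1
      linarith
    · rw [hf2]
      nlinarith
  set K₀ : ℝ := (1 + 2 * T) * (2 * c * (1 + 2 * T)) + 2
  have hfL : ∀ τ ∈ Icc 0 T, ∀ w w', ‖f τ w' - f τ w‖ ≤ K₀ * ‖w' - w‖ := by
    intro τ hτ w w'
    have h0 := hτ.1
    have h1 : ‖hamField H τ (A τ w') - hamField H τ (A τ w)‖ ≤ 2 * c * (1 + 2 * T) * ‖w' - w‖ := by
      refine (hE.norm_hamField_sub_le hτ _ _).trans ?_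
      rw [mul_assoc (2 * c)]
      have := hA τ hτ w w'
      gcongr
    set D := hamField H τ (A τ w') - hamField H τ (A τ w) with hD
    have e : f τ w' - f τ w = (D.1 - (2 : ℝ) • (w' - w).2 - (2 * τ) • D.2, D.2) := by
      ext1
      · simp only [f, hD, Prod.fst_sub, Prod.snd_sub]; module
      · simp [f, hD]
    have h2 := norm_fst_le D
    have h3 := norm_snd_le D
    have h4 := norm_snd_le (w' - w)
    have h5 := norm_nonneg (w' - w)
    have h6 := norm_nonneg D
    rw [e]
    refine max_le ?_ ?_
    · refine (norm_sub_le _ _).trans ((add_le_add_left (norm_sub_le _ _) _).trans ?_)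
      rw [norm_smul, norm_smul, Real.norm_of_nonneg zero_le_two,
        Real.norm_of_nonneg (show 0 ≤ 2 * τ by positivity)]
      have h7 : 2 * τ * ‖D.2‖ ≤ 2 * T * ‖D‖ := by
        have := hτ.2
        gcongr
      have h8 : (1 + 2 * T) * ‖D‖ ≤ (1 + 2 * T) * (2 * c * (1 + 2 * T) * ‖w' - w‖) := by gcongr
      simp only [K₀]
      nlinarith
    · change ‖D.2‖ ≤ _
      have h8 : 2 * c * (1 + 2 * T) * ‖w' - w‖ ≤
          (1 + 2 * T) * (2 * c * (1 + 2 * T) * ‖w' - w‖) := by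
        have : 0 ≤ 2 * c * (1 + 2 * T) * ‖w' - w‖ := by positivity
        nlinarith
      simp only [K₀]
      nlinarith
  have hfc : ∀ w, ContinuousOn (f · w) (Icc 0 T) := by
    intro w
    have hAc : Continuous fun τ : ℝ => ((τ, A τ w) : ℝ × E d × E d) := by
      refine continuous_id.prodMk ((Continuous.add continuous_const ?_).prodMk continuous_const)
      exact (continuous_const.mul continuous_id).smul continuous_const
    have h1 : ContinuousOn (fun τ => hamField H τ (A τ w)) (Icc 0 T) :=
      hE.continuousOn_hamField.comp hAc.continuousOn fun τ hτ => ⟨hτ, mem_univ _⟩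
    have c1 : ContinuousOn (fun τ => (hamField H τ (A τ w)).1) (Icc 0 T) :=
      continuous_fst.comp_continuousOn h1
    have c2 : ContinuousOn (fun τ => (hamField H τ (A τ w)).2) (Icc 0 T) :=
      continuous_snd.comp_continuousOn h1
    have c3 : ContinuousOn (fun τ : ℝ => 2 * τ) (Icc 0 T) :=
      (continuous_const.mul continuous_id).continuousOn
    exact ((c1.sub continuousOn_const).sub (c3.smul c2)).prodMk c2
  have hL0 : 0 ≤ (1 + 2 * T) * B := by positivity
  have hK0 : 0 ≤ K₀ := by positivity
  set w₀ : E d × E d := (z.1 - (2 * s) • z.2, z.2)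
  -- The ball has radius (bound of the field)·T, which a solution cannot leave during [0,T].
  have hPL : IsPicardLindelof f (tmin := 0) (tmax := T) ⟨s, hs⟩ w₀
      (⟨(1 + 2 * T) * B, hL0⟩ * ⟨T, hT.le⟩) 0 ⟨(1 + 2 * T) * B, hL0⟩ ⟨K₀, hK0⟩ := by
    refine ⟨fun t ht => ?_, fun w _ => hfc w, fun t ht w _ => hfB t ht w, ?_⟩
    · refine LipschitzOnWith.of_dist_le_mul fun w _ w' _ => ?_
      rw [dist_eq_norm, dist_eq_norm]
      exact hfL t ht w' w
    · simp only [NNReal.coe_zero, sub_zero]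
      refine mul_le_mul_of_nonneg_left ?_ hL0
      exact max_le (by linarith [hs.1]) hs.2
  obtain ⟨α, hα0, hα⟩ := hPL.exists_eq_forall_mem_Icc_hasDerivWithinAt₀
  refine ⟨fun τ => A τ (α τ), fun τ hτ => ?_, ?_⟩
  · have h1 := hα τ hτ
    have hfst : HasDerivWithinAt (fun τ => (α τ).1) (f τ (α τ)).1 (Icc 0 T) τ :=
      (ContinuousLinearMap.fst ℝ (E d) (E d)).hasFDerivAt.comp_hasDerivWithinAt τ h1
    have hsnd : HasDerivWithinAt (fun τ => (α τ).2) (f τ (α τ)).2 (Icc 0 T) τ :=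
      (ContinuousLinearMap.snd ℝ (E d) (E d)).hasFDerivAt.comp_hasDerivWithinAt τ h1
    have hlin : HasDerivWithinAt (fun τ : ℝ => 2 * τ) 2 (Icc 0 T) τ := by
      simpa using (hasDerivWithinAt_id τ (Icc 0 T)).const_mul (2 : ℝ)
    have h2 := (hfst.add (hlin.smul hsnd)).prodMk hsnd
    have e : hamField H τ (A τ (α τ)) =
        ((f τ (α τ)).1 + ((2 * τ) • (f τ (α τ)).2 + (2 : ℝ) • (α τ).2), (f τ (α τ)).2) :=
      Prod.ext (by rw [hf1, hf2]; module) (hf2 _ _).symm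
    change HasDerivWithinAt (fun τ => A τ (α τ)) (hamField H τ (A τ (α τ))) (Icc 0 T) τ
    rw [e]
    exact h2
  · change A s (α s) = z
    rw [hα0]
    ext1
    · simp [A, w₀]
    · rfl

lemma _root_.HJ.IsCharacteristic.continuousOn {γ : ℝ → E d × E d} (h : IsCharacteristic H T γ) :
    ContinuousOn γ (Icc 0 T) := fun τ hτ => (h τ hτ).continuousWithinAt

lemma _root_.HJ.IsCharacteristic.hasDerivWithinAt_Ici {γ : ℝ → E d × E d}
    (h : IsCharacteristic H T γ) {τ : ℝ} (h0 : 0 ≤ τ) (hT : τ < T) :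
    HasDerivWithinAt γ (hamField H τ (γ τ)) (Ici τ) τ :=
  (h τ ⟨h0, hT.le⟩).mono_of_mem_nhdsWithin (Icc_mem_nhdsGE_of_mem ⟨h0, hT⟩)

lemma _root_.HJ.gronwallBound_zero_mul (c D x : ℝ) :
    gronwallBound 0 c (c * D) x = D * (Real.exp (c * x) - 1) := by
  rcases eq_or_ne c 0 with rfl | hc
  · simp [gronwallBound_K0]
  · rw [gronwallBound_of_K_ne_0 hc]
    field_simp
    ring

/-- The divergence of two solutions. -/
theorem phaseNorm_sub_sub_le (hE : HamiltonianEstimates T c B H) {γ γ' : ℝ → E d × E d}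
    (h : IsCharacteristic H T γ) (h' : IsCharacteristic H T γ') {s t : ℝ} (hs : 0 ≤ s)
    (hst : s ≤ t) (ht : t ≤ T) :
    phaseNorm (γ' t - γ t - (γ' s - γ s)) ≤
      phaseNorm (γ' s - γ s) * (Real.exp (c * (t - s)) - 1) := by
  have hc := hE.c_nonneg
  let e : E d × E d →L[ℝ] Phase d := (WithLp.prodContinuousLinearEquiv 2 ℝ (E d) (E d)).symm
  have he : ∀ z, e z = WithLp.toLp 2 z := fun _ => rfl
  have hsub : Icc s t ⊆ Icc 0 T := Icc_subset_Icc hs ht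
  -- Gronwall is applied to the difference of the orbits minus its initial value. The factor
  -- e^{c(t-s)} - 1 so obtained is less than 1 when c(t-s) < ln 2.
  have h1 := norm_le_gronwallBound_of_norm_deriv_right_le (a := s) (b := t)
    (f := fun τ => e (γ' τ - γ τ - (γ' s - γ s)))
    (f' := fun τ => e (hamField H τ (γ' τ) - hamField H τ (γ τ))) (δ := 0) (K := c)
    (ε := c * phaseNorm (γ' s - γ s))
    (e.continuous.comp_continuousOn (((h'.continuousOn.mono hsub).sub
      (h.continuousOn.mono hsub)).sub continuousOn_const))
    (fun τ hτ => by
      have h0 : 0 ≤ τ := hs.trans hτ.1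
      have hT : τ < T := hτ.2.trans_le ht
      exact e.hasFDerivAt.comp_hasDerivWithinAt τ (((h'.hasDerivWithinAt_Ici h0 hT).sub
        (h.hasDerivWithinAt_Ici h0 hT)).sub_const _))
    (by simp)
    (fun τ hτ => by
      have hτ' : τ ∈ Icc 0 T := hsub ⟨hτ.1, hτ.2.le⟩
      have h2 : ‖e (γ' τ - γ τ)‖ ≤ ‖e (γ' τ - γ τ - (γ' s - γ s))‖ + ‖e (γ' s - γ s)‖ := by
        refine le_trans (le_of_eq ?_) (norm_add_le _ _)
        rw [← map_add, sub_add_cancel]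
      refine (hE.lipschitz τ hτ' (γ τ) (γ' τ)).trans ?_
      have h3 : phaseNorm (γ' τ - γ τ) = ‖e (γ' τ - γ τ)‖ := rfl
      have h4 : phaseNorm (γ' s - γ s) = ‖e (γ' s - γ s)‖ := rfl
      rw [h3, h4, ← mul_add]
      gcongr) t ⟨hst, le_rfl⟩
  rw [gronwallBound_zero_mul] at h1
  exact h1

lemma phaseNorm_sub_le (hE : HamiltonianEstimates T c B H) {γ γ' : ℝ → E d × E d}
    (h : IsCharacteristic H T γ) (h' : IsCharacteristic H T γ') {s t : ℝ} (hs : 0 ≤ s)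
    (hst : s ≤ t) (ht : t ≤ T) :
    phaseNorm (γ' t - γ t) ≤ phaseNorm (γ' s - γ s) * Real.exp (c * (t - s)) := by
  have h1 := hE.phaseNorm_sub_sub_le h h' hs hst ht
  have h2 : phaseNorm (γ' t - γ t) ≤
      phaseNorm (γ' t - γ t - (γ' s - γ s)) + phaseNorm (γ' s - γ s) := by
    refine le_trans (le_of_eq ?_) (norm_add_le _ _)
    rw [← WithLp.toLp_add, sub_add_cancel]
    rfl
  linarith

lemma eq_of_isCharacteristic (hE : HamiltonianEstimates T c B H) {γ γ' : ℝ → E d × E d}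
    (h : IsCharacteristic H T γ) (h' : IsCharacteristic H T γ') {s t : ℝ} (hs : 0 ≤ s)
    (hst : s ≤ t) (ht : t ≤ T) (hss : γ s = γ' s) : γ t = γ' t := by
  have h1 := hE.phaseNorm_sub_le h h' hs hst ht
  rw [hss, sub_self] at h1
  have h0 : phaseNorm (0 : E d × E d) = 0 := by simp [phaseNorm]
  rw [h0, zero_mul] at h1
  have h2 := (norm_le_phaseNorm _).trans h1
  exact (sub_eq_zero.1 (norm_le_zero_iff.1 h2)).symm

lemma flow_spec (hE : HamiltonianEstimates T c B H) {s : ℝ} (hs : s ∈ Icc 0 T) (z : E d × E d) :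
    IsCharacteristic H T (fun t => flow H T s t z) ∧ flow H T s s z = z :=
  Classical.epsilon_spec (p := fun γ : ℝ → E d × E d => IsCharacteristic H T γ ∧ γ s = z)
    (hE.exists_isCharacteristic hs z)

lemma isCharacteristic_flow (hE : HamiltonianEstimates T c B H) {s : ℝ} (hs : s ∈ Icc 0 T)
    (z : E d × E d) : IsCharacteristic H T (fun t => flow H T s t z) := (hE.flow_spec hs z).1

lemma flow_self (hE : HamiltonianEstimates T c B H) {s : ℝ} (hs : s ∈ Icc 0 T) (z : E d × E d) :
    flow H T s s z = z := (hE.flow_spec hs z).2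

lemma flow_flow (hE : HamiltonianEstimates T c B H) {s r t : ℝ} (hs : 0 ≤ s) (hsr : s ≤ r)
    (hrt : r ≤ t) (ht : t ≤ T) (z : E d × E d) :
    flow H T r t (flow H T s r z) = flow H T s t z := by
  have hr : r ∈ Icc 0 T := ⟨hs.trans hsr, hrt.trans ht⟩
  exact hE.eq_of_isCharacteristic (hE.isCharacteristic_flow hr _)
    (hE.isCharacteristic_flow ⟨hs, hsr.trans hr.2⟩ z) hr.1 hrt ht (hE.flow_self hr _)

lemma _root_.HJ.IsCharacteristic.hasDerivWithinAt_fst {γ : ℝ → E d × E d}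
    (h : IsCharacteristic H T γ) {τ : ℝ} (hτ : τ ∈ Icc 0 T) :
    HasDerivWithinAt (fun τ => (γ τ).1) (hamField H τ (γ τ)).1 (Icc 0 T) τ :=
  (ContinuousLinearMap.fst ℝ (E d) (E d)).hasFDerivAt.comp_hasDerivWithinAt τ (h τ hτ)

lemma _root_.HJ.IsCharacteristic.hasDerivWithinAt_snd {γ : ℝ → E d × E d}
    (h : IsCharacteristic H T γ) {τ : ℝ} (hτ : τ ∈ Icc 0 T) :
    HasDerivWithinAt (fun τ => (γ τ).2) (hamField H τ (γ τ)).2 (Icc 0 T) τ :=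
  (ContinuousLinearMap.snd ℝ (E d) (E d)).hasFDerivAt.comp_hasDerivWithinAt τ (h τ hτ)

lemma norm_snd_sub_le (hE : HamiltonianEstimates T c B H) {γ : ℝ → E d × E d}
    (h : IsCharacteristic H T γ) {s t : ℝ} (hs : 0 ≤ s) (hst : s ≤ t) (ht : t ≤ T) :
    ‖(γ t).2 - (γ s).2‖ ≤ B * (t - s) := by
  have hsub : Icc s t ⊆ Icc 0 T := Icc_subset_Icc hs ht
  have h1 := (convex_Icc s t).norm_image_sub_le_of_norm_hasDerivWithin_le
    (f := fun τ => (γ τ).2) (f' := fun τ => (hamField H τ (γ τ)).2) (C := B)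
    (fun τ hτ => (h.hasDerivWithinAt_snd (hsub hτ)).mono hsub)
    (fun τ hτ => hE.bound_snd τ (hsub hτ) _) ⟨le_rfl, hst⟩ ⟨hst, le_rfl⟩
  rwa [Real.norm_of_nonneg (sub_nonneg.2 hst)] at h1

lemma norm_fst_sub_le (hE : HamiltonianEstimates T c B H) {γ : ℝ → E d × E d}
    (h : IsCharacteristic H T γ) {s t : ℝ} (hs : 0 ≤ s) (hst : s ≤ t) (ht : t ≤ T) :
    ‖(γ t).1 - (γ s).1 - (2 * (t - s)) • (γ s).2‖ ≤ (1 + 2 * T) * B * (t - s) := by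
  have hsub : Icc s t ⊆ Icc 0 T := Icc_subset_Icc hs ht
  have hB := hE.B_nonneg
  have h1 := (convex_Icc s t).norm_image_sub_le_of_norm_hasDerivWithin_le
    (f := fun τ => (γ τ).1 - (2 * τ) • (γ s).2)
    (f' := fun τ => (hamField H τ (γ τ)).1 - (2 : ℝ) • (γ s).2) (C := (1 + 2 * T) * B)
    (fun τ hτ => by
      have hlin : HasDerivWithinAt (fun τ : ℝ => 2 * τ) 2 (Icc s t) τ := by
        simpa using (hasDerivWithinAt_id τ (Icc s t)).const_mul (2 : ℝ)
      exact ((h.hasDerivWithinAt_fst (hsub hτ)).mono hsub).sub (hlin.smul_const _))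
    (fun τ hτ => by
      have h2 := hE.bound_fst τ (hsub hτ) (γ τ)
      have h3 := hE.norm_snd_sub_le h hs hτ.1 (hτ.2.trans ht)
      have e : (hamField H τ (γ τ)).1 - (2 : ℝ) • (γ s).2 =
          ((hamField H τ (γ τ)).1 - (2 : ℝ) • (γ τ).2) + (2 : ℝ) • ((γ τ).2 - (γ s).2) := by
        module
      rw [e]
      refine (norm_add_le _ _).trans ?_
      rw [norm_smul, Real.norm_of_nonneg zero_le_two]
      have h4 : B * (τ - s) ≤ B * T := by
        have := hτ.2
        gcongr
        linarith
      linarith) ⟨le_rfl, hst⟩ ⟨hst, le_rfl⟩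
  rw [Real.norm_of_nonneg (sub_nonneg.2 hst)] at h1
  refine le_trans (le_of_eq ?_) h1
  congr 1
  module

/-! #### The action -/

/-- The integrand of the action. -/
def _root_.HJ.lagrangian (H : ℝ → E d → E d → ℝ) (τ : ℝ) (z : E d × E d) : ℝ :=
  inner ℝ z.2 (hamField H τ z).1 - H τ z.1 z.2

lemma continuousOn_hamField_comp (hE : HamiltonianEstimates T c B H) {γ : ℝ → E d × E d}
    (h : IsCharacteristic H T γ) : ContinuousOn (fun τ => hamField H τ (γ τ)) (Icc 0 T) :=
  hE.continuousOn_hamField.comp (continuousOn_id.prodMk h.continuousOn)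
    fun _ hτ => ⟨hτ, mem_univ _⟩

lemma continuousOn_H_comp (hE : HamiltonianEstimates T c B H) {γ : ℝ → E d × E d}
    (h : IsCharacteristic H T γ) : ContinuousOn (fun τ => H τ (γ τ).1 (γ τ).2) (Icc 0 T) :=
  hE.continuousOn.comp (continuousOn_id.prodMk h.continuousOn) fun _ hτ => ⟨hτ, mem_univ _⟩

lemma continuousOn_lagrangian_comp (hE : HamiltonianEstimates T c B H) {γ : ℝ → E d × E d}
    (h : IsCharacteristic H T γ) : ContinuousOn (fun τ => lagrangian H τ (γ τ)) (Icc 0 T) :=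
  ((continuous_snd.comp_continuousOn h.continuousOn).inner
    (continuous_fst.comp_continuousOn (hE.continuousOn_hamField_comp h))).sub
    (hE.continuousOn_H_comp h)

lemma _root_.HJ.hasDerivAt_of_Icc {F : Type*} [NormedAddCommGroup F] [NormedSpace ℝ F] {f : ℝ → F}
    {f' : F} {s t τ : ℝ} (hs : 0 ≤ s) (ht : t ≤ T) (hτ : τ ∈ Ioo s t)
    (h : HasDerivWithinAt f f' (Icc 0 T) τ) : HasDerivAt f f' τ :=
  h.hasDerivAt (Icc_mem_nhds (hs.trans_lt hτ.1) (hτ.2.trans_le ht))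

/-- The first variation of the action, with a quadratic remainder. -/
theorem abs_action_sub_le (hE : HamiltonianEstimates T c B H) {γ γ' : ℝ → E d × E d}
    (h : IsCharacteristic H T γ) (h' : IsCharacteristic H T γ') {s t : ℝ} (hs : 0 ≤ s)
    (hst : s ≤ t) (ht : t ≤ T) :
    |(∫ τ in s..t, lagrangian H τ (γ' τ)) - (∫ τ in s..t, lagrangian H τ (γ τ)) -
      (inner ℝ (γ t).2 ((γ' t).1 - (γ t).1) - inner ℝ (γ s).2 ((γ' s).1 - (γ s).1))| ≤
      2 * c * (phaseNorm (γ' s - γ s) * Real.exp (c * (t - s))) ^ 2 * (t - s) := by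
  have hc := hE.c_nonneg
  have hsub : Icc s t ⊆ Icc 0 T := Icc_subset_Icc hs ht
  have hu : uIcc s t ⊆ Icc 0 T := by rwa [uIcc_of_le hst]
  have hl := (hE.continuousOn_lagrangian_comp h).mono hu
  have hl' := (hE.continuousOn_lagrangian_comp h').mono hu
  -- The boundary terms of the first variation are the integral of this derivative, so they can be
  -- subtracted under the integral sign.
  have hder : ∀ τ ∈ Icc 0 T, HasDerivWithinAt (fun τ => inner ℝ (γ τ).2 ((γ' τ).1 - (γ τ).1))
      (inner ℝ (γ τ).2 ((hamField H τ (γ' τ)).1 - (hamField H τ (γ τ)).1) +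
        inner ℝ (hamField H τ (γ τ)).2 ((γ' τ).1 - (γ τ).1)) (Icc 0 T) τ := fun τ hτ =>
    (h.hasDerivWithinAt_snd hτ).inner ℝ
      ((h'.hasDerivWithinAt_fst hτ).sub (h.hasDerivWithinAt_fst hτ))
  have hdc : ContinuousOn (fun τ =>
      inner ℝ (γ τ).2 ((hamField H τ (γ' τ)).1 - (hamField H τ (γ τ)).1) +
        inner ℝ (hamField H τ (γ τ)).2 ((γ' τ).1 - (γ τ).1)) (Icc 0 T) := by
    have a1 := hE.continuousOn_hamField_comp h
    have a2 := hE.continuousOn_hamField_comp h'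
    exact ((continuous_snd.comp_continuousOn h.continuousOn).inner
      ((continuous_fst.comp_continuousOn a2).sub (continuous_fst.comp_continuousOn a1))).add
      ((continuous_snd.comp_continuousOn a1).inner
        ((continuous_fst.comp_continuousOn h'.continuousOn).sub
          (continuous_fst.comp_continuousOn h.continuousOn)))
  have hdi := (hdc.mono hu).intervalIntegrable (μ := MeasureTheory.volume)
  have hftc := intervalIntegral.integral_eq_sub_of_hasDerivAt_of_le hst
    (fun τ hτ => ((hder τ (hsub hτ)).mono hsub).continuousWithinAt)
    (fun τ hτ => hasDerivAt_of_Icc hs ht hτ (hder τ (hsub (Ioo_subset_Icc_self hτ)))) hdi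
  rw [← hftc, ← intervalIntegral.integral_sub hl'.intervalIntegrable hl.intervalIntegrable,
    ← intervalIntegral.integral_sub (hl'.intervalIntegrable.sub hl.intervalIntegrable) hdi]
  have hbd : ∀ τ ∈ uIoc s t, ‖lagrangian H τ (γ' τ) - lagrangian H τ (γ τ) -
      (inner ℝ (γ τ).2 ((hamField H τ (γ' τ)).1 - (hamField H τ (γ τ)).1) +
        inner ℝ (hamField H τ (γ τ)).2 ((γ' τ).1 - (γ τ).1))‖ ≤
      2 * c * (phaseNorm (γ' s - γ s) * Real.exp (c * (t - s))) ^ 2 := by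
    intro τ hτ
    rw [uIoc_of_le hst] at hτ
    have hτ' : τ ∈ Icc 0 T := hsub ⟨hτ.1.le, hτ.2⟩
    have h1 := hE.taylor τ hτ' (γ τ) (γ' τ)
    have h2 := hE.lipschitz τ hτ' (γ τ) (γ' τ)
    have h3 : |inner ℝ ((γ' τ).2 - (γ τ).2) ((hamField H τ (γ' τ)).1 - (hamField H τ (γ τ)).1)| ≤
        c * phaseNorm (γ' τ - γ τ) ^ 2 := by
      refine (abs_real_inner_le_norm _ _).trans ?_
      have a1 := norm_snd_le_phaseNorm (γ' τ - γ τ)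
      have a2 := (norm_fst_le_phaseNorm (hamField H τ (γ' τ) - hamField H τ (γ τ))).trans h2
      have := mul_le_mul a1 a2 (norm_nonneg _) (phaseNorm_nonneg _)
      refine this.trans (le_of_eq ?_)
      ring
    have h4 : phaseNorm (γ' τ - γ τ) ≤ phaseNorm (γ' s - γ s) * Real.exp (c * (t - s)) := by
      refine (hE.phaseNorm_sub_le h h' hs hτ.1.le (hτ.2.trans ht)).trans ?_
      have := phaseNorm_nonneg (γ' s - γ s)
      gcongr
      exact hτ.2
    have h5 : phaseNorm (γ' τ - γ τ) ^ 2 ≤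
        (phaseNorm (γ' s - γ s) * Real.exp (c * (t - s))) ^ 2 :=
      pow_le_pow_left₀ (phaseNorm_nonneg _) h4 2
    -- What is left of the integrand is ⟨ΔY, Δ∂_pH⟩ minus the Taylor remainder of H. Each is at most
    -- c times the squared distance of the orbits, whence the factor 2c.
    have e : lagrangian H τ (γ' τ) - lagrangian H τ (γ τ) -
      (inner ℝ (γ τ).2 ((hamField H τ (γ' τ)).1 - (hamField H τ (γ τ)).1) +
        inner ℝ (hamField H τ (γ τ)).2 ((γ' τ).1 - (γ τ).1)) =
      inner ℝ ((γ' τ).2 - (γ τ).2) ((hamField H τ (γ' τ)).1 - (hamField H τ (γ τ)).1) -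
      (H τ (γ' τ).1 (γ' τ).2 - H τ (γ τ).1 (γ τ).2 -
      (inner ℝ (hamField H τ (γ τ)).1 ((γ' τ).2 - (γ τ).2) -
        inner ℝ (hamField H τ (γ τ)).2 ((γ' τ).1 - (γ τ).1))) := by
      simp only [lagrangian, inner_sub_left, inner_sub_right]
      rw [real_inner_comm (γ' τ).2 (hamField H τ (γ τ)).1,
        real_inner_comm (γ τ).2 (hamField H τ (γ τ)).1]
      ring
    rw [e, Real.norm_eq_abs]
    refine (abs_sub _ _).trans ?_
    have h6 := mul_le_mul_of_nonneg_left h5 hc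
    linarith
  have := intervalIntegral.norm_integral_le_of_norm_le_const hbd
  rwa [abs_of_nonneg (sub_nonneg.2 hst), Real.norm_eq_abs] at this

end HamiltonianEstimates

end Flow

end HJ
end

noncomputable section

namespace HJ

section TwistMaps

/-! ### Twist maps -/

variable {d : ℕ} {T c B : ℝ} {H : ℝ → E d → E d → ℝ}

/-- `Φ : (x, y) ↦ (X, Y)` is an exact symplectic map with action `A`, close to
`(x, y) ↦ (x + 2 h y, y)`, such that `x ↦ X` is close to the identity and the map `X ↦ x` (at
fixed `y`) gives rise to a concave generating function. -/
structure IsTwistMap (h κ C : ℝ) (Φ : E d × E d → E d × E d) (A : E d × E d → ℝ) : Prop where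
  pos : 0 < h
  nonneg : 0 ≤ κ
  lt_one : κ < 1
  C_nonneg : 0 ≤ C
  continuous : Continuous Φ
  near_id : ∀ z z', ‖(Φ z').1 - (Φ z).1 - (z'.1 - z.1)‖ ≤ κ * (‖z'.1 - z.1‖ + ‖z'.2 - z.2‖)
  action : ∀ z z', |A z' - A z - (inner ℝ (Φ z).2 ((Φ z').1 - (Φ z).1) -
    inner ℝ z.2 (z'.1 - z.1))| ≤ C * (‖z'.1 - z.1‖ + ‖z'.2 - z.2‖) ^ 2
  bound_fst : ∀ z, ‖(Φ z).1 - z.1 - (2 * h) • z.2‖ ≤ C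
  bound_snd : ∀ z, ‖(Φ z).2 - z.2‖ ≤ C
  bound_action : ∀ z, |A z - inner ℝ z.2 ((Φ z).1 - z.1) + h * ‖z.2‖ ^ 2| ≤ C
  antitone : ∀ z z', (Φ z').1 = (Φ z).1 → inner ℝ (z'.2 - z.2) (z'.1 - z.1) ≤ 0
  injective : ∀ x y y', (Φ (x, y')).1 = (Φ (x, y)).1 → y' = y

/-- `[s,t]` is an interval in `[0,T]` of length less than `ln 2 / c`. -/
structure IsShortStep (T c s t : ℝ) : Prop where
  nonneg : 0 ≤ s
  lt : s < t
  le : t ≤ T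
  small : c * (t - s) < Real.log 2

/-- The action along the flow. -/
def action (H : ℝ → E d → E d → ℝ) (T s t : ℝ) (z : E d × E d) : ℝ :=
  ∫ τ in s..t, lagrangian H τ (flow H T s τ z)

namespace HamiltonianEstimates

/-! ### Monotonicity along a pair of orbits -/

section Lyapunov

variable {γ γ' : ℝ → E d × E d} {s t : ℝ}

/-- The auxiliary function `⟨ΔY, ΔX⟩ + k |ΔX|²` along two solutions, with `1 + k = 1/(1-K(τ-s))`. -/
def lyapunov (γ γ' : ℝ → E d × E d) (K s τ : ℝ) : ℝ :=
  inner ℝ ((γ' τ).2 - (γ τ).2) ((γ' τ).1 - (γ τ).1) +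
    ((1 - K * (τ - s))⁻¹ - 1) * ‖(γ' τ).1 - (γ τ).1‖ ^ 2

/-- The derivative of `lyapunov`. -/
def lyapunovDeriv (H : ℝ → E d → E d → ℝ) (γ γ' : ℝ → E d × E d) (K s τ : ℝ) : ℝ :=
  inner ℝ ((γ' τ).2 - (γ τ).2) ((hamField H τ (γ' τ)).1 - (hamField H τ (γ τ)).1) +
    inner ℝ ((hamField H τ (γ' τ)).2 - (hamField H τ (γ τ)).2) ((γ' τ).1 - (γ τ).1) +
  (K / (1 - K * (τ - s)) ^ 2 * ‖(γ' τ).1 - (γ τ).1‖ ^ 2 + ((1 - K * (τ - s))⁻¹ - 1) *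
    (2 * inner ℝ ((γ' τ).1 - (γ τ).1) ((hamField H τ (γ' τ)).1 - (hamField H τ (γ τ)).1)))

lemma hasDerivWithinAt_lyapunov (h : IsCharacteristic H T γ) (h' : IsCharacteristic H T γ')
    {K τ : ℝ} (hτ : τ ∈ Icc 0 T) (hK : K * (τ - s) < 1) :
    HasDerivWithinAt (lyapunov γ γ' K s) (lyapunovDeriv H γ γ' K s τ) (Icc 0 T) τ := by
  have hx := (h'.hasDerivWithinAt_fst hτ).sub (h.hasDerivWithinAt_fst hτ)
  have hy := (h'.hasDerivWithinAt_snd hτ).sub (h.hasDerivWithinAt_snd hτ)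
  have hk : HasDerivWithinAt (fun τ => (1 - K * (τ - s))⁻¹ - 1) (K / (1 - K * (τ - s)) ^ 2)
      (Icc 0 T) τ := by
    have h1 : HasDerivWithinAt (fun τ => 1 - K * (τ - s)) (-K) (Icc 0 T) τ := by
      simpa using (((hasDerivWithinAt_id τ (Icc 0 T)).sub_const s).const_mul K).const_sub 1
    simpa using (h1.inv (by linarith)).sub_const 1
  exact (hy.inner ℝ hx).add (hk.mul hx.norm_sq)

/-- The weight k solves the Riccati equation k' = K(1 + k)² with k = 0 at time s, chosen to absorb
the loss c(1 + k)²|ΔX|² in the twist inequality. -/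
lemma le_lyapunovDeriv (hE : HamiltonianEstimates T c B H) {K τ : ℝ} (hτ : τ ∈ Icc 0 T)
    (hs : s ≤ τ) (hK0 : 0 ≤ K) (hK : K * (τ - s) < 1) :
    (K - c) / (1 - K * (τ - s)) ^ 2 * ‖(γ' τ).1 - (γ τ).1‖ ^ 2 ≤ lyapunovDeriv H γ γ' K s τ := by
  have hpos : 0 < 1 - K * (τ - s) := by linarith
  have hk : 0 ≤ (1 - K * (τ - s))⁻¹ - 1 := by
    rw [sub_nonneg]
    refine (one_le_inv₀ hpos).2 ?_
    have := mul_nonneg hK0 (sub_nonneg.2 hs)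
    linarith
  have h1 := hE.twist τ hτ (γ τ) (γ' τ) _ hk
  have e1 : c * (1 + ((1 - K * (τ - s))⁻¹ - 1)) ^ 2 = c / (1 - K * (τ - s)) ^ 2 := by
    field_simp
    ring
  rw [e1, inner_add_right, inner_smul_right] at h1
  unfold lyapunovDeriv
  rw [real_inner_comm ((hamField H τ (γ' τ)).1 - (hamField H τ (γ τ)).1) ((γ' τ).2 - (γ τ).2),
    real_inner_comm ((hamField H τ (γ' τ)).1 - (hamField H τ (γ τ)).1) ((γ' τ).1 - (γ τ).1)]
  rw [sub_div, sub_mul]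
  linarith

lemma monotoneOn_lyapunov (hE : HamiltonianEstimates T c B H) (h : IsCharacteristic H T γ)
    (h' : IsCharacteristic H T γ') (hs : 0 ≤ s) (ht : t ≤ T) {K : ℝ} (hcK : c ≤ K)
    (hK : K * (t - s) < 1) : MonotoneOn (lyapunov γ γ' K s) (Icc s t) := by
  have hsub : Icc s t ⊆ Icc 0 T := Icc_subset_Icc hs ht
  have hK0 : 0 ≤ K := hE.c_nonneg.trans hcK
  have hK' : ∀ τ ∈ Icc s t, K * (τ - s) < 1 := fun τ hτ =>
    lt_of_le_of_lt (by have := hτ.2; gcongr) hK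
  refine monotoneOn_of_deriv_nonneg (convex_Icc s t) (fun τ hτ =>
    ((hasDerivWithinAt_lyapunov h h' (hsub hτ) (hK' τ hτ)).mono hsub).continuousWithinAt) ?_ ?_
  · rw [interior_Icc]
    exact fun τ hτ => (hasDerivAt_of_Icc hs ht hτ (hasDerivWithinAt_lyapunov h h'
      (hsub (Ioo_subset_Icc_self hτ)) (hK' τ (Ioo_subset_Icc_self hτ)))).differentiableAt.differentiableWithinAt
  · rw [interior_Icc]
    intro τ hτ
    have hτ' := Ioo_subset_Icc_self hτ
    rw [(hasDerivAt_of_Icc hs ht hτ (hasDerivWithinAt_lyapunov h h'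
      (hsub hτ') (hK' τ hτ'))).deriv]
    refine le_trans ?_ (hE.le_lyapunovDeriv (hsub hτ') hτ.1.le hK0 (hK' τ hτ'))
    have : 0 ≤ K - c := sub_nonneg.2 hcK
    positivity

/-- With K = c the auxiliary function increases; it is ⟨ΔY, ΔX⟩ at time s, where k = 0, and 0 at
time t, where ΔX = 0. It makes the mixed generating function concave in y. -/
lemma inner_nonpos_of_fst_eq (hE : HamiltonianEstimates T c B H) (h : IsCharacteristic H T γ)
    (h' : IsCharacteristic H T γ') (hs : 0 ≤ s) (hst : s ≤ t) (ht : t ≤ T)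
    (hK : c * (t - s) < 1) (hX : (γ' t).1 = (γ t).1) :
    inner ℝ ((γ' s).2 - (γ s).2) ((γ' s).1 - (γ s).1) ≤ 0 := by
  have := hE.monotoneOn_lyapunov h h' hs ht le_rfl hK ⟨le_rfl, hst⟩ ⟨hst, le_rfl⟩ hst
  simpa [lyapunov, hX] using this

/-- With some K > c the increasing auxiliary function vanishes at both ends, hence throughout. Its
derivative controls |ΔX|², so the positions coincide; then so do the velocities, and strict
convexity identifies the momenta. -/
lemma snd_eq_of_fst_eq (hE : HamiltonianEstimates T c B H) (h : IsCharacteristic H T γ)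
    (h' : IsCharacteristic H T γ') (hs : 0 ≤ s) (hst : s < t) (ht : t ≤ T)
    (hK : c * (t - s) < 1) (hx : (γ' s).1 = (γ s).1) (hX : (γ' t).1 = (γ t).1) :
    (γ' s).2 = (γ s).2 := by
  have hsub : Icc s t ⊆ Icc 0 T := Icc_subset_Icc hs ht
  have hpos : 0 < t - s := sub_pos.2 hst
  obtain ⟨K, hcK, hK1⟩ : ∃ K, c < K ∧ K * (t - s) < 1 := by
    obtain ⟨K, h1, h2⟩ := exists_between ((lt_div_iff₀ hpos).2 hK)
    exact ⟨K, h1, (lt_div_iff₀ hpos).1 h2⟩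
  have hK0 : 0 ≤ K := hE.c_nonneg.trans hcK.le
  have hK' : ∀ τ ∈ Icc s t, K * (τ - s) < 1 := fun τ hτ =>
    lt_of_le_of_lt (by have := hτ.2; gcongr) hK1
  have hmono := hE.monotoneOn_lyapunov h h' hs ht hcK.le hK1
  have hzs : lyapunov γ γ' K s s = 0 := by simp [lyapunov, hx]
  have hzt : lyapunov γ γ' K s t = 0 := by simp [lyapunov, hX]
  have hz : ∀ τ ∈ Icc s t, lyapunov γ γ' K s τ = 0 := fun τ hτ =>
    le_antisymm (hzt ▸ hmono hτ ⟨hst.le, le_rfl⟩ hτ.2) (hzs ▸ hmono ⟨le_rfl, hst.le⟩ hτ hτ.1)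
  have hfst : ∀ τ ∈ Ioo s t, (γ' τ).1 - (γ τ).1 = 0 := by
    intro τ hτ
    have hτ' := Ioo_subset_Icc_self hτ
    have h1 := hasDerivAt_of_Icc hs ht hτ (hasDerivWithinAt_lyapunov h h' (hsub hτ') (hK' τ hτ'))
    have h2 : lyapunov γ γ' K s =ᶠ[𝓝 τ] fun _ => 0 :=
      Filter.eventually_of_mem (Icc_mem_nhds hτ.1 hτ.2) hz
    have h3 := (h1.congr_of_eventuallyEq h2.symm).unique (hasDerivAt_const τ (0 : ℝ))
    have h4 := hE.le_lyapunovDeriv (γ := γ) (γ' := γ') (hsub hτ') hτ.1.le hK0 (hK' τ hτ')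
    rw [h3] at h4
    have h5 : 0 < (K - c) / (1 - K * (τ - s)) ^ 2 := by
      have := hK' τ hτ'
      exact div_pos (sub_pos.2 hcK) (pow_pos (by linarith) 2)
    have h6 : ‖(γ' τ).1 - (γ τ).1‖ ^ 2 ≤ 0 := by
      by_contra! hlt
      exact absurd h4 (not_le.2 (mul_pos h5 hlt))
    exact norm_eq_zero.1 (pow_eq_zero_iff two_ne_zero |>.1 (le_antisymm h6 (sq_nonneg _)))
  have hsnd : ∀ τ ∈ Ioo s t, (γ' τ).2 - (γ τ).2 = 0 := by
    intro τ hτ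
    have hτ' := hsub (Ioo_subset_Icc_self hτ)
    have h1 := hasDerivAt_of_Icc hs ht hτ
      ((h'.hasDerivWithinAt_fst hτ').sub (h.hasDerivWithinAt_fst hτ'))
    have h2 : ((fun τ => (γ' τ).1) - fun τ => (γ τ).1) =ᶠ[𝓝 τ] fun _ => 0 :=
      Filter.eventually_of_mem (isOpen_Ioo.mem_nhds hτ) hfst
    have h3 := (h1.congr_of_eventuallyEq h2.symm).unique (hasDerivAt_const τ (0 : E d))
    have h4 := sub_eq_zero.1 (hfst τ hτ)
    rw [sub_eq_zero] at h3 ⊢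
    refine hE.injective τ hτ' (γ τ).1 _ _ ?_
    have e : ((γ τ).1, (γ' τ).2) = γ' τ := by rw [← h4]
    rw [e]
    exact h3
  have hcont : ContinuousWithinAt (fun τ => (γ' τ).2 - (γ τ).2) (Ioo s t) s := by
    have hs' : s ∈ Icc 0 T := hsub ⟨le_rfl, hst.le⟩
    exact ((continuous_snd.comp_continuousOn h'.continuousOn).sub
      (continuous_snd.comp_continuousOn h.continuousOn)).continuousWithinAt hs' |>.mono
      (Ioo_subset_Icc_self.trans hsub)
  have hne : (𝓝[Ioo s t] s).NeBot := by
    rw [← mem_closure_iff_nhdsWithin_neBot, closure_Ioo hst.ne]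
    exact ⟨le_rfl, hst.le⟩
  have hlim : Tendsto (fun τ => (γ' τ).2 - (γ τ).2) (𝓝[Ioo s t] s) (𝓝 0) :=
    tendsto_const_nhds.congr' (eventually_of_mem self_mem_nhdsWithin fun τ hτ => (hsnd τ hτ).symm)
  exact sub_eq_zero.1 (tendsto_nhds_unique hcont hlim)

end Lyapunov

/-- The flow over a short step is a twist map. -/
theorem exists_isTwistMap (hE : HamiltonianEstimates T c B H) {s t : ℝ} (hst : IsShortStep T c s t) :
    ∃ κ C, IsTwistMap (t - s) κ C (flow H T s t) (action H T s t) := by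
  have hs := hst.nonneg
  have ht := hst.le
  have hlt := hst.lt
  have hc := hE.c_nonneg
  have hB := hE.B_nonneg
  have hT := hE.pos
  have hpos : 0 < t - s := sub_pos.2 hlt
  have hs' : s ∈ Icc 0 T := ⟨hs, hlt.le.trans ht⟩
  have hsub : Icc s t ⊆ Icc 0 T := Icc_subset_Icc hs ht
  have hlog : Real.log 2 < 1 := by linarith [Real.log_two_lt_d9]
  have hch : 0 ≤ c * (t - s) := by positivity
  have hfl := fun z => hE.isCharacteristic_flow hs' z
  have hf0 := fun z => hE.flow_self hs' z
  have hnear : ∀ z z', phaseNorm (flow H T s t z' - flow H T s t z - (z' - z)) ≤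
      (Real.exp (c * (t - s)) - 1) * (‖z'.1 - z.1‖ + ‖z'.2 - z.2‖) := by
    intro z z'
    have h1 := hE.phaseNorm_sub_sub_le (hfl z) (hfl z') hs hlt.le ht
    simp only [hf0] at h1
    refine h1.trans ?_
    rw [mul_comm]
    have h2 := phaseNorm_le_add (z' - z)
    have h3 : 0 ≤ Real.exp (c * (t - s)) - 1 := by linarith [Real.add_one_le_exp (c * (t - s))]
    exact mul_le_mul_of_nonneg_left h2 h3
  -- `K` is the remainder constant of the first variation of the action. `C₀` below bounds the
  -- integrand left when the action of the model |p|² is subtracted.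
  obtain ⟨K, hK⟩ : ∃ K, K = 2 * c * Real.exp (c * (t - s)) ^ 2 * (t - s) := ⟨_, rfl⟩
  obtain ⟨C₀, hC₀⟩ : ∃ C₀, C₀ = B * T * B + (B * T) ^ 2 + B := ⟨_, rfl⟩
  have hK0 : 0 ≤ K := by rw [hK]; positivity
  have hC₀0 : 0 ≤ C₀ := by rw [hC₀]; positivity
  obtain ⟨C, hC1, hC2, hC3, hC4⟩ : ∃ C, K ≤ C ∧ (1 + 2 * T) * B * (t - s) ≤ C ∧
      C₀ * (t - s) ≤ C ∧ B * (t - s) ≤ C := by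
    have h1 : 0 ≤ (1 + 2 * T) * B * (t - s) := by positivity
    have h2 : 0 ≤ C₀ * (t - s) := by positivity
    have h3 : 0 ≤ B * (t - s) := by positivity
    exact ⟨K + (1 + 2 * T) * B * (t - s) + C₀ * (t - s) + B * (t - s), by linarith, by linarith,
      by linarith, by linarith⟩
  refine ⟨Real.exp (c * (t - s)) - 1, C, hpos,
    by linarith [Real.add_one_le_exp (c * (t - s))], ?_,
    hK0.trans hC1, ?_, fun z z' => ?_, fun z z' => ?_, fun z => ?_,
    fun z => ?_, fun z => ?_, fun z z' hX => ?_, fun x y y' hX => ?_⟩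
  -- The threshold ln 2 is exactly what makes κ = e^{c(t-s)} - 1 less than 1.
  · have := Real.exp_lt_exp.2 hst.small
    rw [Real.exp_log two_pos] at this
    linarith
  · refine LipschitzWith.continuous (K := (2 * Real.exp (c * (t - s))).toNNReal)
      (LipschitzWith.of_dist_le_mul fun z' z => ?_)
    rw [dist_eq_norm, dist_eq_norm, Real.coe_toNNReal _ (by positivity)]
    have h1 := hE.phaseNorm_sub_le (hfl z) (hfl z') hs hlt.le ht
    simp only [hf0] at h1
    refine (norm_le_phaseNorm _).trans (h1.trans ?_)
    have h2 : phaseNorm (z' - z) ≤ 2 * ‖z' - z‖ := by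
      have := phaseNorm_le_add (z' - z)
      linarith [norm_fst_le (z' - z), norm_snd_le (z' - z)]
    have := Real.exp_pos (c * (t - s))
    nlinarith
  · have h1 := (norm_fst_le_phaseNorm (flow H T s t z' - flow H T s t z - (z' - z))).trans
      (hnear z z')
    simpa only [Prod.fst_sub] using h1
  · have h1 := hE.abs_action_sub_le (hfl z) (hfl z') hs hlt.le ht
    simp only [hf0] at h1
    refine h1.trans ?_
    have h2 : phaseNorm (z' - z) ^ 2 ≤ (‖z'.1 - z.1‖ + ‖z'.2 - z.2‖) ^ 2 :=
      pow_le_pow_left₀ (phaseNorm_nonneg _) (phaseNorm_le_add (z' - z)) 2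
    refine le_trans (le_of_eq ?_) (mul_le_mul hC1 h2 (sq_nonneg _) (hK0.trans hC1))
    rw [hK]
    ring
  · have h1 := hE.norm_fst_sub_le (hfl z) hs hlt.le ht
    simp only [hf0] at h1
    exact h1.trans hC2
  · have h1 := hE.norm_snd_sub_le (hfl z) hs hlt.le ht
    simp only [hf0] at h1
    exact h1.trans hC4
  · refine le_trans ?_ hC3
    set γ := fun τ => flow H T s τ z with hγ
    have hz : z = γ s := (hf0 z).symm
    have hu : uIcc s t ⊆ Icc 0 T := by rwa [uIcc_of_le hlt.le]
    have c1 := (hE.continuousOn_lagrangian_comp (hfl z)).mono hu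
    have c2 : ContinuousOn (fun τ => (hamField H τ (γ τ)).1) (uIcc s t) :=
      (continuous_fst.comp_continuousOn (hE.continuousOn_hamField_comp (hfl z))).mono hu
    have c3 : ContinuousOn (fun τ => inner ℝ z.2 (hamField H τ (γ τ)).1) (uIcc s t) :=
      continuousOn_const.inner c2
    have hftc : ∫ τ in s..t, inner ℝ z.2 (hamField H τ (γ τ)).1 =
        inner ℝ z.2 ((γ t).1 - (γ s).1) := by
      rw [intervalIntegral.integral_eq_sub_of_hasDerivAt_of_le hlt.le
        (f := fun τ => inner ℝ z.2 (γ τ).1) (f' := fun τ => inner ℝ z.2 (hamField H τ (γ τ)).1)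
        (continuousOn_const.inner ((continuous_fst.comp_continuousOn (hfl z).continuousOn).mono
          hsub)) (fun τ hτ => ?_) c3.intervalIntegrable]
      · rw [inner_sub_right]
      · have := hasDerivAt_of_Icc hs ht hτ ((hfl z).hasDerivWithinAt_fst
          (hsub (Ioo_subset_Icc_self hτ)))
        simpa using (hasDerivAt_const τ z.2).inner ℝ this
    have hcst : ∫ _τ in s..t, ‖z.2‖ ^ 2 = (t - s) * ‖z.2‖ ^ 2 := by
      rw [intervalIntegral.integral_const, smul_eq_mul]
    have key : action H T s t z - inner ℝ z.2 ((γ t).1 - (γ s).1) + (t - s) * ‖z.2‖ ^ 2 =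
        ∫ τ in s..t, (lagrangian H τ (γ τ) - inner ℝ z.2 (hamField H τ (γ τ)).1 + ‖z.2‖ ^ 2) := by
      rw [intervalIntegral.integral_add (c1.intervalIntegrable.sub c3.intervalIntegrable)
        intervalIntegrable_const, intervalIntegral.integral_sub c1.intervalIntegrable
        c3.intervalIntegrable, hftc, hcst]
      rfl
    have hgoal : action H T s t z - inner ℝ z.2 ((flow H T s t z).1 - z.1) +
        (t - s) * ‖z.2‖ ^ 2 =
        action H T s t z - inner ℝ z.2 ((γ t).1 - (γ s).1) + (t - s) * ‖z.2‖ ^ 2 := by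
      rw [show γ s = z from hf0 z]
    rw [hgoal, key]
    have hbd : ∀ τ ∈ uIoc s t, ‖lagrangian H τ (γ τ) - inner ℝ z.2 (hamField H τ (γ τ)).1 +
        ‖z.2‖ ^ 2‖ ≤ C₀ := by
      intro τ hτ
      rw [uIoc_of_le hlt.le] at hτ
      have hτ' : τ ∈ Icc 0 T := hsub ⟨hτ.1.le, hτ.2⟩
      have a1 := hE.norm_snd_sub_le (hfl z) hs hτ.1.le (hτ.2.trans ht)
      have a1' : ‖(γ τ).2 - z.2‖ ≤ B * T := by
        simp only [hf0] at a1
        have : B * (τ - s) ≤ B * T := by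
          have := hτ'.2
          gcongr
          linarith
        exact a1.trans this
      have a2 := hE.bound_fst τ hτ' (γ τ)
      have a3 := hE.bound τ hτ' (γ τ)
      have a4 : |inner ℝ ((γ τ).2 - z.2) ((hamField H τ (γ τ)).1 - (2 : ℝ) • (γ τ).2)| ≤
          B * T * B :=
        (abs_real_inner_le_norm _ _).trans (mul_le_mul a1' a2 (norm_nonneg _) (by positivity))
      have a5 := pow_le_pow_left₀ (norm_nonneg _) a1' 2
      -- Rewriting around the model field 2Y and the model Hamiltonian |Y|² leaves only quantities
      -- controlled by the drift BT of the momentum and by B.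
      have e : lagrangian H τ (γ τ) - inner ℝ z.2 (hamField H τ (γ τ)).1 + ‖z.2‖ ^ 2 =
          inner ℝ ((γ τ).2 - z.2) ((hamField H τ (γ τ)).1 - (2 : ℝ) • (γ τ).2) +
            ‖(γ τ).2 - z.2‖ ^ 2 - (H τ (γ τ).1 (γ τ).2 - ‖(γ τ).2‖ ^ 2) := by
        rw [norm_sub_sq_real, lagrangian, inner_sub_right, inner_sub_left, inner_smul_right,
          inner_sub_left, real_inner_self_eq_norm_sq, real_inner_comm (γ τ).2 z.2]
        ring
      rw [e, Real.norm_eq_abs, hC₀]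
      refine (abs_sub _ _).trans (add_le_add ((abs_add_le _ _).trans (add_le_add a4 ?_)) a3)
      rwa [abs_of_nonneg (sq_nonneg _)]
    have := intervalIntegral.norm_integral_le_of_norm_le_const hbd
    rwa [abs_of_nonneg hpos.le, Real.norm_eq_abs] at this
  · have h1 := hE.inner_nonpos_of_fst_eq (hfl z) (hfl z') hs hlt.le ht
      (hst.small.trans hlog) hX
    simpa only [hf0] using h1
  · have h1 := hE.snd_eq_of_fst_eq (hfl (x, y)) (hfl (x, y')) hs hlt ht
      (hst.small.trans hlog) (by simp only [hf0]) hX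
    simpa only [hf0] using h1

end HamiltonianEstimates

end TwistMaps

end HJ
end

/-! ### Generating functions of a twist map in the variables (X, y) and (X, x) -/

noncomputable section

namespace HJ

section TwistMaps

variable {d : ℕ}

lemma hasFDerivAt_of_abs_sub_le_sq {V : Type*} [NormedAddCommGroup V] [NormedSpace ℝ V]
    {f : V → ℝ} {D : V →L[ℝ] ℝ} {a : V} {K : ℝ}
    (h : ∀ w, |f w - f a - D (w - a)| ≤ K * ‖w - a‖ ^ 2) : HasFDerivAt f D a := by
  refine HasFDerivAt.of_isLittleO (Asymptotics.IsBigO.trans_isLittleO (g := fun w => ‖w - a‖ ^ 2)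
    (Asymptotics.IsBigO.of_bound K (Eventually.of_forall fun w => ?_)) ?_)
  · rw [Real.norm_eq_abs, Real.norm_of_nonneg (sq_nonneg _)]
    exact h w
  · exact Asymptotics.isLittleO_pow_sub_sub a one_lt_two

/-- The point `x` with `Φ (x, y) = (X, Y)`. -/
def basePoint (Φ : E d × E d → E d × E d) (X y : E d) : E d :=
  (Function.invFun (fun z => ((Φ z).1, z.2)) (X, y)).1

/-- The generating function of `Φ` in the variables `(X, y)`. -/
def mixedGenFun (Φ : E d × E d → E d × E d) (A : E d × E d → ℝ) (X y : E d) : ℝ :=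
  A (basePoint Φ X y, y) - inner ℝ y (X - basePoint Φ X y)

/-- The point `y` with `Φ (x, y) = (X, Y)`. -/
def momentum (Φ : E d × E d → E d × E d) (X x : E d) : E d :=
  Function.invFun (fun y => (Φ (x, y)).1) X

/-- The generating function of `Φ` in the variables `(X, x)`. -/
def actionGenFun (Φ : E d × E d → E d × E d) (A : E d × E d → ℝ) (X x : E d) : ℝ :=
  A (x, momentum Φ X x)

namespace IsTwistMap

variable {h κ C : ℝ} {Φ : E d × E d → E d × E d} {A : E d × E d → ℝ}

/-- At fixed y the map x ↦ X differs from the identity by a κ-contraction, so x is the fixed point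
of a contraction. -/
lemma bijective (hΦ : IsTwistMap h κ C Φ A) :
    Function.Bijective fun z : E d × E d => ((Φ z).1, z.2) := by
  constructor
  · rintro z z' hz
    obtain ⟨h1, h2⟩ := Prod.ext_iff.1 hz
    simp only at h1 h2
    have := hΦ.near_id z z'
    rw [h1, h2, sub_self, sub_self, zero_sub, norm_neg, norm_zero, add_zero] at this
    have h3 : ‖z'.1 - z.1‖ ≤ 0 := by
      have := hΦ.lt_one
      have := norm_nonneg (z'.1 - z.1)
      nlinarith
    exact Prod.ext (sub_eq_zero.1 (norm_le_zero_iff.1 h3)).symm h2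
  · rintro ⟨X, y⟩
    have hc : ContractingWith κ.toNNReal fun x => X - ((Φ (x, y)).1 - x) := by
      refine ⟨?_, LipschitzWith.of_dist_le_mul fun x' x => ?_⟩
      · rw [← Real.toNNReal_one]
        exact (Real.toNNReal_lt_toNNReal_iff one_pos).2 hΦ.lt_one
      · rw [Real.coe_toNNReal _ hΦ.nonneg, dist_eq_norm, dist_eq_norm]
        have := hΦ.near_id (x, y) (x', y)
        simp only [sub_self, norm_zero, add_zero] at this
        refine le_trans (le_of_eq ?_) this
        rw [← norm_neg]
        congr 1
        abel
    refine ⟨(hc.fixedPoint, y), ?_⟩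
    have := hc.fixedPoint_isFixedPt
    refine Prod.ext ?_ rfl
    have h1 : X - ((Φ (hc.fixedPoint, y)).1 - hc.fixedPoint) = hc.fixedPoint := this
    rw [sub_eq_iff_eq_add, add_sub_cancel] at h1
    exact h1.symm

lemma fst_basePoint (hΦ : IsTwistMap h κ C Φ A) (X y : E d) :
    (Φ (basePoint Φ X y, y)).1 = X := by
  have h1 := Function.invFun_eq (hΦ.bijective.2 (X, y))
  obtain ⟨h2, h3⟩ := Prod.ext_iff.1 h1
  simp only at h2 h3
  have e : (basePoint Φ X y, y) = Function.invFun (fun z => ((Φ z).1, z.2)) (X, y) :=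
    Prod.ext rfl h3.symm
  rw [e, h2]

lemma basePoint_fst (hΦ : IsTwistMap h κ C Φ A) (z : E d × E d) :
    basePoint Φ (Φ z).1 z.2 = z.1 :=
  congrArg Prod.fst (Function.leftInverse_invFun hΦ.bijective.1 z)

lemma norm_basePoint_sub_le (hΦ : IsTwistMap h κ C Φ A) (X y X' y' : E d) :
    ‖basePoint Φ X' y' - basePoint Φ X y‖ ≤ (1 - κ)⁻¹ * (‖X' - X‖ + ‖y' - y‖) := by
  have h1 := hΦ.near_id (basePoint Φ X y, y) (basePoint Φ X' y', y')
  rw [hΦ.fst_basePoint, hΦ.fst_basePoint] at h1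
  simp only at h1
  have hκ : 0 < 1 - κ := sub_pos.2 hΦ.lt_one
  have h2 := norm_sub_norm_le (basePoint Φ X' y' - basePoint Φ X y) (X' - X)
  rw [norm_sub_rev _ (X' - X)] at h2
  rw [inv_mul_eq_div, le_div_iff₀ hκ]
  have := hΦ.lt_one
  have := norm_nonneg (y' - y)
  nlinarith

/-- Subtracting y·(X - x) from the action turns its variation Y·dX - y·dx into (Y - y)·dX + (x -
X)·dy. The new error is a product of increments, quadratic because x is Lipschitz in (X, y). -/
lemma exists_abs_mixedGenFun_sub_le (hΦ : IsTwistMap h κ C Φ A) : ∃ K, 0 ≤ K ∧ ∀ X y X' y',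
    |mixedGenFun Φ A X' y' - mixedGenFun Φ A X y -
      (inner ℝ ((Φ (basePoint Φ X y, y)).2 - y) (X' - X) +
        inner ℝ (basePoint Φ X y - X) (y' - y))| ≤ K * (‖X' - X‖ + ‖y' - y‖) ^ 2 := by
  have hκ : 0 < 1 - κ := sub_pos.2 hΦ.lt_one
  obtain ⟨R, hR⟩ : ∃ R, R = (1 - κ)⁻¹ := ⟨_, rfl⟩
  have hR0 : 0 ≤ R := by rw [hR]; positivity
  have hC := hΦ.C_nonneg
  refine ⟨C * (R + 1) ^ 2 + (R + 1), by positivity, fun X y X' y' => ?_⟩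
  set x := basePoint Φ X y with hx
  set x' := basePoint Φ X' y' with hx'
  set n := ‖X' - X‖ + ‖y' - y‖ with hn
  have hn0 : 0 ≤ n := by positivity
  have h1 := hΦ.action (x, y) (x', y')
  have h2 : ‖x' - x‖ ≤ R * n := by rw [hR]; exact hΦ.norm_basePoint_sub_le X y X' y'
  rw [hΦ.fst_basePoint, hΦ.fst_basePoint] at h1
  simp only at h1
  have hy : ‖y' - y‖ ≤ n := by rw [hn]; linarith [norm_nonneg (X' - X)]
  have hX : ‖X' - X‖ ≤ n := by rw [hn]; linarith [norm_nonneg (y' - y)]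
  have h3 : (‖x' - x‖ + ‖y' - y‖) ^ 2 ≤ ((R + 1) * n) ^ 2 :=
    pow_le_pow_left₀ (by positivity) (by linarith) 2
  have h4 : |inner ℝ (y' - y) (X' - X - (x' - x))| ≤ n * ((R + 1) * n) := by
    refine (abs_real_inner_le_norm _ _).trans (mul_le_mul hy ?_ (norm_nonneg _) hn0)
    exact (norm_sub_le _ _).trans (by linarith)
  have e : mixedGenFun Φ A X' y' - mixedGenFun Φ A X y -
      (inner ℝ ((Φ (x, y)).2 - y) (X' - X) + inner ℝ (x - X) (y' - y)) =
      (A (x', y') - A (x, y) - (inner ℝ (Φ (x, y)).2 (X' - X) - inner ℝ y (x' - x))) -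
      inner ℝ (y' - y) (X' - X - (x' - x)) := by
    simp only [mixedGenFun, ← hx, ← hx', inner_sub_left, inner_sub_right]
    rw [real_inner_comm y x, real_inner_comm y X, real_inner_comm y' x, real_inner_comm y' X]
    ring
  rw [e]
  refine (abs_sub _ _).trans ?_
  have h5 := mul_le_mul_of_nonneg_left h3 hC
  nlinarith

lemma abs_mixedGenFun_add_le (hΦ : IsTwistMap h κ C Φ A) (X y : E d) :
    |mixedGenFun Φ A X y + h * ‖y‖ ^ 2| ≤ C := by
  have := hΦ.bound_action (basePoint Φ X y, y)
  rwa [hΦ.fst_basePoint] at this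

lemma hasFDerivAt_mixedGenFun (hΦ : IsTwistMap h κ C Φ A) (w : E d × E d) :
    HasFDerivAt (fun w : E d × E d => mixedGenFun Φ A w.1 w.2)
      ((innerSL ℝ ((Φ (basePoint Φ w.1 w.2, w.2)).2 - w.2)).comp (ContinuousLinearMap.fst ℝ _ _) +
        (innerSL ℝ (basePoint Φ w.1 w.2 - w.1)).comp (ContinuousLinearMap.snd ℝ _ _)) w := by
  obtain ⟨K, hK, h1⟩ := hΦ.exists_abs_mixedGenFun_sub_le
  refine hasFDerivAt_of_abs_sub_le_sq (K := K * 4) fun w' => ?_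
  refine (h1 w.1 w.2 w'.1 w'.2).trans ?_
  have h2 : (‖w'.1 - w.1‖ + ‖w'.2 - w.2‖) ^ 2 ≤ (2 * ‖w' - w‖) ^ 2 :=
    pow_le_pow_left₀ (by positivity) (by
      have a1 := norm_fst_le (w' - w)
      have a2 := norm_snd_le (w' - w)
      rw [Prod.fst_sub] at a1
      rw [Prod.snd_sub] at a2
      linarith) 2
  have := mul_le_mul_of_nonneg_left h2 hK
  linarith

/-- Up to the quadratic form `-h|y|²`, the generating function is globally Lipschitz. -/
lemma lipschitzWith_mixedGenFun_add (hΦ : IsTwistMap h κ C Φ A) : ∃ L : ℝ≥0,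
    LipschitzWith L fun w : E d × E d => mixedGenFun Φ A w.1 w.2 + h * ‖w.2‖ ^ 2 := by
  have hd : ∀ w : E d × E d, HasFDerivAt (fun w : E d × E d => mixedGenFun Φ A w.1 w.2 + h * ‖w.2‖ ^ 2)
      ((innerSL ℝ ((Φ (basePoint Φ w.1 w.2, w.2)).2 - w.2)).comp (ContinuousLinearMap.fst ℝ _ _) +
        (innerSL ℝ (basePoint Φ w.1 w.2 - w.1)).comp (ContinuousLinearMap.snd ℝ _ _) +
        h • (2 • (innerSL ℝ w.2).comp (ContinuousLinearMap.snd ℝ _ _))) w := fun w =>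
    (hΦ.hasFDerivAt_mixedGenFun w).add
      (((ContinuousLinearMap.snd ℝ (E d) (E d)).hasFDerivAt (x := w)).norm_sq.const_mul h)
  refine ⟨(2 * C).toNNReal, ?_⟩
  rw [← lipschitzOnWith_univ]
  refine convex_univ.lipschitzOnWith_of_nnnorm_hasFDerivWithin_le
    (fun w _ => (hd w).hasFDerivWithinAt) fun w _ => ?_
  have hC := hΦ.C_nonneg
  rw [← NNReal.coe_le_coe, coe_nnnorm, Real.coe_toNNReal _ (by positivity)]
  refine ContinuousLinearMap.opNorm_le_bound _ (by positivity) fun v => ?_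
  have e : ((innerSL ℝ ((Φ (basePoint Φ w.1 w.2, w.2)).2 - w.2)).comp
        (ContinuousLinearMap.fst ℝ (E d) (E d)) +
        (innerSL ℝ (basePoint Φ w.1 w.2 - w.1)).comp (ContinuousLinearMap.snd ℝ (E d) (E d)) +
        h • (2 • (innerSL ℝ w.2).comp (ContinuousLinearMap.snd ℝ (E d) (E d)))) v =
      inner ℝ ((Φ (basePoint Φ w.1 w.2, w.2)).2 - w.2) v.1 -
      inner ℝ (w.1 - basePoint Φ w.1 w.2 - (2 * h) • w.2) v.2 := by
    simp only [add_apply, smul_apply, ContinuousLinearMap.comp_apply, ContinuousLinearMap.coe_fst',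
      ContinuousLinearMap.coe_snd', innerSL_apply_apply, inner_sub_left, inner_smul_left,
      RCLike.conj_to_real, smul_eq_mul, nsmul_eq_mul]
    push_cast
    ring
  rw [e, Real.norm_eq_abs]
  have b1 := hΦ.bound_snd (basePoint Φ w.1 w.2, w.2)
  have b2 := hΦ.bound_fst (basePoint Φ w.1 w.2, w.2)
  rw [hΦ.fst_basePoint] at b2
  have h1 := (abs_real_inner_le_norm ((Φ (basePoint Φ w.1 w.2, w.2)).2 - w.2) v.1).trans
    (mul_le_mul b1 (norm_fst_le v) (norm_nonneg _) hC)
  have h2 := (abs_real_inner_le_norm (w.1 - basePoint Φ w.1 w.2 - (2 * h) • w.2) v.2).trans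
    (mul_le_mul b2 (norm_snd_le v) (norm_nonneg _) hC)
  refine (abs_sub _ _).trans ?_
  linarith

lemma hasFDerivAt_mixedGenFun_add_inner (hΦ : IsTwistMap h κ C Φ A) (X x y : E d) :
    HasFDerivAt (fun y => mixedGenFun Φ A X y + inner ℝ (X - x) y)
      (innerSL ℝ (basePoint Φ X y - x)) y := by
  have h1 := (hΦ.hasFDerivAt_mixedGenFun (X, y)).comp y
    ((hasFDerivAt_const X y).prodMk (hasFDerivAt_id y))
  have h2 := h1.add ((innerSL ℝ (X - x)).hasFDerivAt (x := y))
  refine h2.congr_fderiv ?_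
  ext v
  simp

lemma tendsto_mixedGenFun_add_inner (hΦ : IsTwistMap h κ C Φ A) (X x : E d) :
    Tendsto (fun y => mixedGenFun Φ A X y + inner ℝ (X - x) y) (cocompact (E d)) atBot := by
  have hpos := hΦ.pos
  have h1 : Tendsto (fun r : ℝ => C + r * (‖X - x‖ - h * r)) atTop atBot := by
    refine tendsto_atBot_add_const_left _ _ (tendsto_id.atTop_mul_atBot₀ ?_)
    exact tendsto_atBot_add_const_left _ _
      (tendsto_neg_atTop_atBot.comp (tendsto_id.const_mul_atTop hpos))
  refine tendsto_atBot_mono (fun y => ?_) (h1.comp (tendsto_norm_cocompact_atTop (E := E d)))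
  have a1 := (abs_le.1 (hΦ.abs_mixedGenFun_add_le X y)).2
  have a2 := real_inner_le_norm (X - x) y
  simp only [Function.comp_apply]
  nlinarith

/-- The function y ↦ φ(X, y) + (X - x)·y tends to -∞ and so has a maximum. There its gradient x(X,
y) - x vanishes, which says that the orbit of (x, y) ends at X. -/
lemma surjective (hΦ : IsTwistMap h κ C Φ A) (x : E d) :
    Function.Surjective fun y => (Φ (x, y)).1 := by
  intro X
  have hc : Continuous fun y => mixedGenFun Φ A X y + inner ℝ (X - x) y :=
    continuous_iff_continuousAt.2 fun y =>
      (hΦ.hasFDerivAt_mixedGenFun_add_inner X x y).continuousAt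
  obtain ⟨y, hy⟩ := hc.exists_forall_ge (hΦ.tendsto_mixedGenFun_add_inner X x)
  have h1 : IsLocalMax (fun y => mixedGenFun Φ A X y + inner ℝ (X - x) y) y :=
    Eventually.of_forall hy
  have h2 := h1.hasFDerivAt_eq_zero (hΦ.hasFDerivAt_mixedGenFun_add_inner X x y)
  have h3 := congrArg (fun l : E d →L[ℝ] ℝ => l (basePoint Φ X y - x)) h2
  simp only [innerSL_apply_apply, zero_apply] at h3
  have h4 := sub_eq_zero.1 (inner_self_eq_zero.1 h3)
  refine ⟨y, ?_⟩
  change (Φ (x, y)).1 = X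
  rw [← h4, hΦ.fst_basePoint]

lemma fst_momentum (hΦ : IsTwistMap h κ C Φ A) (X x : E d) : (Φ (x, momentum Φ X x)).1 = X :=
  Function.invFun_eq (hΦ.surjective x X)

lemma momentum_fst (hΦ : IsTwistMap h κ C Φ A) (x y : E d) : momentum Φ (Φ (x, y)).1 x = y :=
  hΦ.injective x _ _ (hΦ.fst_momentum _ _)

lemma basePoint_momentum (hΦ : IsTwistMap h κ C Φ A) (X x : E d) :
    basePoint Φ X (momentum Φ X x) = x := by
  have := hΦ.basePoint_fst (x, momentum Φ X x)
  rwa [hΦ.fst_momentum] at this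

lemma mixedGenFun_momentum (hΦ : IsTwistMap h κ C Φ A) (X x : E d) :
    mixedGenFun Φ A X (momentum Φ X x) + inner ℝ (X - x) (momentum Φ X x) =
      actionGenFun Φ A X x := by
  rw [mixedGenFun, hΦ.basePoint_momentum, actionGenFun, real_inner_comm]
  ring

/-- At `momentum + r • w` the slope is ⟨x_r - x, w⟩, where x_r and x are the starting points of two
orbits ending at X with momenta differing by r w. The field `antitone` makes it nonpositive. -/
lemma antitoneOn_mixedGenFun (hΦ : IsTwistMap h κ C Φ A) (X x w : E d) :
    AntitoneOn (fun r : ℝ => mixedGenFun Φ A X (momentum Φ X x + r • w) +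
      inner ℝ (X - x) (momentum Φ X x + r • w)) (Ici 0) := by
  have hd : ∀ r : ℝ, HasDerivAt (fun r : ℝ => mixedGenFun Φ A X (momentum Φ X x + r • w) +
      inner ℝ (X - x) (momentum Φ X x + r • w))
      (inner ℝ (basePoint Φ X (momentum Φ X x + r • w) - x) w) r := by
    intro r
    have h1 : HasDerivAt (fun r : ℝ => momentum Φ X x + r • w) w r := by
      simpa using ((hasDerivAt_id r).smul_const w).const_add (momentum Φ X x)
    exact (hΦ.hasFDerivAt_mixedGenFun_add_inner X x _).comp_hasDerivAt r h1
  refine antitoneOn_of_deriv_nonpos (convex_Ici 0)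
    (fun r _ => (hd r).continuousAt.continuousWithinAt)
    (fun r _ => (hd r).differentiableAt.differentiableWithinAt) fun r hr => ?_
  rw [interior_Ici, mem_Ioi] at hr
  rw [(hd r).deriv]
  have h1 := hΦ.antitone (x, momentum Φ X x)
    (basePoint Φ X (momentum Φ X x + r • w), momentum Φ X x + r • w)
    (by rw [hΦ.fst_basePoint, hΦ.fst_momentum])
  simp only [add_sub_cancel_left, inner_smul_left, RCLike.conj_to_real] at h1
  rw [real_inner_comm]
  exact nonpos_of_mul_nonpos_right h1 hr

lemma tendsto_mixedGenFun_ray (hΦ : IsTwistMap h κ C Φ A) (X x y : E d) {w : E d} (hw : w ≠ 0) :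
    Tendsto (fun r : ℝ => mixedGenFun Φ A X (y + r • w) + inner ℝ (X - x) (y + r • w))
      atTop atBot := by
  refine (hΦ.tendsto_mixedGenFun_add_inner X x).comp ?_
  rw [← Metric.cobounded_eq_cocompact, ← comap_norm_atTop, tendsto_comap_iff]
  have h1 : Tendsto (fun r : ℝ => r * ‖w‖ - ‖y‖) atTop atTop :=
    tendsto_atTop_add_const_right _ _ (tendsto_id.atTop_mul_const (norm_pos_iff.2 hw))
  refine tendsto_atTop_mono (fun r => ?_) h1
  have h2 := norm_sub_norm_le (r • w) (-y)
  rw [norm_neg, sub_neg_eq_add, add_comm, norm_smul, Real.norm_eq_abs] at h2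
  have h3 := mul_le_mul_of_nonneg_right (le_abs_self r) (norm_nonneg w)
  simp only [Function.comp_apply]
  rw [add_comm] at h2 ⊢
  linarith

lemma mixedGenFun_add_inner_le (hΦ : IsTwistMap h κ C Φ A) (X x y : E d) :
    mixedGenFun Φ A X y + inner ℝ (X - x) y ≤ actionGenFun Φ A X x := by
  have := hΦ.antitoneOn_mixedGenFun X x (y - momentum Φ X x) (mem_Ici.2 le_rfl)
    (mem_Ici.2 zero_le_one) zero_le_one
  simp only [one_smul, add_sub_cancel, zero_smul, add_zero] at this
  rwa [hΦ.mixedGenFun_momentum] at this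

/-- Since ψ is the maximum over y, any trial value bounds it below; (X - x)/(2h) is the maximiser
for the model -h|y|² + (X - x)·y. The bound makes the minimisation in x coercive. -/
lemma le_actionGenFun (hΦ : IsTwistMap h κ C Φ A) (X x : E d) :
    ‖X - x‖ ^ 2 / (4 * h) - C ≤ actionGenFun Φ A X x := by
  have hpos := hΦ.pos
  have h1 := hΦ.mixedGenFun_add_inner_le X x ((2 * h)⁻¹ • (X - x))
  have h2 := (abs_le.1 (hΦ.abs_mixedGenFun_add_le X ((2 * h)⁻¹ • (X - x)))).1
  rw [norm_smul, mul_pow, Real.norm_of_nonneg (by positivity)] at h2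
  rw [inner_smul_right, real_inner_self_eq_norm_sq] at h1
  have e1 : h * (((2 * h)⁻¹) ^ 2 * ‖X - x‖ ^ 2) = ‖X - x‖ ^ 2 / (4 * h) := by
    field_simp
    ring
  have e2 : (2 * h)⁻¹ * ‖X - x‖ ^ 2 = 2 * (‖X - x‖ ^ 2 / (4 * h)) := by
    field_simp
    ring
  rw [e1] at h2
  rw [e2] at h1
  linarith

/-- The continuous bijection (x, y) ↦ (X, x) is proper, because 2hy is within C of X - x; hence it
is a homeomorphism. -/
lemma continuous_momentum (hΦ : IsTwistMap h κ C Φ A) :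
    Continuous fun w : E d × E d => momentum Φ w.1 w.2 := by
  have hpos := hΦ.pos
  let e : E d × E d ≃ E d × E d :=
    { toFun := fun z => ((Φ z).1, z.1)
      invFun := fun w => (w.2, momentum Φ w.1 w.2)
      left_inv := fun z => Prod.ext rfl (hΦ.momentum_fst z.1 z.2)
      right_inv := fun w => Prod.ext (hΦ.fst_momentum w.1 w.2) rfl }
  have hec : Continuous e := (continuous_fst.comp hΦ.continuous).prodMk continuous_fst
  have hprop : IsProperMap e := by
    refine isProperMap_iff_tendsto_cocompact.2 ⟨hec, ?_⟩
    rw [← Metric.cobounded_eq_cocompact]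
    nth_rw 2 [← comap_norm_atTop]
    rw [tendsto_comap_iff]
    have h1 : Tendsto (fun z : E d × E d => (1 + 1 / h)⁻¹ * (‖z‖ - C / (2 * h)))
        (Bornology.cobounded _) atTop :=
      Tendsto.const_mul_atTop (by positivity)
        (tendsto_atTop_add_const_right _ _ tendsto_norm_cobounded_atTop)
    refine tendsto_atTop_mono (fun z => ?_) h1
    rw [inv_mul_le_iff₀ (by positivity)]
    have a0 : ‖(Φ z).1‖ ≤ ‖e z‖ := norm_fst_le (e z)
    have a1 : ‖z.1‖ ≤ ‖e z‖ := norm_snd_le (e z)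
    have a2 := hΦ.bound_fst z
    have a3 : ‖(2 * h) • z.2‖ ≤ ‖(Φ z).1‖ + ‖z.1‖ + C := by
      have : (2 * h) • z.2 = (Φ z).1 - z.1 - ((Φ z).1 - z.1 - (2 * h) • z.2) := by abel
      rw [this]
      exact (norm_sub_le _ _).trans (add_le_add (norm_sub_le _ _) a2)
    rw [norm_smul, Real.norm_of_nonneg (by positivity)] at a3
    have a4 : ‖z.2‖ ≤ ‖e z‖ / h + C / (2 * h) := by
      rw [show ‖e z‖ / h + C / (2 * h) = (2 * ‖e z‖ + C) / (2 * h) by field_simp,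
        le_div_iff₀ (by positivity)]
      linarith
    have a5 : 0 ≤ C / (2 * h) := div_nonneg hΦ.C_nonneg (by positivity)
    have a6 : 0 ≤ ‖e z‖ / h := by positivity
    have a7 : ‖z‖ ≤ ‖e z‖ + ‖e z‖ / h + C / (2 * h) :=
      max_le (by linarith) (by linarith [norm_nonneg (e z)])
    have a8 : (1 + 1 / h) * ‖e z‖ = ‖e z‖ + ‖e z‖ / h := by ring
    simp only [Function.comp_apply]
    linarith
  exact continuous_snd.comp (e.toHomeomorphOfContinuousClosed hec hprop.isClosedMap).symm.continuous

/-- The generating function is differentiable, with differential `Y dX - y dx`. -/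
theorem hasFDerivAt_actionGenFun (hΦ : IsTwistMap h κ C Φ A) (w : E d × E d) :
    HasFDerivAt (fun w : E d × E d => actionGenFun Φ A w.1 w.2)
      ((innerSL ℝ (Φ (w.2, momentum Φ w.1 w.2)).2).comp (ContinuousLinearMap.fst ℝ _ _) -
        (innerSL ℝ (momentum Φ w.1 w.2)).comp (ContinuousLinearMap.snd ℝ _ _)) w := by
  obtain ⟨K, hK, hmix⟩ := hΦ.exists_abs_mixedGenFun_sub_le
  set D : E d × E d → (E d × E d →L[ℝ] ℝ) := fun w =>
    (innerSL ℝ (Φ (w.2, momentum Φ w.1 w.2)).2).comp (ContinuousLinearMap.fst ℝ _ _) -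
        (innerSL ℝ (momentum Φ w.1 w.2)).comp (ContinuousLinearMap.snd ℝ _ _) with hD
  have hDc : Continuous D := by
    have h1 : Continuous fun w : E d × E d => (Φ (w.2, momentum Φ w.1 w.2)).2 :=
      continuous_snd.comp (hΦ.continuous.comp (continuous_snd.prodMk hΦ.continuous_momentum))
    exact (((innerSL ℝ).continuous.comp h1).clm_comp continuous_const).sub
      (((innerSL ℝ).continuous.comp hΦ.continuous_momentum).clm_comp continuous_const)
  -- ψ is a maximum over y, and the maximiser at `w` is a competitor at `w'`. This bounds the
  -- increment below; exchanging the two points bounds it above, and continuity of `D` makes the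
  -- bounds agree to first order.
  have hlow : ∀ w w' : E d × E d, D w (w' - w) - K * ‖w' - w‖ ^ 2 ≤
      actionGenFun Φ A w'.1 w'.2 - actionGenFun Φ A w.1 w.2 := by
    intro w w'
    have h1 := hΦ.mixedGenFun_add_inner_le w'.1 w'.2 (momentum Φ w.1 w.2)
    have h2 := hΦ.mixedGenFun_momentum w.1 w.2
    have h3 := (abs_le.1 (hmix w.1 (momentum Φ w.1 w.2) w'.1 (momentum Φ w.1 w.2))).1
    rw [hΦ.basePoint_momentum, sub_self, norm_zero, inner_zero_right, add_zero, add_zero] at h3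
    have h4 : ‖w'.1 - w.1‖ ^ 2 ≤ ‖w' - w‖ ^ 2 :=
      pow_le_pow_left₀ (norm_nonneg _) (norm_fst_le (w' - w)) 2
    have h5 := mul_le_mul_of_nonneg_left h4 hK
    have e : D w (w' - w) = inner ℝ (Φ (w.2, momentum Φ w.1 w.2)).2 (w'.1 - w.1) -
        inner ℝ (momentum Φ w.1 w.2) (w'.2 - w.2) := by
      simp [hD]
    rw [e]
    simp only [inner_sub_left, inner_sub_right] at h1 h2 h3 ⊢
    rw [real_inner_comm (momentum Φ w.1 w.2) w'.1, real_inner_comm (momentum Φ w.1 w.2) w'.2] at h1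
    rw [real_inner_comm (momentum Φ w.1 w.2) w.1, real_inner_comm (momentum Φ w.1 w.2) w.2] at h2
    linarith
  rw [hasFDerivAt_iff_isLittleO, Asymptotics.isLittleO_iff]
  intro ε hε
  have hev : ∀ᶠ w' in 𝓝 w, ‖D w' - D w‖ < ε / 2 ∧ K * ‖w' - w‖ < ε / 2 := by
    refine Filter.Eventually.and ?_ ?_
    · have h1 : Tendsto (fun w' => ‖D w' - D w‖) (𝓝 w) (𝓝 0) := by
        have := (hDc.sub continuous_const).norm.tendsto w (f := fun w' => ‖D w' - D w‖)
        simpa using this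
      exact h1.eventually (gt_mem_nhds (by positivity))
    · have h1 : Tendsto (fun w' => K * ‖w' - w‖) (𝓝 w) (𝓝 0) := by
        have : Continuous fun w' => K * ‖w' - w‖ := by fun_prop
        simpa using this.tendsto w
      exact h1.eventually (gt_mem_nhds (by positivity))
  filter_upwards [hev] with w' hw'
  have h1 := hlow w w'
  have h2 := hlow w' w
  have h3 : D w' (w - w') = - D w' (w' - w) := by rw [← map_neg, neg_sub]
  rw [h3, norm_sub_rev w w'] at h2
  have h4 := (D w' - D w).le_opNorm (w' - w)
  rw [sub_apply, Real.norm_eq_abs] at h4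
  have h5 := (abs_le.1 h4).2
  have h6 := mul_le_mul_of_nonneg_right hw'.1.le (norm_nonneg (w' - w))
  have h7 := mul_le_mul_of_nonneg_right hw'.2.le (norm_nonneg (w' - w))
  rw [Real.norm_eq_abs, abs_le]
  have h8 : 0 ≤ ε / 2 * ‖w' - w‖ := by positivity
  constructor <;> nlinarith

end IsTwistMap

end TwistMaps

end HJ
end

/-! ### One-step minima, their Lipschitz property and their composition -/

noncomputable section

namespace HJ

section TwistMaps

variable {d : ℕ}

namespace IsTwistMap

variable {h κ C : ℝ} {Φ : E d × E d → E d × E d} {A : E d × E d → ℝ}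

lemma contDiff_actionGenFun (hΦ : IsTwistMap h κ C Φ A) :
    ContDiff ℝ 1 fun w : E d × E d => actionGenFun Φ A w.1 w.2 := by
  have hDc : Continuous fun w : E d × E d =>
      (innerSL ℝ (Φ (w.2, momentum Φ w.1 w.2)).2).comp (ContinuousLinearMap.fst ℝ (E d) (E d)) -
        (innerSL ℝ (momentum Φ w.1 w.2)).comp (ContinuousLinearMap.snd ℝ (E d) (E d)) := by
    have h1 : Continuous fun w : E d × E d => (Φ (w.2, momentum Φ w.1 w.2)).2 :=
      continuous_snd.comp (hΦ.continuous.comp (continuous_snd.prodMk hΦ.continuous_momentum))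
    exact (((innerSL ℝ).continuous.comp h1).clm_comp continuous_const).sub
      (((innerSL ℝ).continuous.comp hΦ.continuous_momentum).clm_comp continuous_const)
  exact contDiff_one_iff_hasFDerivAt.2 ⟨_, hDc, hΦ.hasFDerivAt_actionGenFun⟩

lemma continuous_actionGenFun (hΦ : IsTwistMap h κ C Φ A) :
    Continuous fun w : E d × E d => actionGenFun Φ A w.1 w.2 :=
  hΦ.contDiff_actionGenFun.continuous

lemma hasFDerivAt_actionGenFun_left (hΦ : IsTwistMap h κ C Φ A) (X x : E d) :
    HasFDerivAt (fun X' => actionGenFun Φ A X' x) (innerSL ℝ (Φ (x, momentum Φ X x)).2) X := by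
  refine (HasFDerivAt.comp (g := fun w : E d × E d => actionGenFun Φ A w.1 w.2) X
    (hΦ.hasFDerivAt_actionGenFun (X, x)) ((hasFDerivAt_id (𝕜 := ℝ) X).prodMk
    (hasFDerivAt_const (𝕜 := ℝ) x X))).congr_fderiv ?_
  ext v
  simp

lemma hasFDerivAt_actionGenFun_right (hΦ : IsTwistMap h κ C Φ A) (X x : E d) :
    HasFDerivAt (fun x' => actionGenFun Φ A X x') (innerSL ℝ (-momentum Φ X x)) x := by
  refine (HasFDerivAt.comp (g := fun w : E d × E d => actionGenFun Φ A w.1 w.2) x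
    (hΦ.hasFDerivAt_actionGenFun (X, x)) ((hasFDerivAt_const X x).prodMk (hasFDerivAt_id x))).congr_fderiv ?_
  ext v
  simp

lemma gradient_left (hΦ : IsTwistMap h κ C Φ A) (X x : E d) :
    gradient (fun X' => actionGenFun Φ A X' x) X = (Φ (x, momentum Φ X x)).2 :=
  (hasGradientAt_iff_hasFDerivAt.2 (hΦ.hasFDerivAt_actionGenFun_left X x)).gradient

lemma gradient_right (hΦ : IsTwistMap h κ C Φ A) (X x : E d) :
    gradient (fun x' => actionGenFun Φ A X x') x = -momentum Φ X x :=
  (hasGradientAt_iff_hasFDerivAt.2 (hΦ.hasFDerivAt_actionGenFun_right X x)).gradient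

lemma isClassicalGenFun (hΦ : IsTwistMap h κ C Φ A) :
    IsClassicalGenFun Φ (actionGenFun Φ A) := by
  refine ⟨hΦ.contDiff_actionGenFun, fun x y X Y => ?_⟩
  rw [hΦ.gradient_left, hΦ.gradient_right, neg_neg]
  constructor
  · intro hxy
    have h1 : momentum Φ X x = y := by
      have := hΦ.momentum_fst x y
      rwa [hxy] at this
    rw [h1, hxy]
    exact ⟨rfl, rfl⟩
  · rintro ⟨rfl, rfl⟩
    exact Prod.ext (hΦ.fst_momentum X x) rfl

/-- When both ends move together the derivative of ψ is ⟨Y - y, v⟩, and Y - y is bounded by C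
although Y and y are not. -/
lemma abs_actionGenFun_translate_le (hΦ : IsTwistMap h κ C Φ A) (X x v : E d) :
    |actionGenFun Φ A (X + v) (x + v) - actionGenFun Φ A X x| ≤ C * ‖v‖ := by
  have hd : ∀ r : ℝ, HasDerivAt (fun r : ℝ => actionGenFun Φ A (X + r • v) (x + r • v))
      (inner ℝ ((Φ (x + r • v, momentum Φ (X + r • v) (x + r • v))).2 -
        momentum Φ (X + r • v) (x + r • v)) v) r := by
    intro r
    have h1 : ∀ a : E d, HasDerivAt (fun r : ℝ => a + r • v) v r := fun a => by
      simpa using ((hasDerivAt_id r).smul_const v).const_add a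
    have := (hΦ.hasFDerivAt_actionGenFun (X + r • v, x + r • v)).comp_hasDerivAt r
      ((h1 X).prodMk (h1 x))
    refine this.congr_deriv ?_
    simp [inner_sub_left]
  have := (convex_Icc (0 : ℝ) 1).norm_image_sub_le_of_norm_hasDerivWithin_le (C := C * ‖v‖)
    (fun r _ => (hd r).hasDerivWithinAt) (fun r _ => by
      refine (norm_inner_le_norm _ _).trans ?_
      exact mul_le_mul_of_nonneg_right (hΦ.bound_snd _) (norm_nonneg v))
    ⟨le_rfl, zero_le_one⟩ ⟨zero_le_one, le_rfl⟩
  simpa using this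

lemma tendsto_add_actionGenFun (hΦ : IsTwistMap h κ C Φ A) {v : E d → ℝ} (hv : IsLip v)
    (X : E d) : Tendsto (fun x => v x + actionGenFun Φ A X x) (cocompact (E d)) atTop := by
  obtain ⟨L, hL⟩ := hv
  have hpos := hΦ.pos
  have h1 : Tendsto (fun r : ℝ => v X - C + r * ((4 * h)⁻¹ * r - L)) atTop atTop :=
    tendsto_atTop_add_const_left _ _ (tendsto_id.atTop_mul_atTop₀
      (tendsto_atTop_add_const_right _ _ (tendsto_id.const_mul_atTop (by positivity))))
  refine tendsto_atTop_mono (fun x => ?_) (h1.comp (tendsto_dist_left_cocompact_atTop X))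
  have a1 := hΦ.le_actionGenFun X x
  have a2 := (abs_le.1 ((Real.dist_eq _ _).symm.le.trans (hL.dist_le_mul X x))).2
  rw [dist_eq_norm] at a2
  simp only [Function.comp_apply]
  rw [dist_eq_norm]
  have e : ‖X - x‖ ^ 2 / (4 * h) = ‖X - x‖ * ((4 * h)⁻¹ * ‖X - x‖) := by
    field_simp
  rw [e] at a1
  rw [mul_sub]
  linarith

end IsTwistMap

/-- The one-step minimum `X ↦ min_x (v x + ψ X x)`. -/
def minStep (ψ : E d → E d → ℝ) (v : E d → ℝ) (X : E d) : ℝ := ⨅ x, v x + ψ X x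

lemma IsLip.continuous {v : E d → ℝ} (hv : IsLip v) : Continuous v := by
  obtain ⟨L, hL⟩ := hv
  exact hL.continuous

namespace IsTwistMap

variable {h κ C : ℝ} {Φ : E d × E d → E d × E d} {A : E d × E d → ℝ}

lemma isLeast_minStep (hΦ : IsTwistMap h κ C Φ A) {v : E d → ℝ} (hv : IsLip v) (X : E d) :
    IsLeast (range fun x => v x + actionGenFun Φ A X x) (minStep (actionGenFun Φ A) v X) := by
  have hc : Continuous fun x => v x + actionGenFun Φ A X x :=
    hv.continuous.add (hΦ.continuous_actionGenFun.comp (continuous_const.prodMk continuous_id))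
  obtain ⟨x, hx⟩ := hc.exists_forall_le (hΦ.tendsto_add_actionGenFun hv X)
  have h1 : IsLeast (range fun x => v x + actionGenFun Φ A X x) (v x + actionGenFun Φ A X x) :=
    ⟨⟨x, rfl⟩, forall_mem_range.2 hx⟩
  rwa [minStep, iInf, h1.csInf_eq]

/-- A minimiser for X', translated by X - X', is a competitor for X and costs at most (Lip v + C)|X
- X'| more. -/
lemma isLip_minStep (hΦ : IsTwistMap h κ C Φ A) {v : E d → ℝ} (hv : IsLip v) :
    IsLip (minStep (actionGenFun Φ A) v) := by
  obtain ⟨L, hL⟩ := id hv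
  have hC := hΦ.C_nonneg
  refine ⟨L + C.toNNReal, LipschitzWith.of_le_add_mul _ fun X X' => ?_⟩
  obtain ⟨⟨x, hx⟩, -⟩ := hΦ.isLeast_minStep hv X'
  have h1 := (hΦ.isLeast_minStep hv X).2 ⟨x + (X - X'), rfl⟩
  have h2 := (abs_le.1 (hΦ.abs_actionGenFun_translate_le X' x (X - X'))).2
  have h3 := (abs_le.1 ((Real.dist_eq _ _).symm.le.trans (hL.dist_le_mul (x + (X - X')) x))).2
  rw [dist_eq_norm, add_sub_cancel_left] at h3
  rw [add_sub_cancel] at h2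
  simp only at h1 hx
  rw [dist_eq_norm, NNReal.coe_add, Real.coe_toNNReal _ hC, add_mul]
  linarith

/-- The generating function of a composition of twist maps. -/
theorem isLeast_actionGenFun_comp {h₁ κ₁ C₁ h₂ κ₂ C₂ : ℝ} {Φ₁ Φ₂ : E d × E d → E d × E d}
    {A₁ A₂ : E d × E d → ℝ} (hΦ : IsTwistMap h κ C Φ A) (hΦ₁ : IsTwistMap h₁ κ₁ C₁ Φ₁ A₁)
    (hΦ₂ : IsTwistMap h₂ κ₂ C₂ Φ₂ A₂) (hcomp : ∀ z, Φ₂ (Φ₁ z) = Φ z)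
    (hA : ∀ z, A₁ z + A₂ (Φ₁ z) = A z) (X x : E d) :
    IsLeast (range fun x' => actionGenFun Φ₁ A₁ x' x + actionGenFun Φ₂ A₂ X x')
      (actionGenFun Φ A X x) := by
  have hc : Continuous fun x' => actionGenFun Φ₁ A₁ x' x + actionGenFun Φ₂ A₂ X x' :=
    (hΦ₁.continuous_actionGenFun.comp (continuous_id.prodMk continuous_const)).add
      (hΦ₂.continuous_actionGenFun.comp (continuous_const.prodMk continuous_id))
  have ht : Tendsto (fun x' => actionGenFun Φ₁ A₁ x' x + actionGenFun Φ₂ A₂ X x')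
      (cocompact (E d)) atTop := by
    have h0 : IsLip (fun _ : E d => -C₁) := ⟨0, LipschitzWith.const _⟩
    refine tendsto_atTop_mono (fun x' => ?_) (hΦ₂.tendsto_add_actionGenFun h0 X)
    have h1 := hΦ₁.le_actionGenFun x' x
    have h2 : 0 ≤ ‖x' - x‖ ^ 2 / (4 * h₁) := by
      have := hΦ₁.pos
      positivity
    linarith
  obtain ⟨x', hx'⟩ := hc.exists_forall_le ht
  -- At a minimiser `x'` the vanishing derivative equates the final momentum of the first piece with
  -- the initial one of the second. The concatenation is thus an orbit of Φ from x to X, the only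
  -- one, and actions add.
  suffices hval : actionGenFun Φ A X x = actionGenFun Φ₁ A₁ x' x + actionGenFun Φ₂ A₂ X x' by
    rw [hval]
    exact ⟨⟨x', rfl⟩, forall_mem_range.2 hx'⟩
  have h1 : IsLocalMin (fun x' => actionGenFun Φ₁ A₁ x' x + actionGenFun Φ₂ A₂ X x') x' :=
    Eventually.of_forall hx'
  have h2 := h1.hasFDerivAt_eq_zero ((hΦ₁.hasFDerivAt_actionGenFun_left x' x).add
    (hΦ₂.hasFDerivAt_actionGenFun_right X x'))
  rw [← map_add] at h2
  have h3 : (Φ₁ (x, momentum Φ₁ x' x)).2 + -momentum Φ₂ X x' = 0 := by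
    have := congrArg (fun l : E d →L[ℝ] ℝ => l ((Φ₁ (x, momentum Φ₁ x' x)).2 + -momentum Φ₂ X x')) h2
    simpa only [innerSL_apply_apply, zero_apply, inner_self_eq_zero] using this
  have h4 : Φ₁ (x, momentum Φ₁ x' x) = (x', momentum Φ₂ X x') :=
    Prod.ext (hΦ₁.fst_momentum x' x) (add_neg_eq_zero.1 h3)
  have h5 : (Φ (x, momentum Φ₁ x' x)).1 = X := by
    rw [← hcomp, h4, hΦ₂.fst_momentum]
  have h6 := hΦ.momentum_fst x (momentum Φ₁ x' x)
  rw [h5] at h6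
  rw [actionGenFun, h6, ← hA, h4]
  rfl

lemma minStep_minStep {h₁ κ₁ C₁ h₂ κ₂ C₂ : ℝ} {Φ₁ Φ₂ : E d × E d → E d × E d}
    {A₁ A₂ : E d × E d → ℝ} (hΦ : IsTwistMap h κ C Φ A) (hΦ₁ : IsTwistMap h₁ κ₁ C₁ Φ₁ A₁)
    (hΦ₂ : IsTwistMap h₂ κ₂ C₂ Φ₂ A₂) (hcomp : ∀ z, Φ₂ (Φ₁ z) = Φ z)
    (hA : ∀ z, A₁ z + A₂ (Φ₁ z) = A z) {v : E d → ℝ} (hv : IsLip v) :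
    minStep (actionGenFun Φ₂ A₂) (minStep (actionGenFun Φ₁ A₁) v) =
      minStep (actionGenFun Φ A) v := by
  ext X
  have hv₁ := hΦ₁.isLip_minStep hv
  refine le_antisymm ?_ ?_
  · obtain ⟨⟨x, hx⟩, -⟩ := hΦ.isLeast_minStep hv X
    obtain ⟨⟨x', hx'⟩, -⟩ := hΦ.isLeast_actionGenFun_comp hΦ₁ hΦ₂ hcomp hA X x
    have h1 := (hΦ₁.isLeast_minStep hv x').2 ⟨x, rfl⟩
    have h2 := (hΦ₂.isLeast_minStep hv₁ X).2 ⟨x', rfl⟩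
    simp only at hx hx' h1 h2
    linarith
  · obtain ⟨⟨x', hx'⟩, -⟩ := hΦ₂.isLeast_minStep hv₁ X
    obtain ⟨⟨x, hx⟩, -⟩ := hΦ₁.isLeast_minStep hv x'
    have h1 := (hΦ.isLeast_actionGenFun_comp hΦ₁ hΦ₂ hcomp hA X x).2 ⟨x', rfl⟩
    have h2 := (hΦ.isLeast_minStep hv X).2 ⟨x, rfl⟩
    simp only at hx hx' h1 h2
    linarith

end IsTwistMap

variable {T c B : ℝ} {H : ℝ → E d → E d → ℝ}

namespace HamiltonianEstimates

/-- The integral of y·Ẋ is y·(X - x), which identifies the integral formula with the action minus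
y·(X - x). -/
lemma genFun_eq (hE : HamiltonianEstimates T c B H) {s t : ℝ} (hst : IsShortStep T c s t)
    (X y : E d) :
    genFun H T s t X y = mixedGenFun (flow H T s t) (action H T s t) X y := by
  obtain ⟨κ, C, hΦ⟩ := hE.exists_isTwistMap hst
  set z := (basePoint (flow H T s t) X y, y) with hz
  have h1 : Function.invFun (alpha H T s t) (X, y) = z := by
    have := Function.invFun_eq (hΦ.bijective.2 (X, y))
    have h2 : (Function.invFun (alpha H T s t) (X, y)).2 = y := congrArg Prod.snd this
    exact Prod.ext rfl h2
  have hs : s ∈ Icc 0 T := ⟨hst.nonneg, hst.lt.le.trans hst.le⟩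
  have hγ := hE.isCharacteristic_flow hs z
  have hu : uIcc s t ⊆ Icc 0 T := by
    rw [uIcc_of_le hst.lt.le]
    exact Icc_subset_Icc hst.nonneg hst.le
  have c1 := (hE.continuousOn_lagrangian_comp hγ).mono hu
  have c2 : ContinuousOn (fun τ => (hamField H τ (flow H T s τ z)).1) (uIcc s t) :=
    (continuous_fst.comp_continuousOn (hE.continuousOn_hamField_comp hγ)).mono hu
  have c3 : ContinuousOn (fun τ => inner ℝ y (hamField H τ (flow H T s τ z)).1) (uIcc s t) :=
    continuousOn_const.inner c2
  have hsub : Icc s t ⊆ Icc 0 T := Icc_subset_Icc hst.nonneg hst.le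
  have hftc : ∫ τ in s..t, inner ℝ y (hamField H τ (flow H T s τ z)).1 =
      inner ℝ y ((flow H T s t z).1 - (flow H T s s z).1) := by
    rw [intervalIntegral.integral_eq_sub_of_hasDerivAt_of_le hst.lt.le
      (f := fun τ => inner ℝ y (flow H T s τ z).1)
      (f' := fun τ => inner ℝ y (hamField H τ (flow H T s τ z)).1)
      (continuousOn_const.inner ((continuous_fst.comp_continuousOn hγ.continuousOn).mono
        hsub)) (fun τ hτ => ?_) c3.intervalIntegrable]
    · rw [inner_sub_right]
    · have := hasDerivAt_of_Icc hst.nonneg hst.le hτ (hγ.hasDerivWithinAt_fst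
        (hsub (Ioo_subset_Icc_self hτ)))
      simpa using (hasDerivAt_const τ y).inner ℝ this
  rw [hE.flow_self hs, hΦ.fst_basePoint] at hftc
  have h2 : genFun H T s t X y = ∫ τ in s..t, (lagrangian H τ (flow H T s τ z) -
      inner ℝ y (hamField H τ (flow H T s τ z)).1) := by
    simp only [genFun, h1]
    refine intervalIntegral.integral_congr fun τ _ => ?_
    simp only [lagrangian, inner_sub_left]
    ring
  rw [h2, intervalIntegral.integral_sub c1.intervalIntegrable c3.intervalIntegrable, hftc]
  rfl

lemma action_add_action (hE : HamiltonianEstimates T c B H) {s r t : ℝ} (hs : 0 ≤ s)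
    (hsr : s ≤ r) (hrt : r ≤ t) (ht : t ≤ T) (z : E d × E d) :
    action H T s r z + action H T r t (flow H T s r z) = action H T s t z := by
  have hs' : s ∈ Icc 0 T := ⟨hs, hsr.trans (hrt.trans ht)⟩
  have hc := hE.continuousOn_lagrangian_comp (hE.isCharacteristic_flow hs' z)
  have h1 : action H T r t (flow H T s r z) =
      ∫ τ in r..t, lagrangian H τ (flow H T s τ z) := by
    refine intervalIntegral.integral_congr fun τ hτ => ?_
    rw [uIcc_of_le hrt] at hτ
    rw [hE.flow_flow hs hsr hτ.1 (hτ.2.trans ht)]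
  rw [h1, action, intervalIntegral.integral_add_adjacent_intervals]
  · rfl
  · refine (hc.mono ?_).intervalIntegrable
    rw [uIcc_of_le hsr]
    exact Icc_subset_Icc hs (hrt.trans ht)
  · refine (hc.mono ?_).intervalIntegrable
    rw [uIcc_of_le hrt]
    exact Icc_subset_Icc (hs.trans hsr) ht

lemma isLip_minStep (hE : HamiltonianEstimates T c B H) {s t : ℝ} (hst : IsShortStep T c s t)
    {v : E d → ℝ} (hv : IsLip v) : IsLip (minStep (classicalGenFun H T s t) v) := by
  obtain ⟨κ, C, hΦ⟩ := hE.exists_isTwistMap hst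
  exact hΦ.isLip_minStep hv

lemma isLeast_minStep (hE : HamiltonianEstimates T c B H) {s t : ℝ} (hst : IsShortStep T c s t)
    {v : E d → ℝ} (hv : IsLip v) (X : E d) :
    IsLeast (range fun x => v x + classicalGenFun H T s t X x)
      (minStep (classicalGenFun H T s t) v X) := by
  obtain ⟨κ, C, hΦ⟩ := hE.exists_isTwistMap hst
  exact hΦ.isLeast_minStep hv X

lemma minStep_minStep (hE : HamiltonianEstimates T c B H) {s r t : ℝ} (hst : IsShortStep T c s t)
    (hsr : s < r) (hrt : r < t) {v : E d → ℝ} (hv : IsLip v) :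
    minStep (classicalGenFun H T r t) (minStep (classicalGenFun H T s r) v) =
      minStep (classicalGenFun H T s t) v := by
  have hc := hE.c_nonneg
  have h1 : IsShortStep T c s r := ⟨hst.nonneg, hsr, hrt.le.trans hst.le,
    lt_of_le_of_lt (by gcongr) hst.small⟩
  have h2 : IsShortStep T c r t := ⟨hst.nonneg.trans hsr.le, hrt, hst.le,
    lt_of_le_of_lt (by gcongr) hst.small⟩
  obtain ⟨κ, C, hΦ⟩ := hE.exists_isTwistMap hst
  obtain ⟨κ₁, C₁, hΦ₁⟩ := hE.exists_isTwistMap h1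
  obtain ⟨κ₂, C₂, hΦ₂⟩ := hE.exists_isTwistMap h2
  exact hΦ.minStep_minStep hΦ₁ hΦ₂
    (fun z => hE.flow_flow hst.nonneg hsr.le hrt.le hst.le z)
    (fun z => hE.action_add_action hst.nonneg hsr.le hrt.le hst.le z) hv

end HamiltonianEstimates

end TwistMaps

end HJ
end

/-! ### Iterated minima and independence of the subdivision -/

noncomputable section

namespace HJ

section Subdivisions

variable {d : ℕ} {T c B : ℝ} {H : ℝ → E d → E d → ℝ}

/-- All the steps of `τ` are short. -/
def HasShortSteps (T c : ℝ) {N : ℕ} (τ : Fin (N + 1) → ℝ) : Prop :=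
  ∀ i : Fin N, IsShortStep T c (τ i.castSucc) (τ i.succ)

namespace HasShortSteps

variable {N : ℕ}

lemma head {τ : Fin (N + 2) → ℝ} (h : HasShortSteps T c τ) : IsShortStep T c (τ 0) (τ 1) := h 0

lemma tail {τ : Fin (N + 2) → ℝ} (h : HasShortSteps T c τ) :
    HasShortSteps T c (Fin.tail τ) := fun i => h i.succ

lemma cons {τ : Fin (N + 1) → ℝ} (h : HasShortSteps T c τ) {s : ℝ} (hs : IsShortStep T c s (τ 0)) :
    HasShortSteps T c (Fin.cons s τ : Fin (N + 2) → ℝ) := by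
  intro i
  refine Fin.cases ?_ (fun j => ?_) i
  · simpa using hs
  · simpa [Fin.castSucc_succ] using h j

lemma strictMono {τ : Fin (N + 1) → ℝ} (h : HasShortSteps T c τ) : StrictMono τ :=
  Fin.strictMono_iff_lt_succ.2 fun i => (h i).lt

end HasShortSteps

/-- The iterated one-step minima along a subdivision. -/
def iterMin (H : ℝ → E d → E d → ℝ) (T : ℝ) :
    {N : ℕ} → (Fin (N + 1) → ℝ) → (E d → ℝ) → E d → ℝ
  | 0, _, v => v
  | _ + 1, τ, v => iterMin H T (Fin.tail τ) (minStep (classicalGenFun H T (τ 0) (τ 1)) v)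

lemma iterMin_succ {N : ℕ} (τ : Fin (N + 2) → ℝ) (v : E d → ℝ) :
    iterMin H T τ v =
      iterMin H T (Fin.tail τ) (minStep (classicalGenFun H T (τ 0) (τ 1)) v) := rfl

lemma iterMin_cons {N : ℕ} (s : ℝ) (τ : Fin (N + 1) → ℝ) (v : E d → ℝ) :
    iterMin H T (Fin.cons s τ : Fin (N + 2) → ℝ) v =
      iterMin H T τ (minStep (classicalGenFun H T s (τ 0)) v) := by
  have h0 : (Fin.cons s τ : Fin (N + 2) → ℝ) 0 = s := Fin.cons_zero _ _
  have h1 : (Fin.cons s τ : Fin (N + 2) → ℝ) 1 = τ 0 :=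
    Fin.cons_succ (α := fun _ => ℝ) s τ 0
  rw [iterMin_succ, Fin.tail_cons, h0, h1]

lemma nodes_cons_zero {N : ℕ} (x x₀ : E d) (q : Fin N → E d) :
    nodes x (Fin.cons x₀ q : Fin (N + 1) → E d) 0 = x₀ := by
  simp [nodes]

lemma nodes_cons_succ {N : ℕ} (x x₀ : E d) (q : Fin N → E d) (i : Fin (N + 1)) :
    nodes x (Fin.cons x₀ q : Fin (N + 1) → E d) i.succ = nodes x q i := by
  unfold nodes
  rw [← Fin.cons_snoc_eq_snoc_cons]
  simp

lemma nodes_cons_one {N : ℕ} (x x₀ : E d) (q : Fin N → E d) :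
    nodes x (Fin.cons x₀ q : Fin (N + 1) → E d) 1 = nodes x q 0 := nodes_cons_succ x x₀ q 0

/-- The function `w` is added and removed. With `w` the one-step minimum of `v`, the bracket is
nonnegative and vanishes for a minimising `x₀`, which reduces the minimum of the family to one step
fewer. -/
lemma minFamily_cons {N : ℕ} (τ : Fin (N + 2) → ℝ) (v w : E d → ℝ) (x x₀ : E d)
    (q : Fin N → E d) :
    minFamily H T τ v x (Fin.cons x₀ q : Fin (N + 1) → E d) =
      minFamily H T (Fin.tail τ) w x q +
        (v x₀ + classicalGenFun H T (τ 0) (τ 1) (nodes x q 0) x₀ - w (nodes x q 0)) := by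
  unfold minFamily
  rw [Fin.sum_univ_succ]
  simp only [Fin.castSucc_zero, nodes_cons_zero, nodes_cons_succ, Fin.castSucc_succ, Fin.tail,
    Fin.succ_zero_eq_one, nodes_cons_one]
  ring

namespace HamiltonianEstimates

lemma isLip_iterMin (hE : HamiltonianEstimates T c B H) {N : ℕ} {τ : Fin (N + 1) → ℝ}
    (hτ : HasShortSteps T c τ) {v : E d → ℝ} (hv : IsLip v) : IsLip (iterMin H T τ v) := by
  induction N generalizing v with
  | zero => exact hv
  | succ N ih => exact ih hτ.tail (hE.isLip_minStep hτ.head hv)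

lemma isLeast_iterMin (hE : HamiltonianEstimates T c B H) {N : ℕ} {τ : Fin (N + 1) → ℝ}
    (hτ : HasShortSteps T c τ) {v : E d → ℝ} (hv : IsLip v) (x : E d) :
    IsLeast (range (minFamily H T τ v x)) (iterMin H T τ v x) := by
  induction N generalizing v with
  | zero =>
    have h : ∀ q, minFamily H T τ v x q = v x := fun q => by simp [minFamily, nodes, Fin.snoc]
    exact ⟨⟨Fin.elim0, h _⟩, forall_mem_range.2 fun q => (h q).ge⟩
  | succ N ih =>
    have hw := hE.isLip_minStep hτ.head hv
    obtain ⟨⟨q, hq⟩, hlow⟩ := ih hτ.tail hw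
    constructor
    · obtain ⟨⟨x₀, hx₀⟩, -⟩ := hE.isLeast_minStep hτ.head hv (nodes x q 0)
      refine ⟨Fin.cons x₀ q, ?_⟩
      simp only at hx₀
      rw [minFamily_cons τ v (minStep (classicalGenFun H T (τ 0) (τ 1)) v), hx₀, sub_self,
        add_zero, hq]
      rfl
    · refine forall_mem_range.2 fun q => ?_
      rw [← Fin.cons_self_tail q,
        minFamily_cons τ v (minStep (classicalGenFun H T (τ 0) (τ 1)) v)]
      have h1 := (hE.isLeast_minStep hτ.head hv (nodes x (Fin.tail q) 0)).2 ⟨q 0, rfl⟩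
      have h2 := hlow ⟨Fin.tail q, rfl⟩
      simp only at h1
      rw [iterMin_succ]
      linarith

lemma iterMin_split (hE : HamiltonianEstimates T c B H) {N : ℕ} {τ : Fin (N + 2) → ℝ}
    (hτ : HasShortSteps T c τ) {v : E d → ℝ} (hv : IsLip v) {r : ℝ} (h0 : τ 0 < r)
    (h1 : r < τ 1) :
    HasShortSteps T c (Fin.cons r (Fin.tail τ) : Fin (N + 2) → ℝ) ∧
    iterMin H T (Fin.cons r (Fin.tail τ) : Fin (N + 2) → ℝ)
      (minStep (classicalGenFun H T (τ 0) r) v) = iterMin H T τ v := by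
  have hc := hE.c_nonneg
  have e : Fin.tail τ 0 = τ 1 := rfl
  have h2 : c * (τ 1 - r) ≤ c * (τ 1 - τ 0) := by gcongr
  refine ⟨hτ.tail.cons ?_, ?_⟩
  · rw [e]
    exact ⟨hτ.head.nonneg.trans h0.le, h1, hτ.head.le, h2.trans_lt hτ.head.small⟩
  · rw [iterMin_cons, e, hE.minStep_minStep hτ.head h0 h1 hv, iterMin_succ]

/-- The iterated minimum does not depend on the subdivision. -/
theorem iterMin_eq (hE : HamiltonianEstimates T c B H) {N M : ℕ} {τ : Fin (N + 1) → ℝ}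
    {σ : Fin (M + 1) → ℝ} (hτ : HasShortSteps T c τ) (hσ : HasShortSteps T c σ) (h0 : τ 0 = σ 0)
    (h1 : τ (Fin.last N) = σ (Fin.last M)) {v : E d → ℝ} (hv : IsLip v) :
    iterMin H T τ v = iterMin H T σ v := by
  obtain ⟨n, hn⟩ : ∃ n, N + M = n := ⟨_, rfl⟩
  induction n using Nat.strong_induction_on generalizing N M v with
  | _ n ih =>
    have hpos : ∀ {K : ℕ} {ρ : Fin (K + 2) → ℝ}, HasShortSteps T c ρ → ρ 0 < ρ (Fin.last _) :=
      fun hρ => hρ.strictMono (Fin.last_pos)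
    rcases N with _ | N
    · rcases M with _ | M
      · rfl
      · exact absurd (hpos hσ) (not_lt.2 (by rw [← h0, ← h1]; rfl))
    · rcases M with _ | M
      · exact absurd (hpos hτ) (not_lt.2 (by rw [h0, h1]; rfl))
      -- The longer of the two first steps is split at the end of the shorter, which leaves the
      -- iterated minimum unchanged. The common first step is then removed from both, and the total
      -- number of steps drops.
      · rcases lt_trichotomy (τ 1) (σ 1) with hlt | heq | hgt
        · have hσr : σ 0 < τ 1 := by rw [← h0]; exact hτ.head.lt
          obtain ⟨h2, h3⟩ := hE.iterMin_split hσ hv hσr hlt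
          rw [← h3, ← h0]
          refine ih (N + (M + 1)) (by omega) hτ.tail h2 rfl ?_ (hE.isLip_minStep hτ.head hv) rfl
          rw [← Fin.succ_last, Fin.cons_succ]
          exact h1
        · have := ih (N + M) (by omega) hτ.tail hσ.tail heq h1 (hE.isLip_minStep hτ.head hv) rfl
          rw [iterMin_succ, iterMin_succ, this, h0, heq]
        · have hτr : τ 0 < σ 1 := by rw [h0]; exact hσ.head.lt
          obtain ⟨h2, h3⟩ := hE.iterMin_split hτ hv hτr hgt
          rw [← h3, h0]
          refine ih (N + 1 + M) (by omega) h2 hσ.tail rfl ?_ (hE.isLip_minStep hσ.head hv) rfl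
          rw [← Fin.succ_last, Fin.cons_succ]
          exact h1

end HamiltonianEstimates

/-- Concatenation of subdivisions. -/
lemma exists_iterMin_comp {N M : ℕ} {τ : Fin (N + 1) → ℝ} {σ : Fin (M + 1) → ℝ}
    (hτ : HasShortSteps T c τ) (hσ : HasShortSteps T c σ) (h : τ (Fin.last N) = σ 0)
    (v : E d → ℝ) :
    ∃ (K : ℕ) (ρ : Fin (K + 1) → ℝ), HasShortSteps T c ρ ∧ ρ 0 = τ 0 ∧
      ρ (Fin.last K) = σ (Fin.last M) ∧ iterMin H T ρ v = iterMin H T σ (iterMin H T τ v) := by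
  induction N generalizing v with
  | zero => exact ⟨M, σ, hσ, h.symm, rfl, rfl⟩
  | succ N ih =>
    obtain ⟨K, ρ, h1, h2, h3, h4⟩ :=
      ih hτ.tail h (minStep (classicalGenFun H T (τ 0) (τ 1)) v)
    have h2' : ρ 0 = τ 1 := h2
    refine ⟨K + 1, Fin.cons (τ 0) ρ, h1.cons (h2' ▸ hτ.head), rfl, ?_, ?_⟩
    · rw [← Fin.succ_last, Fin.cons_succ, h3]
    · rw [iterMin_cons, h2', h4, iterMin_succ]

lemma exists_hasShortSteps (hc : 0 ≤ c) {s t : ℝ} (hs : 0 ≤ s) (hst : s ≤ t) (ht : t ≤ T) :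
    ∃ (N : ℕ) (τ : Fin (N + 1) → ℝ), HasShortSteps T c τ ∧ τ 0 = s ∧ τ (Fin.last N) = t := by
  have hlog := Real.log_pos one_lt_two
  -- Dividing by c + 1 rather than c allows c = 0.
  obtain ⟨δ, hδ, hcδ⟩ : ∃ δ > 0, c * δ < Real.log 2 :=
    ⟨Real.log 2 / (c + 1), by positivity, by
      rw [mul_div_assoc', div_lt_iff₀ (by positivity)]
      nlinarith⟩
  obtain ⟨n, hn⟩ := exists_nat_ge ((t - s) / δ)
  rw [div_le_iff₀ hδ] at hn
  induction n generalizing s with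
  | zero =>
    have : s = t := by simp only [Nat.cast_zero, zero_mul] at hn; linarith
    exact ⟨0, fun _ => s, fun i => i.elim0, rfl, this⟩
  | succ n ih =>
    rcases hst.eq_or_lt with rfl | hlt
    · exact ⟨0, fun _ => s, fun i => i.elim0, rfl, rfl⟩
    · have hr : s < min (s + δ) t := lt_min (by linarith) hlt
      obtain ⟨N, τ, h1, h2, h3⟩ := ih (s := min (s + δ) t) (hs.trans hr.le) (min_le_right _ _) (by
        rcases min_cases (s + δ) t with ⟨h, -⟩ | ⟨h, -⟩
        · rw [h]
          push_cast at hn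
          linarith
        · rw [h, sub_self]
          positivity)
      refine ⟨N + 1, Fin.cons s τ, h1.cons ?_, rfl, ?_⟩
      · rw [h2]
        refine ⟨hs, hr, (min_le_right _ _).trans ht, lt_of_le_of_lt ?_ hcδ⟩
        refine mul_le_mul_of_nonneg_left ?_ hc
        linarith [min_le_left (s + δ) t]
      · rw [← Fin.succ_last, Fin.cons_succ, h3]

lemma IsAdmissible.hasShortSteps {s t : ℝ} {N : ℕ} {τ : Fin (N + 1) → ℝ}
    (h : IsAdmissible H T s t τ) (hs : 0 ≤ s) (ht : t ≤ T) : HasShortSteps T (cH H T) τ := by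
  obtain ⟨⟨h1, h2, h3⟩, h4⟩ := h
  refine fun i => ⟨?_, h1 i.castSucc_lt_succ, ?_, h4 i⟩
  · exact (hs.trans h2.ge).trans (h1.monotone (Fin.zero_le _))
  · exact (h1.monotone (Fin.le_last _)).trans (h3.le.trans ht)

lemma HasShortSteps.isAdmissible {s t : ℝ} {N : ℕ} {τ : Fin (N + 1) → ℝ}
    (h : HasShortSteps T (cH H T) τ) (h0 : τ 0 = s) (h1 : τ (Fin.last N) = t) :
    IsAdmissible H T s t τ := ⟨⟨h.strictMono, h0, h1⟩, fun i => (h i).small⟩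

end Subdivisions

end HJ
end

/-! ### Signature of the quadratic part, and uniqueness of the minmax -/

noncomputable section

namespace HJ

section QuadraticPart

/-- A negative definite and a positive definite subspace of half the dimension leave no room for the
radical. -/
lemma sigNeg_eq_and_separatingLeft {V W : Type*} [AddCommGroup V] [Module ℝ V]
    [FiniteDimensional ℝ V] [AddCommGroup W] [Module ℝ W] [FiniteDimensional ℝ W]
    {Q : QuadraticForm ℝ V} {j j' : W →ₗ[ℝ] V} (hj : ∀ w, w ≠ 0 → Q (j w) < 0)
    (hj' : ∀ w, w ≠ 0 → 0 < Q (j' w)) (hV : Module.finrank ℝ V = 2 * Module.finrank ℝ W) :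
    sigNeg Q = Module.finrank ℝ W ∧
      (QuadraticMap.associated (R := ℝ) Q).SeparatingLeft := by
  have hinj : Function.Injective j := (injective_iff_map_eq_zero j).2 fun w hw => by
    by_contra h
    have := hj w h
    rw [hw, map_zero] at this
    exact lt_irrefl _ this
  have hinj' : Function.Injective j' := (injective_iff_map_eq_zero j').2 fun w hw => by
    by_contra h
    have := hj' w h
    rw [hw, map_zero] at this
    exact lt_irrefl _ this
  have h1 : Module.finrank ℝ W ≤ sigNeg Q := by
    rw [← LinearMap.finrank_range_of_inj hinj]
    refine le_sigNeg_of_negDef Q ?_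
    rintro ⟨_, w, rfl⟩ hw
    have : w ≠ 0 := by
      rintro rfl
      exact hw (Subtype.ext (map_zero j))
    simpa using hj w this
  have h2 : Module.finrank ℝ W ≤ sigPos Q := by
    rw [← LinearMap.finrank_range_of_inj hinj']
    refine le_sigPos_of_posDef Q ?_
    rintro ⟨_, w, rfl⟩ hw
    have : w ≠ 0 := by
      rintro rfl
      exact hw (Subtype.ext (map_zero j'))
    simpa using hj' w this
  have h3 := QuadraticForm.sigPos_add_sigNeg_add_radical (Q := Q)
  refine ⟨by omega, ?_⟩
  have h4 : Module.finrank ℝ Q.radical = 0 := by omega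
  rw [LinearMap.separatingLeft_iff_ker_eq_bot, ← QuadraticMap.radical_eq_ker_associated]
  exact Submodule.finrank_eq_zero.1 h4

variable {d N : ℕ}

/-- The points `x₀, …, x_{N-1}, 0` as linear maps. -/
def nodeLin (j : Fin (N + 1)) : (Fin N → E d) →ₗ[ℝ] E d :=
  Fin.lastCases (motive := fun _ => (Fin N → E d) →ₗ[ℝ] E d) 0 (fun i => LinearMap.proj i) j

lemma nodes_eq (x : E d) (q : Fin N → E d) (j : Fin (N + 1)) :
    nodes x q j = nodeLin j q + nodes x 0 j := by
  refine Fin.lastCases ?_ (fun i => ?_) j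
  · simp [nodes, nodeLin]
  · simp [nodes, nodeLin]

lemma nodeLin_castSucc (i : Fin N) (q : Fin N → E d) : nodeLin i.castSucc q = q i := by
  simp [nodeLin]

lemma nodeLin_last (q : Fin N → E d) : nodeLin (Fin.last N) q = 0 := by
  simp [nodeLin]

/-- The quadratic part `∑ -h_i|y_i|² + (x_{i+1} - x_i)·y_i` (with `x_N = 0`) of the generating
family. -/
def quadraticPart (h : Fin N → ℝ) : QuadraticForm ℝ (Fin N → E d × E d) :=
  ∑ i, (LinearMap.BilinMap.toQuadraticMap
    ((-h i) • (innerₗ (E d)).compl₁₂ ((LinearMap.snd ℝ (E d) (E d)).comp (LinearMap.proj i))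
      ((LinearMap.snd ℝ (E d) (E d)).comp (LinearMap.proj i)) +
    (innerₗ (E d)).compl₁₂ ((nodeLin i.succ - nodeLin i.castSucc).comp
      (LinearMap.compLeft (LinearMap.fst ℝ (E d) (E d)) (Fin N)))
      ((LinearMap.snd ℝ (E d) (E d)).comp (LinearMap.proj i))))

lemma quadraticPart_apply (h : Fin N → ℝ) (η : Fin N → E d × E d) :
    quadraticPart h η = ∑ i, (-h i * ‖(η i).2‖ ^ 2 +
      inner ℝ (nodeLin i.succ (fun i => (η i).1) - nodeLin i.castSucc fun i => (η i).1)
        (η i).2) := by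
  rw [quadraticPart, sum_apply]
  refine Finset.sum_congr rfl fun i _ => ?_
  rw [LinearMap.BilinMap.toQuadraticMap_apply, ← real_inner_self_eq_norm_sq]
  rfl

/-- The form is negative definite on x = 0, and positive definite on the graph y_i = (x_{i+1} -
x_i)/(2h_i), where it equals ∑ |x_{i+1} - x_i|²/(4h_i); there x_N = 0 forces all x_i to vanish with
the differences. -/
lemma quadraticPart_signature {h : Fin N → ℝ} (hpos : ∀ i, 0 < h i) :
    sigNeg (quadraticPart (d := d) h) = Module.finrank ℝ (Fin N → E d) ∧
      (QuadraticMap.associated (R := ℝ) (quadraticPart (d := d) h)).SeparatingLeft := by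
  let j : (Fin N → E d) →ₗ[ℝ] (Fin N → E d × E d) :=
    LinearMap.pi fun i => (LinearMap.inr ℝ (E d) (E d)).comp (LinearMap.proj i)
  let j' : (Fin N → E d) →ₗ[ℝ] (Fin N → E d × E d) :=
    LinearMap.pi fun i => (LinearMap.proj i).prod
      ((2 * h i)⁻¹ • (nodeLin i.succ - nodeLin i.castSucc))
  have hj1 : ∀ w i, (j w i).1 = 0 := fun _ _ => rfl
  have hj2 : ∀ w i, (j w i).2 = w i := fun _ _ => rfl
  have hj1' : ∀ w i, (j' w i).1 = w i := fun _ _ => rfl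
  have hj2' : ∀ w i, (j' w i).2 = (2 * h i)⁻¹ • (nodeLin i.succ w - nodeLin i.castSucc w) :=
    fun _ _ => rfl
  refine sigNeg_eq_and_separatingLeft (j := j) (j' := j') (fun w hw => ?_) (fun w hw => ?_) ?_
  · rw [quadraticPart_apply]
    simp only [hj1, hj2]
    have e : (fun _ => 0 : Fin N → E d) = 0 := rfl
    simp only [e, map_zero, sub_zero, inner_zero_left, add_zero]
    obtain ⟨i, hi⟩ := Function.ne_iff.1 hw
    refine Finset.sum_neg' (fun i _ => ?_) ⟨i, Finset.mem_univ _, ?_⟩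
    · have := hpos i
      have : 0 ≤ h i * ‖w i‖ ^ 2 := by positivity
      linarith
    · have : 0 < h i * ‖w i‖ ^ 2 := mul_pos (hpos i) (pow_pos (norm_pos_iff.2 hi) 2)
      linarith
  · rw [quadraticPart_apply]
    simp only [hj1', hj2']
    have e : ∀ i, -h i * ‖(2 * h i)⁻¹ • (nodeLin i.succ w - nodeLin i.castSucc w)‖ ^ 2 +
        inner ℝ (nodeLin i.succ w - nodeLin i.castSucc w)
          ((2 * h i)⁻¹ • (nodeLin i.succ w - nodeLin i.castSucc w)) =
        (4 * h i)⁻¹ * ‖nodeLin i.succ w - nodeLin i.castSucc w‖ ^ 2 := by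
      intro i
      have := hpos i
      rw [norm_smul, inner_smul_right, real_inner_self_eq_norm_sq,
        Real.norm_of_nonneg (by positivity)]
      field_simp
      ring
    simp only [e]
    obtain ⟨i, hi⟩ : ∃ i : Fin N, nodeLin i.succ w - nodeLin i.castSucc w ≠ 0 := by
      by_contra! hall
      refine hw ?_
      have hz : ∀ j : Fin (N + 1), nodeLin j w = 0 := by
        intro j
        refine Fin.reverseInduction (nodeLin_last w) (fun i hi => ?_) j
        have := hall i
        rwa [hi, zero_sub, neg_eq_zero] at this
      ext1 i
      have := hz i.castSucc
      rwa [nodeLin_castSucc] at this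
    refine Finset.sum_pos' (fun i _ => ?_) ⟨i, Finset.mem_univ _, ?_⟩
    · have := hpos i
      positivity
    · have := hpos i
      have := norm_pos_iff.2 hi
      positivity
  · simp only [Module.finrank_pi_fintype, Module.finrank_prod, finrank_euclideanSpace,
      Fintype.card_fin, Finset.sum_const, Finset.card_univ, smul_eq_mul]
    ring

/-- Real functions that are globally Lipschitz. -/
def IsGloballyLipschitz {V : Type*} [NormedAddCommGroup V] (f : V → ℝ) : Prop :=
  ∃ C : ℝ≥0, LipschitzWith C f

namespace IsGloballyLipschitz

variable {V : Type*} [NormedAddCommGroup V]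

lemma add {f g : V → ℝ} (hf : IsGloballyLipschitz f) (hg : IsGloballyLipschitz g) :
    IsGloballyLipschitz fun v => f v + g v :=
  hf.elim fun _ hf => hg.elim fun _ hg => ⟨_, hf.add hg⟩

lemma sum {ι : Type*} {s : Finset ι} {f : ι → V → ℝ} (hf : ∀ i ∈ s, IsGloballyLipschitz (f i)) :
    IsGloballyLipschitz fun v => ∑ i ∈ s, f i v := by
  classical
  induction s using Finset.induction_on with
  | empty => exact ⟨0, by simp⟩
  | insert i s hi ih =>
    simp only [Finset.sum_insert hi]
    exact (hf i (Finset.mem_insert_self i s)).add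
      (ih fun j hj => hf j (Finset.mem_insert_of_mem hj))

lemma comp {W : Type*} [NormedAddCommGroup W] {f : W → ℝ} (hf : IsGloballyLipschitz f) {g : V → W}
    (hg : ∃ C : ℝ≥0, LipschitzWith C g) : IsGloballyLipschitz fun v => f (g v) :=
  hf.elim fun _ hf => hg.elim fun _ hg => ⟨_, hf.comp hg⟩

end IsGloballyLipschitz

/-- Two admissible quadratic parts differ by a Lipschitz quadratic form, which grows at most
linearly along rays and so vanishes. The index is then the same, and greatest lower bounds are
unique. -/
lemma isMinmax_unique {V : Type*} [NormedAddCommGroup V] [NormedSpace ℝ V] {f : V → ℝ} {a b : ℝ}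
    (ha : IsMinmax f a) (hb : IsMinmax f b) : a = b := by
  obtain ⟨Q, ⟨-, C, hC⟩, hQ⟩ := ha
  obtain ⟨Q', ⟨-, C', hC'⟩, hQ'⟩ := hb
  have heq : Q = Q' := by
    ext z
    by_contra hne
    have h1 : ∀ r : ℝ, 0 < r → r * |Q' z - Q z| ≤ (C + C') * ‖z‖ := by
      intro r hr
      have h2 := (hC.sub hC').dist_le_mul (r • z) 0
      rw [Real.dist_eq, dist_zero_right, norm_smul, Real.norm_of_nonneg hr.le] at h2
      simp only [map_zero, QuadraticMap.map_smul, smul_eq_mul, NNReal.coe_add] at h2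
      have e : f (r • z) - r * r * Q z - (f (r • z) - r * r * Q' z) - (f 0 - 0 - (f 0 - 0)) =
          r * (r * (Q' z - Q z)) := by ring
      rw [e, abs_mul, abs_mul, abs_of_pos hr] at h2
      have h3 : r * (r * |Q' z - Q z|) ≤ r * ((C + C') * ‖z‖) := by linarith
      exact le_of_mul_le_mul_left h3 hr
    have hpos : 0 < |Q' z - Q z| := abs_pos.2 (sub_ne_zero.2 (Ne.symm hne))
    have h4 := h1 (((C + C') * ‖z‖ + 1) / |Q' z - Q z|) (by positivity)
    rw [div_mul_cancel₀ _ hpos.ne'] at h4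
    linarith
  subst heq
  obtain ⟨r, h1, h2⟩ := (hQ.and hQ').exists
  exact h1.unique h2

end QuadraticPart

/-! ### The minmax of the generating family is the iterated minimum -/

section GenFamily

variable {d : ℕ} {T c B : ℝ} {H : ℝ → E d → E d → ℝ} {N : ℕ}

/-- The splitting of the variables `(x_i, y_i)` of the generating family. -/
def splitEquiv (d N : ℕ) : (Fin N → E d × E d) ≃L[ℝ] (Fin N → E d) × (Fin N → E d) :=
  LinearEquiv.toContinuousLinearEquiv
    { toFun := fun η => (fun i => (η i).1, fun i => (η i).2)
      invFun := fun w i => (w.1 i, w.2 i)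
      left_inv := fun _ => rfl
      right_inv := fun _ => rfl
      map_add' := fun _ _ => rfl
      map_smul' := fun _ _ => rfl }

lemma splitEquiv_symm_apply (w : (Fin N → E d) × (Fin N → E d)) :
    (splitEquiv d N).symm w = fun i => (w.1 i, w.2 i) := rfl

lemma continuous_nodes (x : E d) (j : Fin (N + 1)) :
    Continuous fun p : Fin N → E d => nodes x p j :=
  ((nodeLin j).continuous_of_finiteDimensional.add continuous_const).congr
    fun p => (nodes_eq x p j).symm

lemma lipschitzWith_nodes (x : E d) (j : Fin (N + 1)) :
    ∃ C : ℝ≥0, LipschitzWith C fun η : Fin N → E d × E d => nodes x (fun i => (η i).1) j := by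
  refine Fin.lastCases ?_ (fun i => ?_) j
  · exact ⟨0, by simp [nodes]⟩
  · refine ⟨1, LipschitzWith.of_dist_le_mul fun η η' => ?_⟩
    simp only [nodes, Fin.snoc_castSucc, NNReal.coe_one, one_mul]
    exact (le_max_left _ _).trans (dist_le_pi_dist η η' i)

namespace HamiltonianEstimates

/-- The generating family is quadratic at infinity. -/
theorem isQuadraticAtInfinity_genFamily (hE : HamiltonianEstimates T c B H)
    {τ : Fin (N + 1) → ℝ} (hτ : HasShortSteps T c τ) {v : E d → ℝ} (hv : IsLip v) (x : E d) :
    IsQuadraticAtInfinity (genFamily H T τ v x)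
      (quadraticPart fun i => τ i.succ - τ i.castSucc) := by
  refine ⟨(quadraticPart_signature fun i => sub_pos.2 (hτ i).lt).2, ?_⟩
  have h1 : IsGloballyLipschitz fun η : Fin N → E d × E d => v (nodes x (fun i => (η i).1) 0) :=
    IsGloballyLipschitz.comp hv (lipschitzWith_nodes x 0)
  have h2 : ∀ i : Fin N, IsGloballyLipschitz fun η : Fin N → E d × E d =>
      genFun H T (τ i.castSucc) (τ i.succ) (nodes x (fun i => (η i).1) i.succ) (η i).2 +
        (τ i.succ - τ i.castSucc) * ‖(η i).2‖ ^ 2 := by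
    intro i
    obtain ⟨κ, C, hΦ⟩ := hE.exists_isTwistMap (hτ i)
    obtain ⟨L, hL⟩ := hΦ.lipschitzWith_mixedGenFun_add
    simp only [hE.genFun_eq (hτ i)]
    obtain ⟨C₁, hC₁⟩ := lipschitzWith_nodes (d := d) x i.succ
    exact IsGloballyLipschitz.comp (f := fun w : E d × E d => mixedGenFun _ _ w.1 w.2 +
      (τ i.succ - τ i.castSucc) * ‖w.2‖ ^ 2) ⟨L, hL⟩
      (g := fun η : Fin N → E d × E d => (nodes x (fun i => (η i).1) i.succ, (η i).2))
      ⟨_, hC₁.prodMk (LipschitzWith.prod_snd.comp (LipschitzWith.eval i))⟩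
  -- The last node is x and not 0, which adds to the quadratic part a term linear in the y_i.
  have h3 : ∀ i : Fin N, IsGloballyLipschitz fun η : Fin N → E d × E d =>
      inner ℝ (nodes x 0 i.succ - nodes x 0 i.castSucc) (η i).2 := fun i =>
    IsGloballyLipschitz.comp (f := fun y => inner ℝ (nodes x 0 i.succ - nodes x 0 i.castSucc) y)
      ⟨_, (innerSL ℝ (nodes x 0 i.succ - nodes x 0 i.castSucc)).lipschitz⟩
      (g := fun η : Fin N → E d × E d => (η i).2)
      ⟨_, LipschitzWith.prod_snd.comp (LipschitzWith.eval i)⟩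
  obtain ⟨C, hC⟩ := (h1.add (IsGloballyLipschitz.sum (s := Finset.univ) fun i _ => h2 i)).add
    (IsGloballyLipschitz.sum (s := Finset.univ) fun i _ => h3 i)
  refine ⟨C, ?_⟩
  convert hC using 2 with η
  rw [quadraticPart_apply, genFamily]
  simp only [Finset.sum_add_distrib, neg_mul, Finset.sum_neg_distrib]
  have e : ∀ i : Fin N, inner ℝ (nodes x (fun i => (η i).1) i.succ -
      nodes x (fun i => (η i).1) i.castSucc) (η i).2 =
      inner ℝ (nodeLin i.succ (fun i => (η i).1) - nodeLin i.castSucc fun i => (η i).1) (η i).2 +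
        inner ℝ (nodes x 0 i.succ - nodes x 0 i.castSucc) (η i).2 := by
    intro i
    rw [nodes_eq x _ i.succ, nodes_eq x _ i.castSucc, ← inner_add_left]
    congr 1
    abel
  simp only [e, Finset.sum_add_distrib]
  ring

lemma continuous_genFamily (hE : HamiltonianEstimates T c B H)
    {τ : Fin (N + 1) → ℝ} (hτ : HasShortSteps T c τ) {v : E d → ℝ} (hv : IsLip v) (x : E d) :
    Continuous (genFamily H T τ v x) := by
  obtain ⟨L, hL⟩ := (hE.isQuadraticAtInfinity_genFamily hτ hv x).2
  have hQc : Continuous fun η : Fin N → E d × E d =>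
      quadraticPart (fun i => τ i.succ - τ i.castSucc) η := by
    simp only [quadraticPart_apply]
    have hn : ∀ j : Fin (N + 1), Continuous fun η : Fin N → E d × E d =>
        nodeLin j (fun i => (η i).1) := fun j =>
      (nodeLin j).continuous_of_finiteDimensional.comp (by fun_prop)
    refine continuous_finsetSum _ fun i _ => Continuous.add (by fun_prop) ?_
    exact ((hn _).sub (hn _)).inner (by fun_prop)
  have h1 := hL.continuous.add hQc
  exact h1.congr fun η => sub_add_cancel _ _

/-- The minmax of the generating family. -/
theorem isMinmax_genFamily (hE : HamiltonianEstimates T c B H)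
    {τ : Fin (N + 1) → ℝ} (hτ : HasShortSteps T c τ) {v : E d → ℝ} (hv : IsLip v) (x : E d) :
    IsMinmax (genFamily H T τ v x) (iterMin H T τ v x) := by
  have hQ := hE.isQuadraticAtInfinity_genFamily hτ hv x
  refine ⟨_, hQ, ?_⟩
  choose κ C hΦ using fun i : Fin N => hE.exists_isTwistMap (hτ i)
  have hcont := hE.continuous_genFamily hτ hv x
  -- For fixed points x_i the family separates into functions of the single y_i, each maximal at the
  -- momentum of the orbit from x_i to x_{i+1}.
  set m : (Fin N → E d) → (Fin N → E d) := fun p i =>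
    momentum (flow H T (τ i.castSucc) (τ i.succ)) (nodes x p i.succ) (nodes x p i.castSucc) with hm
  have hmc : Continuous m := continuous_pi fun i =>
    (hΦ i).continuous_momentum.comp ((continuous_nodes x _).prodMk (continuous_nodes x _))
  set g : (Fin N → E d) → (Fin N → E d) → Fin N → ℝ → ℝ := fun p w i r =>
    mixedGenFun (flow H T (τ i.castSucc) (τ i.succ)) (action H T (τ i.castSucc) (τ i.succ))
      (nodes x p i.succ) (m p i + r • w i) +
      inner ℝ (nodes x p i.succ - nodes x p i.castSucc) (m p i + r • w i) with hg
  have hval : ∀ p w (r : ℝ), genFamily H T τ v x ((splitEquiv d N).symm (p, m p + r • w)) =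
      v (nodes x p 0) + ∑ i, g p w i r := by
    intro p w r
    rw [splitEquiv_symm_apply, genFamily]
    simp only [hg, Finset.sum_add_distrib, Pi.add_apply, Pi.smul_apply, ← add_assoc]
    congr 2
    exact Finset.sum_congr rfl fun i _ => hE.genFun_eq (hτ i) _ _
  have hganti : ∀ p w i, AntitoneOn (g p w i) (Ici 0) := fun p w i =>
    (hΦ i).antitoneOn_mixedGenFun _ _ _
  have hmin : ∀ p, genFamily H T τ v x ((splitEquiv d N).symm (p, m p)) =
      minFamily H T τ v x p := by
    intro p
    have h1 := hval p 0 0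
    rw [smul_zero, add_zero] at h1
    rw [h1, minFamily]
    congr 1
    refine Finset.sum_congr rfl fun i _ => ?_
    simp only [hg, zero_smul, add_zero]
    exact (hΦ i).mixedGenFun_momentum _ _
  obtain ⟨⟨p₀, hp₀⟩, hlow⟩ := hE.isLeast_iterMin hτ hv x
  have key := isGLB_descendingCycles hcont (splitEquiv d N) hmc (fun p w => ?_) (fun p w hw => ?_)
    (p₀ := p₀) (fun p => ?_) (quadraticPart_signature fun i => sub_pos.2 (hτ i).lt).1.symm
  · rwa [hmin, hp₀] at key
  · simp only [hval]
    intro a ha b hb hab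
    have := Finset.sum_le_sum fun i (_ : i ∈ Finset.univ) => hganti p w i ha hb hab
    simp only
    linarith
  · simp only [hval]
    obtain ⟨j, hj⟩ := Function.ne_iff.1 hw
    have h1 : Tendsto (fun r => v (nodes x p 0) + ∑ i ∈ Finset.univ.erase j, g p w i 0 + g p w j r)
        atTop atBot :=
      tendsto_atBot_add_const_left _ _ ((hΦ j).tendsto_mixedGenFun_ray _ _ _ hj)
    refine tendsto_atBot_mono' _ ?_ h1
    filter_upwards [eventually_ge_atTop 0] with r hr
    rw [← Finset.sum_erase_add _ _ (Finset.mem_univ j), ← add_assoc]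
    have := Finset.sum_le_sum fun i (_ : i ∈ Finset.univ.erase j) =>
      hganti p w i (mem_Ici.2 le_rfl) (mem_Ici.2 hr) hr
    linarith
  · rw [hmin, hmin, hp₀]
    exact hlow ⟨p, rfl⟩

end HamiltonianEstimates

end GenFamily

end HJ
end

noncomputable section

namespace HJ

section Clarke

/-! ### The Clarke derivative of the family of actions -/

variable {V W : Type*} [NormedAddCommGroup V] [NormedSpace ℝ V] [NormedAddCommGroup W]
  [NormedSpace ℝ W]

/-- The Clarke derivative of `v ∘ π + G` for a split surjection `π` and a function `G` of class
`C¹`. -/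
theorem clarke_comp_add {v : V → ℝ} {G : W → ℝ} (hG : ContDiff ℝ 1 G) {π : W →L[ℝ] V}
    {ι : V →L[ℝ] W} (hπ : π.comp ι = ContinuousLinearMap.id ℝ V) (a : W) :
    clarke (fun w => v (π w) + G w) a =
      (fun l : V →L[ℝ] ℝ => l.comp π + fderiv ℝ G a) '' clarke v (π a) := by
  have hπ' : ∀ z, π (ι z) = z := fun z => by
    have := congrArg (fun l : V →L[ℝ] V => l z) hπ
    simpa using this
  have hGd : Differentiable ℝ G := hG.differentiable one_ne_zero
  have hGc : Continuous (fderiv ℝ G) := hG.continuous_fderiv one_ne_zero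
  -- After removing the smooth part, restriction to the affine section of π through `u` recovers v.
  have hdiff : ∀ u, DifferentiableAt ℝ (fun w => v (π w) + G w) u →
      DifferentiableAt ℝ v (π u) := by
    intro u hu
    have h1 : DifferentiableAt ℝ (fun w => v (π w)) u :=
      (hu.sub (hGd u)).congr_of_eventuallyEq (Eventually.of_forall fun w => by simp)
    have h2 : DifferentiableAt ℝ (fun z : V => u + ι (z - π u)) (π u) := by fun_prop
    have e : u + ι (π u - π u) = u := by simp
    have h3 : DifferentiableAt ℝ (fun z : V => v (π (u + ι (z - π u)))) (π u) :=
      DifferentiableAt.comp (g := fun w => v (π w)) (π u) (by rwa [e]) h2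
    refine h3.congr_of_eventuallyEq (Eventually.of_forall fun z => ?_)
    simp [hπ']
  have hfd : ∀ u, DifferentiableAt ℝ v (π u) →
      HasFDerivAt (fun w => v (π w) + G w) ((fderiv ℝ v (π u)).comp π + fderiv ℝ G u) u :=
    fun u hu => (hu.hasFDerivAt.comp u π.hasFDerivAt).add (hGd u).hasFDerivAt
  let L : (V →L[ℝ] ℝ) →ₗ[ℝ] (W →L[ℝ] ℝ) :=
    { toFun := fun l => l.comp π
      map_add' := fun _ _ => rfl
      map_smul' := fun _ _ => rfl }
  let F : (V →L[ℝ] ℝ) →ᵃ[ℝ] (W →L[ℝ] ℝ) := L.toAffineMap + AffineMap.const ℝ _ (fderiv ℝ G a)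
  have hF : (fun l : V →L[ℝ] ℝ => l.comp π + fderiv ℝ G a) = F := rfl
  rw [hF, clarke, clarke, AffineMap.image_convexHull]
  congr 1
  ext l
  constructor
  · rintro ⟨u, hu, hua, hul⟩
    -- Convergence of the pulled-back differentials gives that of the differentials of v by
    -- composition with ι. Conversely a sequence for v is lifted along the section through `a`.
    have h1 : Tendsto (fun n => (fderiv ℝ v (π (u n))).comp π) atTop (𝓝 (l - fderiv ℝ G a)) := by
      have h2 := hul.sub ((hGc.tendsto a).comp hua)
      refine h2.congr fun n => ?_
      rw [(hfd (u n) (hdiff _ (hu n))).fderiv]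
      simp
    have h3 : Tendsto (fun n => fderiv ℝ v (π (u n))) atTop
        (𝓝 ((l - fderiv ℝ G a).comp ι)) := by
      have h4 : Continuous fun l : W →L[ℝ] ℝ => l.comp ι := continuous_id.clm_comp continuous_const
      refine ((h4.tendsto _).comp h1).congr fun n => ?_
      simp only [Function.comp_apply]
      rw [ContinuousLinearMap.comp_assoc, hπ, ContinuousLinearMap.comp_id]
    have h5 : Tendsto (fun n => (fderiv ℝ v (π (u n))).comp π) atTop
        (𝓝 (((l - fderiv ℝ G a).comp ι).comp π)) := by
      have h4 : Continuous fun l : V →L[ℝ] ℝ => l.comp π := continuous_id.clm_comp continuous_const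
      exact (h4.tendsto _).comp h3
    refine ⟨(l - fderiv ℝ G a).comp ι, ⟨fun n => π (u n), fun n => hdiff _ (hu n),
      (π.continuous.tendsto a).comp hua, h3⟩, ?_⟩
    change ((l - fderiv ℝ G a).comp ι).comp π + fderiv ℝ G a = l
    rw [tendsto_nhds_unique h5 h1, sub_add_cancel]
  · rintro ⟨l, ⟨x, hx, hxa, hxl⟩, rfl⟩
    have hux : ∀ n, π (a + ι (x n - π a)) = x n := fun n => by simp [hπ']
    have hua : Tendsto (fun n => a + ι (x n - π a)) atTop (𝓝 a) := by
      have h1 : Continuous fun z => a + ι (z - π a) := by fun_prop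
      have := (h1.tendsto (π a)).comp hxa
      simpa [Function.comp_def] using this
    have hd : ∀ n, DifferentiableAt ℝ v (π (a + ι (x n - π a))) := fun n => by
      rw [hux]; exact hx n
    refine ⟨fun n => a + ι (x n - π a), fun n => (hfd _ (hd n)).differentiableAt, hua, ?_⟩
    change Tendsto _ _ (𝓝 (l.comp π + fderiv ℝ G a))
    have h4 : Continuous fun l : V →L[ℝ] ℝ => l.comp π := continuous_id.clm_comp continuous_const
    refine (((h4.tendsto _).comp hxl).add ((hGc.tendsto a).comp hua)).congr fun n => ?_
    rw [(hfd _ (hd n)).fderiv, hux]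
    rfl

end Clarke

/-! ### Critical points of the sum of actions are orbits -/

section GeneratingFamily

variable {d : ℕ} {T c B : ℝ} {H : ℝ → E d → E d → ℝ} {N : ℕ}

/-- The differential `∑ Y_i·θ_{i+1} - y_i·θ_i` of the sum of the actions. -/
def actionDeriv (H : ℝ → E d → E d → ℝ) (T : ℝ) (τ : Fin (N + 1) → ℝ) (X θ : Fin (N + 1) → E d) :
    ℝ :=
  ∑ i : Fin N,
    (inner ℝ (flow H T (τ i.castSucc) (τ i.succ) (X i.castSucc,
      momentum (flow H T (τ i.castSucc) (τ i.succ)) (X i.succ) (X i.castSucc))).2 (θ i.succ) -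
    inner ℝ (momentum (flow H T (τ i.castSucc) (τ i.succ)) (X i.succ) (X i.castSucc))
      (θ i.castSucc))

lemma actionDeriv_succ (τ : Fin (N + 2) → ℝ) (X θ : Fin (N + 2) → E d) :
    actionDeriv H T τ X θ =
      inner ℝ (flow H T (τ 0) (τ 1) (X 0, momentum (flow H T (τ 0) (τ 1)) (X 1) (X 0))).2 (θ 1) -
      inner ℝ (momentum (flow H T (τ 0) (τ 1)) (X 1) (X 0)) (θ 0) +
      actionDeriv H T (Fin.tail τ) (Fin.tail X) (Fin.tail θ) := by
  rw [actionDeriv, Fin.sum_univ_succ]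
  rfl

namespace HamiltonianEstimates

/-- The critical points of the sum of the actions are the orbits of the flow. -/
lemma flow_eq_of_actionDeriv (hE : HamiltonianEstimates T c B H) {τ : Fin (N + 1) → ℝ}
    (hτ : HasShortSteps T c τ) (hτ0 : τ 0 ∈ Icc 0 T) {X : Fin (N + 1) → E d} {p y : E d}
    (h : ∀ θ : Fin (N + 1) → E d,
      inner ℝ p (θ 0) + actionDeriv H T τ X θ = inner ℝ y (θ (Fin.last N))) :
    flow H T (τ 0) (τ (Fin.last N)) (X 0, p) = (X (Fin.last N), y) := by
  induction N generalizing p with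
  | zero =>
    have h1 := h fun _ => p - y
    simp only [actionDeriv, Finset.univ_eq_empty, Finset.sum_empty, add_zero] at h1
    rw [← sub_eq_zero, ← inner_sub_left, inner_self_eq_zero, sub_eq_zero] at h1
    rw [show Fin.last 0 = 0 from rfl, hE.flow_self hτ0, h1]
  | succ N ih =>
    obtain ⟨κ, C, hΦ⟩ := hE.exists_isTwistMap hτ.head
    set y₀ := momentum (flow H T (τ 0) (τ 1)) (X 1) (X 0) with hy₀
    -- Varying only the first node tests the matching of `p` with the initial momentum of the first
    -- piece; the variations that fix it give the hypothesis for the remaining nodes.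
    have hp : p = y₀ := by
      have h1 := h (Fin.cons (p - y₀) 0)
      rw [actionDeriv_succ, Fin.tail_cons] at h1
      have h2 : actionDeriv H T (Fin.tail τ) (Fin.tail X) 0 = 0 := by simp [actionDeriv]
      have h3 : (Fin.cons (p - y₀) 0 : Fin (N + 2) → E d) 1 = 0 :=
        Fin.cons_succ (α := fun _ => E d) (p - y₀) 0 0
      have h4 : (Fin.cons (p - y₀) 0 : Fin (N + 2) → E d) (Fin.last (N + 1)) = 0 :=
        Fin.cons_succ (α := fun _ => E d) (p - y₀) 0 (Fin.last N)
      rw [h2, h3, h4, Fin.cons_zero, inner_zero_right, inner_zero_right, add_zero, zero_sub,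
        ← sub_eq_add_neg, ← inner_sub_left, inner_self_eq_zero, sub_eq_zero] at h1
      exact h1
    have h5 : flow H T (τ 0) (τ 1) (X 0, p) =
        (X 1, (flow H T (τ 0) (τ 1) (X 0, y₀)).2) := by
      rw [hp]
      exact Prod.ext (hΦ.fst_momentum (X 1) (X 0)) rfl
    have h6 := ih hτ.tail ⟨hτ.head.nonneg.trans hτ.head.lt.le, hτ.head.le⟩ (X := Fin.tail X)
      (p := (flow H T (τ 0) (τ 1) (X 0, y₀)).2) fun θ => by
        have h1 := h (Fin.cons 0 θ)
        have h3 : (Fin.cons 0 θ : Fin (N + 2) → E d) 1 = θ 0 :=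
          Fin.cons_succ (α := fun _ => E d) 0 θ 0
        have h4 : (Fin.cons 0 θ : Fin (N + 2) → E d) (Fin.last (N + 1)) = θ (Fin.last N) :=
          Fin.cons_succ (α := fun _ => E d) 0 θ (Fin.last N)
        rw [actionDeriv_succ, Fin.tail_cons, h3, h4, Fin.cons_zero, inner_zero_right,
          inner_zero_right, sub_zero, zero_add] at h1
        exact h1
    have h7 : flow H T (τ 1) (τ (Fin.last (N + 1))) (flow H T (τ 0) (τ 1) (X 0, p)) =
        (X (Fin.last (N + 1)), y) := by
      rw [h5]
      exact h6
    rw [← h7]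
    have hlast : τ (Fin.last (N + 1)) ≤ T := by
      rw [← Fin.succ_last]
      exact (hτ (Fin.last N)).le
    refine (hE.flow_flow hτ0.1 hτ.head.lt.le ?_ hlast _).symm
    exact hτ.strictMono.monotone (Fin.le_last _)

/-- The orbits of the flow are critical points of the sum of the actions. -/
lemma actionDeriv_flow (hE : HamiltonianEstimates T c B H) {τ : Fin (N + 1) → ℝ}
    (hτ : HasShortSteps T c τ) (hτ0 : τ 0 ∈ Icc 0 T) (z : E d × E d) (θ : Fin (N + 1) → E d) :
    inner ℝ z.2 (θ 0) + actionDeriv H T τ (fun i => (flow H T (τ 0) (τ i) z).1) θ =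
      inner ℝ (flow H T (τ 0) (τ (Fin.last N)) z).2 (θ (Fin.last N)) := by
  induction N generalizing z with
  | zero => simp [actionDeriv, hE.flow_self hτ0]
  | succ N ih =>
    obtain ⟨κ, C, hΦ⟩ := hE.exists_isTwistMap hτ.head
    have h1 : momentum (flow H T (τ 0) (τ 1)) (flow H T (τ 0) (τ 1) z).1 z.1 = z.2 :=
      hΦ.momentum_fst z.1 z.2
    have hle : ∀ j : Fin (N + 2), τ j ≤ T := fun j =>
      (hτ.strictMono.monotone (Fin.le_last j)).trans (by
        rw [← Fin.succ_last]
        exact (hτ (Fin.last N)).le)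
    have hff : ∀ j : Fin (N + 1), flow H T (Fin.tail τ 0) (Fin.tail τ j)
        (flow H T (τ 0) (τ 1) z) = flow H T (τ 0) (τ j.succ) z := fun j =>
      hE.flow_flow hτ0.1 hτ.head.lt.le (hτ.tail.strictMono.monotone (Fin.zero_le j)) (hle _) z
    have h2 := ih hτ.tail ⟨hτ.head.nonneg.trans hτ.head.lt.le, hτ.head.le⟩
      (flow H T (τ 0) (τ 1) z) (Fin.tail θ)
    simp only [hff] at h2
    rw [actionDeriv_succ, hE.flow_self hτ0, h1]
    have h3 : (θ 1 : E d) = Fin.tail θ 0 := rfl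
    have h4 : actionDeriv H T (Fin.tail τ) (Fin.tail fun i => (flow H T (τ 0) (τ i) z).1)
        (Fin.tail θ) = actionDeriv H T (Fin.tail τ) (fun i => (flow H T (τ 0) (τ i.succ) z).1)
        (Fin.tail θ) := rfl
    rw [h3, h4]
    rw [show θ (Fin.last (N + 1)) = Fin.tail θ (Fin.last N) from rfl,
      show Fin.last (N + 1) = (Fin.last N).succ from rfl]
    rw [← h2]
    change inner ℝ z.2 (θ 0) + (inner ℝ (flow H T (τ 0) (τ 1) z).2 (Fin.tail θ 0) -
      inner ℝ z.2 (θ 0) + _) = _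
    ring

end HamiltonianEstimates

/-- The sum of the actions. -/
def actionSum (H : ℝ → E d → E d → ℝ) (T : ℝ) (τ : Fin (N + 1) → ℝ) (w : E d × (Fin N → E d)) :
    ℝ :=
  ∑ i : Fin N, classicalGenFun H T (τ i.castSucc) (τ i.succ) (nodes w.1 w.2 i.succ)
    (nodes w.1 w.2 i.castSucc)

/-- The points `x_0, …, x_N` as linear maps of `(x_N, (x_0, …, x_{N-1}))`. -/
def nodeCLM (d : ℕ) {N : ℕ} (j : Fin (N + 1)) : E d × (Fin N → E d) →L[ℝ] E d :=
  Fin.lastCases (motive := fun _ => E d × (Fin N → E d) →L[ℝ] E d)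
    (ContinuousLinearMap.fst ℝ _ _)
    (fun i => (ContinuousLinearMap.proj i).comp (ContinuousLinearMap.snd ℝ _ _)) j

lemma nodeCLM_apply (j : Fin (N + 1)) (w : E d × (Fin N → E d)) :
    nodeCLM d j w = nodes w.1 w.2 j := by
  refine Fin.lastCases ?_ (fun i => ?_) j <;> simp [nodes, nodeCLM]

namespace HamiltonianEstimates

lemma hasFDerivAt_actionSum (hE : HamiltonianEstimates T c B H) {τ : Fin (N + 1) → ℝ}
    (hτ : HasShortSteps T c τ) (w : E d × (Fin N → E d)) :
    ContDiff ℝ 1 (actionSum H T τ) ∧ ∀ u, fderiv ℝ (actionSum H T τ) w u =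
      actionDeriv H T τ (nodes w.1 w.2) (nodes u.1 u.2) := by
  choose κ C hΦ using fun i : Fin N => hE.exists_isTwistMap (hτ i)
  let π : Fin N → (E d × (Fin N → E d) →L[ℝ] E d × E d) := fun i =>
    (nodeCLM d i.succ).prod (nodeCLM d i.castSucc)
  have e : actionSum H T τ = fun w => ∑ i : Fin N,
      (fun z : E d × E d => actionGenFun (flow H T (τ i.castSucc) (τ i.succ))
        (action H T (τ i.castSucc) (τ i.succ)) z.1 z.2) (π i w) := by
    ext w
    simp only [actionSum, π, ContinuousLinearMap.prod_apply, nodeCLM_apply]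
    rfl
  constructor
  · rw [e]
    exact ContDiff.sum fun i _ => (hΦ i).contDiff_actionGenFun.comp (π i).contDiff
  · intro u
    have h1 := HasFDerivAt.fun_sum (u := Finset.univ) (x := w) fun i (_ : i ∈ Finset.univ) =>
      ((hΦ i).hasFDerivAt_actionGenFun (π i w)).comp w (π i).hasFDerivAt
    rw [e]
    refine (congrArg (fun l : E d × (Fin N → E d) →L[ℝ] ℝ => l u) h1.fderiv).trans ?_
    simp only [sum_apply, actionDeriv, ContinuousLinearMap.comp_apply, sub_apply, π,
      ContinuousLinearMap.prod_apply, nodeCLM_apply, ContinuousLinearMap.coe_fst',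
      ContinuousLinearMap.coe_snd', innerSL_apply_apply]

/-- The family of actions is a generating family. -/
theorem isGeneratingFamily_minFamily (hE : HamiltonianEstimates T c B H) {τ : Fin (N + 1) → ℝ}
    (hτ : HasShortSteps T c τ) (hτ0 : τ 0 ∈ Icc 0 T) {v : E d → ℝ} (hv : IsLip v) :
    IsGeneratingFamily (minFamily H T τ v)
      (flow H T (τ 0) (τ (Fin.last N)) '' clarkeGraph v) := by
  have hG := (hE.hasFDerivAt_actionSum hτ (0 : E d × (Fin N → E d))).1
  have hmf : (fun w : E d × (Fin N → E d) => minFamily H T τ v w.1 w.2) =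
      fun w => v (nodeCLM d 0 w) + actionSum H T τ w := by
    ext w
    rw [nodeCLM_apply]
    rfl
  -- The diagonal is a section of the projection to node 0 for all N, including N = 0, where that
  -- node is x itself.
  obtain ⟨ι, hι⟩ : ∃ ι : E d →L[ℝ] E d × (Fin N → E d),
      (nodeCLM d 0).comp ι = ContinuousLinearMap.id ℝ (E d) := by
    refine ⟨(ContinuousLinearMap.id ℝ (E d)).prod (ContinuousLinearMap.pi fun _ =>
      ContinuousLinearMap.id ℝ (E d)), ?_⟩
    ext1 z
    rw [ContinuousLinearMap.comp_apply, nodeCLM_apply]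
    simp only [ContinuousLinearMap.prod_apply, ContinuousLinearMap.id_apply]
    refine Fin.lastCases (motive := fun j => nodes z _ j = z) ?_ (fun i => ?_) (0 : Fin (N + 1)) <;>
      simp [nodes]
  refine ⟨?_, ?_⟩
  · rw [hmf]
    obtain ⟨L, hL⟩ := hv
    intro w
    obtain ⟨K, t, ht, hK⟩ := hG.locallyLipschitz w
    refine ⟨_, t, ht, ((hL.comp (nodeCLM d 0).lipschitz).lipschitzOnWith (s := t)).add hK⟩
  · ext z
    simp only [mem_ofPred_eq]
    rw [hmf]
    simp only [clarke_comp_add hG hι]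
    -- The pair (last node, other nodes) ranges over all families of N + 1 vectors, so equality of
    -- linear forms is the stationarity condition tested on arbitrary θ.
    have hcond : ∀ (q : Fin N → E d) (l : E d →L[ℝ] ℝ),
        l.comp (nodeCLM d 0) + fderiv ℝ (actionSum H T τ) (z.1, q) =
          (innerSL ℝ z.2).comp (ContinuousLinearMap.fst ℝ (E d) (Fin N → E d)) ↔
        ∀ θ : Fin (N + 1) → E d, l (θ 0) + actionDeriv H T τ (nodes z.1 q) θ =
          inner ℝ z.2 (θ (Fin.last N)) := by
      intro q l
      constructor
      · intro h θ
        have h1 := congrArg (fun m : E d × (Fin N → E d) →L[ℝ] ℝ =>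
          m (θ (Fin.last N), Fin.init θ)) h
        have h2 : nodes (θ (Fin.last N)) (Fin.init θ) = θ := Fin.snoc_init_self θ
        simp only [add_apply, ContinuousLinearMap.comp_apply, nodeCLM_apply,
          (hE.hasFDerivAt_actionSum hτ (z.1, q)).2, h2, ContinuousLinearMap.coe_fst',
          innerSL_apply_apply] at h1
        exact h1
      · intro h
        refine ContinuousLinearMap.ext fun u => ?_
        have h1 := h (nodes u.1 u.2)
        simp only [add_apply, ContinuousLinearMap.comp_apply, nodeCLM_apply,
          (hE.hasFDerivAt_actionSum hτ (z.1, q)).2, ContinuousLinearMap.coe_fst',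
          innerSL_apply_apply]
        rw [h1]
        congr 1
        simp [nodes]
    constructor
    · rintro ⟨⟨x₀, p⟩, hp, hz⟩
      refine ⟨fun i => (flow H T (τ 0) (τ i.castSucc) (x₀, p)).1, innerSL ℝ p, ?_, ?_⟩
      · rw [nodeCLM_apply]
        have : nodes z.1 (fun i : Fin N => (flow H T (τ 0) (τ i.castSucc) (x₀, p)).1) =
            fun j => (flow H T (τ 0) (τ j) (x₀, p)).1 := by
          ext1 j
          refine Fin.lastCases ?_ (fun i => ?_) j <;> simp [nodes, hz]
        simp only [this, hE.flow_self hτ0]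
        exact hp
      · refine (hcond _ _).2 fun θ => ?_
        have : nodes z.1 (fun i : Fin N => (flow H T (τ 0) (τ i.castSucc) (x₀, p)).1) =
            fun j => (flow H T (τ 0) (τ j) (x₀, p)).1 := by
          ext1 j
          refine Fin.lastCases ?_ (fun i => ?_) j <;> simp [nodes, hz]
        rw [this, innerSL_apply_apply, ← hz]
        exact hE.actionDeriv_flow hτ hτ0 (x₀, p) θ
    · rintro ⟨q, l, hl, hq⟩
      have h1 := (hcond q l).1 hq
      set p := (InnerProductSpace.toDual ℝ (E d)).symm l with hp
      have hpl : ∀ u, inner ℝ p u = l u := fun u => InnerProductSpace.toDual_symm_apply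
      refine ⟨(nodes z.1 q 0, p), ?_, ?_⟩
      · rw [nodeCLM_apply] at hl
        have : innerSL ℝ p = l := by
          ext1 u
          rw [innerSL_apply_apply, hpl]
        change innerSL ℝ p ∈ clarke v (nodes z.1 q 0)
        rwa [this]
      · have h2 := hE.flow_eq_of_actionDeriv hτ hτ0 (X := nodes z.1 q) (p := p) (y := z.2)
          fun θ => by rw [hpl]; exact h1 θ
        rw [h2]
        refine Prod.ext ?_ rfl
        simp [nodes]

end HamiltonianEstimates

end GeneratingFamily

end HJ
end

/-! ### Identification of the minmax operator with the iterated minimum -/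

noncomputable section

namespace HJ

section MinmaxOperator

variable {d : ℕ} {T B : ℝ} {H : ℝ → E d → E d → ℝ}

namespace HamiltonianEstimates

lemma isMinmaxValue_iterMin (hE : HamiltonianEstimates T (cH H T) B H) {N : ℕ}
    {τ : Fin (N + 1) → ℝ} (hτ : HasShortSteps T (cH H T) τ) (h0 : 0 ≤ τ 0)
    (h1 : τ (Fin.last N) ≤ T) {v : E d → ℝ} (hv : IsLip v) (x : E d) :
    IsMinmaxValue H T (τ 0) (τ (Fin.last N)) v x (iterMin H T τ v x) := by
  intro M σ hσ
  have hσ' := hσ.hasShortSteps h0 h1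
  rw [hE.iterMin_eq hτ hσ' hσ.1.2.1.symm hσ.1.2.2.symm hv]
  exact hE.isMinmax_genFamily hσ' hv x

/-- The minmax operator is the iterated minimum, for any subdivision with short steps. -/
theorem minmaxOp_eq_iterMin (hE : HamiltonianEstimates T (cH H T) B H) {N : ℕ}
    {τ : Fin (N + 1) → ℝ} (hτ : HasShortSteps T (cH H T) τ) (h0 : 0 ≤ τ 0)
    (h1 : τ (Fin.last N) ≤ T) {v : E d → ℝ} (hv : IsLip v) :
    minmaxOp H T (τ 0) (τ (Fin.last N)) v = iterMin H T τ v := by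
  ext x
  have h2 := hE.isMinmaxValue_iterMin hτ h0 h1 hv x
  have h3 : IsMinmaxValue H T (τ 0) (τ (Fin.last N)) v x
      (minmaxOp H T (τ 0) (τ (Fin.last N)) v x) :=
    Classical.epsilon_spec (p := fun c => IsMinmaxValue H T (τ 0) (τ (Fin.last N)) v x c) ⟨_, h2⟩
  -- The condition on all admissible subdivisions pins down a value only because one exists; here it
  -- is τ itself.
  have hadm := hτ.isAdmissible rfl rfl
  exact isMinmax_unique (h3 N τ hadm) (h2 N τ hadm)

end HamiltonianEstimates

end MinmaxOperator

end HJ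
end

theorem proposition3p4 (d : ℕ) (T : ℝ) (hT : 0 < T) (H : ℝ → HJ.E d → HJ.E d → ℝ)
    (hC2 : ContDiffOn ℝ 2 (fun z : ℝ × HJ.E d × HJ.E d => H z.1 z.2.1 z.2.2)
      (Set.Icc 0 T ×ˢ Set.univ))
    (hconv : ∀ t ∈ Set.Icc 0 T, ∀ x, StrictConvexOn ℝ Set.univ (H t x))
    (hinf : ∃ K : Set (ℝ × HJ.E d × HJ.E d), IsCompact K ∧
      ∀ t ∈ Set.Icc 0 T, ∀ x p, (t, x, p) ∉ K → H t x p = ‖p‖ ^ 2) :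
    -- the minmax operators are well defined and map globally Lipschitz functions to such functions
    (∀ s t, 0 ≤ s → s ≤ t → t ≤ T → ∀ v, HJ.IsLip v →
      (∀ x, HJ.IsMinmaxValue H T s t v x (HJ.minmaxOp H T s t v x)) ∧
      HJ.IsLip (HJ.minmaxOp H T s t v)) ∧
    -- the minmax is the minimum of a finite-dimensional generating family
    (∃ ε > 0,
      (∀ s t, 0 ≤ s → s < t → t ≤ T → t - s < ε →
        HJ.IsClassicalGenFun (HJ.flow H T s t) (HJ.classicalGenFun H T s t)) ∧
      ∀ s t, 0 ≤ s → s < t → t ≤ T → ∀ v, HJ.IsLip v →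
        ∀ (N : ℕ) (τ : Fin (N + 1) → ℝ), HJ.IsSubdivision s t τ →
          (∀ i : Fin N, τ i.succ - τ i.castSucc < ε) →
          HJ.IsGeneratingFamily (HJ.minFamily H T τ v)
            (HJ.flow H T s t '' HJ.clarkeGraph v) ∧
          ∀ x, IsLeast (Set.range (HJ.minFamily H T τ v x)) (HJ.minmaxOp H T s t v x)) ∧
    -- the semigroup property
    (∀ v, HJ.IsLip v → ∀ s t, 0 ≤ s → s ≤ t → t ≤ T → ∀ x,
      HJ.minmaxOp H T 0 t v x = HJ.minmaxOp H T s t (HJ.minmaxOp H T 0 s v) x) := by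
  have hH : HJ.IsAdmissibleHamiltonian T H := ⟨hT, hC2, hconv, hinf⟩
  obtain ⟨B, hE⟩ := hH.exists_estimates
  have hc := hE.c_nonneg
  refine ⟨fun s t hs hst ht v hv => ?_, ?_, fun v hv s t hs hst ht x => ?_⟩
  · obtain ⟨N, τ, hτ, rfl, rfl⟩ := HJ.exists_hasShortSteps hc hs hst ht
    rw [hE.minmaxOp_eq_iterMin hτ hs ht hv]
    exact ⟨hE.isMinmaxValue_iterMin hτ hs ht hv, hE.isLip_iterMin hτ hv⟩
  · have hlog := Real.log_pos one_lt_two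
    have hshort : ∀ r, r < Real.log 2 / (HJ.cH H T + 1) → HJ.cH H T * r < Real.log 2 := by
      intro r hr
      have h1 : HJ.cH H T * r ≤ HJ.cH H T * (Real.log 2 / (HJ.cH H T + 1)) := by gcongr
      refine h1.trans_lt ?_
      rw [mul_div_assoc', div_lt_iff₀ (by positivity)]
      nlinarith
    -- This ε depends only on c_H, and steps shorter than it satisfy c_H(t-s) < ln 2 even when c_H =
    -- 0.
    refine ⟨Real.log 2 / (HJ.cH H T + 1), by positivity, fun s t hs hst ht h => ?_,
      fun s t hs hst ht v hv N τ hsub hstep => ?_⟩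
    · obtain ⟨κ, C, hΦ⟩ := hE.exists_isTwistMap ⟨hs, hst, ht, hshort _ h⟩
      exact hΦ.isClassicalGenFun
    · have hτ : HJ.HasShortSteps T (HJ.cH H T) τ :=
        HJ.IsAdmissible.hasShortSteps ⟨hsub, fun i => hshort _ (hstep i)⟩ hs ht
      obtain ⟨-, rfl, rfl⟩ := hsub
      refine ⟨hE.isGeneratingFamily_minFamily hτ ⟨hs, hst.le.trans ht⟩ hv, fun x => ?_⟩
      rw [hE.minmaxOp_eq_iterMin hτ hs ht hv]
      exact hE.isLeast_iterMin hτ hv x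
  · obtain ⟨N, τ, hτ, h0, rfl⟩ := HJ.exists_hasShortSteps hc le_rfl hs (hst.trans ht)
    obtain ⟨M, σ, hσ, h1, rfl⟩ := HJ.exists_hasShortSteps hc hs hst ht
    -- A subdivision of [0,s] followed by one of [s,t] is a subdivision of [0,t], along which the
    -- iterated minimum is the composition.
    obtain ⟨K, ρ, hρ, h2, h3, h4⟩ := HJ.exists_iterMin_comp hτ hσ h1.symm v
    have e1 : HJ.minmaxOp H T 0 (τ (Fin.last N)) v = HJ.iterMin H T τ v := by
      have := hE.minmaxOp_eq_iterMin hτ h0.ge (hst.trans ht) hv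
      rwa [h0] at this
    have e2 : HJ.minmaxOp H T (τ (Fin.last N)) (σ (Fin.last M)) (HJ.iterMin H T τ v) =
        HJ.iterMin H T σ (HJ.iterMin H T τ v) := by
      have := hE.minmaxOp_eq_iterMin hσ (h1 ▸ hs) ht (hE.isLip_iterMin hτ hv)
      rwa [h1] at this
    have e3 : HJ.minmaxOp H T 0 (σ (Fin.last M)) v = HJ.iterMin H T ρ v := by
      have := hE.minmaxOp_eq_iterMin hρ (by rw [h2, h0]) (h3.le.trans ht) hv
      rwa [h2, h0, h3] at this
    rw [e1, e2, e3, h4]
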